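/- Let $c_1,\dots,c_M\in\mathbb C$ ($M\ge 2$) be distinct points, $\Omega=\mathbb C\setminus\{c_1,\dots,c_M\}$, and put $r_0=1/\rho+\max_j|c_j|$ with $\rho=\frac12\min_{j\ne k}|c_j-c_k|$. For $t\ge r_0$ let $\Omega_t=\{|z|<t\}\setminus\bigcup_{j}\{|z-c_j|\le 1/t\}$. Let $N\ge1$ and let $f=(f_0:\dots:f_N):\Omega\to\mathbb P^N(\mathbb C)$ be a holomorphic curve, where $f_0,\dots,f_N$ are holomorphic on $\Omega$ without common zeros. With $\|f(z)\|=\max_i|f_i(z)|$ and $r>r_0$, put $$T_f(r)=\frac1{2\pi}\int_0^{2\pi}\log\|f(re^{i\theta})\|\,d\theta+\frac1{2\pi}\sum_{j=1}^M\int_0^{2\pi}\log\|f(c_j+\tfrac1r e^{i\theta})\|\,d\theta .$$ For a hypersurface $D=\{Q=0\}$ given by a homogeneous polynomial $Q$ with $Q(f)=Q(f_0,\dots,f_N)\not\equiv0$, let $n_f(t,D)$ be the number of zeros of $Q(f)$ in $\overline{\Omega_t}$ counted with multiplicity, let $n_f^{\delta}(t,D)$ be the same number where each zero of multiplicity greater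 than $\delta$ is counted only $\delta$ times, and put $N_f(r,D)=\int_{r_0}^r n_f(t,D)\,\frac{dt}t$ and $N_f^{\delta}(r,D)=\int_{r_0}^r n_f^{\delta}(t,D)\,\frac{dt}t$. Assume that $f$ is algebraically nondegenerate, i.e. its image is contained in no proper algebraic subset of $\mathbb P^N(\mathbb C)$, and, in the case $N=1$, that $f$ is not a rational map, i.e. is not of the form $(p_0:p_1)$ with polynomials $p_0,p_1\in\mathbb C[z]$ not both zero. Let $d\ge 0$ and $n$ be integers with $n>N(d+N+1)$. Let $\mathcal H_0,\dots,\mathcal H_N$ be linear forms and $Q_0,\dots,Q_N$ homogeneous polynomials of degree $d$ in $\mathbb C[x_0,\dots,x_N]$ such that the hypersurfaces $\{\mathcal H_i^nQ_i=0\}$, $0\le i\le N$, of $\mathbb P^N(\mathbb C)$ are in general position, i.e. have no common point. Put $D_i=\{Q_i=0\}$ and $D=\{\sum_{i=0}^N\mathcal H_i^nQ_i=0\}$. Then $$(n-(d+N+1)N)\,T_f(r)+\sum_{i=0}^N\bigl(N_f(r,D_i)-N_f^N(r,D_i)\bigr)\le N_f^N(r,D)+o(T_f(r))$$ for all $r\in(r_0,+\infty)$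 outside a set of finite Lebesgue measure, where $o(T_f(r))$ refers to $r\to+\infty$. -/

import Mathlib

namespace PuncturedPlane

/-- The punctured plane `Ω = ℂ \ {c₁, …, c_M}`. -/
def Omega {M : ℕ} (c : Fin M → ℂ) : Set ℂ := (Set.range c)ᶜ

/-- `(1/2) min {|c_j - c_k| : j ≠ k}`. -/
noncomputable def halfMinDist {M : ℕ} (c : Fin M → ℂ) : ℝ :=
  (1 / 2) * ⨅ p : {p : Fin M × Fin M // p.1 ≠ p.2}, ‖c p.1.1 - c p.1.2‖

/-- `r₀ = 1/d + max_j |c_j|`, where `d` is half the minimal distance of the punctures. -/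
noncomputable def rZero {M : ℕ} (c : Fin M → ℂ) : ℝ :=
  1 / halfMinDist c + ⨆ j, ‖c j‖

/-- `Ω_t = D_t(0) \ ⋃_j closure (D_{1/t}(c_j))`. -/
def OmegaR {M : ℕ} (c : Fin M → ℂ) (t : ℝ) : Set ℂ :=
  Metric.ball 0 t \ ⋃ j, Metric.closedBall (c j) (1 / t)

/-- `f = (f_0 : … : f_N)` is a holomorphic curve `Ω → ℙ^N(ℂ)` given by a reduced representation:
the coordinates are holomorphic on `Ω` and have no common zero there. -/
structure IsHolomorphicCurve {M N : ℕ} (c : Fin M → ℂ) (f : ℂ → Fin (N + 1) → ℂ) : Prop where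
  holomorphic : ∀ i, DifferentiableOn ℂ (fun z => f z i) (Omega c)
  no_common_zero : ∀ z ∈ Omega c, ∃ i, f z i ≠ 0

/-- The image of `f` lies in no proper algebraic subset of `ℙ^N(ℂ)`: every set of homogeneous
polynomials that vanish on the image of `f` vanishes on all of `ℙ^N(ℂ)`. -/
def IsAlgebraicallyNondegenerate {M N : ℕ} (c : Fin M → ℂ) (f : ℂ → Fin (N + 1) → ℂ) : Prop :=
  ∀ S : Set (MvPolynomial (Fin (N + 1)) ℂ),
    (∀ P ∈ S, ∃ k, P.IsHomogeneous k) →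
    (∀ z ∈ Omega c, ∀ P ∈ S, MvPolynomial.eval (f z) P = 0) →
    ∀ x : Fin (N + 1) → ℂ, x ≠ 0 → ∀ P ∈ S, MvPolynomial.eval x P = 0

/-- The curve `f` is rational: it agrees on `Ω` with `(p_0 : … : p_N)` for some polynomials `p_i`
in one variable, not all zero. -/
def IsRationalCurve {M N : ℕ} (c : Fin M → ℂ) (f : ℂ → Fin (N + 1) → ℂ) : Prop :=
  ∃ p : Fin (N + 1) → Polynomial ℂ, p ≠ 0 ∧
    ∀ z ∈ Omega c, ∀ i j, f z i * (p j).eval z = f z j * (p i).eval z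

/-- The hypersurfaces `{P_i = 0}` of `ℙ^N(ℂ)` are in general position: any `N + 1` of them have
no common point. -/
def InGeneralPosition {N q : ℕ} (P : Fin q → MvPolynomial (Fin (N + 1)) ℂ) : Prop :=
  ∀ s : Finset (Fin q), s.card = N + 1 →
    ¬ ∃ x : Fin (N + 1) → ℂ, x ≠ 0 ∧ ∀ i ∈ s, MvPolynomial.eval x (P i) = 0

/-- The characteristic function `T_f(r)`. Here `‖f z‖ = max_i |f_i z|` (the norm of a `Pi` type),
and `Real.circleAverage g a R` is `(1/2π) ∫_0^{2π} g (a + R e^{iθ}) dθ`. -/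
noncomputable def characteristic {M N : ℕ} (c : Fin M → ℂ) (f : ℂ → Fin (N + 1) → ℂ)
    (r : ℝ) : ℝ :=
  Real.circleAverage (fun z => Real.log ‖f z‖) 0 r +
    ∑ j, Real.circleAverage (fun z => Real.log ‖f z‖) (c j) (1 / r)

/-- `n_f(t, D)`: the number of zeros of `Q(f)` in the closure of `Ω_t`, with multiplicity. -/
noncomputable def zeroCount {M N : ℕ} (c : Fin M → ℂ) (f : ℂ → Fin (N + 1) → ℂ)
    (Q : MvPolynomial (Fin (N + 1)) ℂ) (t : ℝ) : ℕ :=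
  ∑ᶠ z ∈ closure (OmegaR c t), (analyticOrderAt (fun w => MvPolynomial.eval (f w) Q) z).toNat

/-- `n_f^δ(t, D)`: zeros of multiplicity greater than `δ` are counted `δ` times. -/
noncomputable def truncZeroCount {M N : ℕ} (c : Fin M → ℂ) (f : ℂ → Fin (N + 1) → ℂ)
    (δ : ℕ) (Q : MvPolynomial (Fin (N + 1)) ℂ) (t : ℝ) : ℕ :=
  ∑ᶠ z ∈ closure (OmegaR c t),
    min (analyticOrderAt (fun w => MvPolynomial.eval (f w) Q) z).toNat δ

/-- The counting function `N_f(r, D)`, for `D = {Q = 0}`. -/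
noncomputable def counting {M N : ℕ} (c : Fin M → ℂ) (f : ℂ → Fin (N + 1) → ℂ)
    (Q : MvPolynomial (Fin (N + 1)) ℂ) (r : ℝ) : ℝ :=
  ∫ t in (rZero c)..r, (zeroCount c f Q t : ℝ) / t

/-- The truncated counting function `N_f^δ(r, D)`, for `D = {Q = 0}`. -/
noncomputable def truncCounting {M N : ℕ} (c : Fin M → ℂ) (f : ℂ → Fin (N + 1) → ℂ)
    (δ : ℕ) (Q : MvPolynomial (Fin (N + 1)) ℂ) (r : ℝ) : ℝ :=
  ∫ t in (rZero c)..r, (truncZeroCount c f δ Q t : ℝ) / t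

end PuncturedPlane

/-! ### Geometry of the exhaustion of the punctured plane. -/

section

open Set Filter Topology Metric

namespace PuncturedPlane

/-! The argument is Cartan's, with Wronskians. Put `P i = H i ^ n * Q i`, forms of degree `e = n +
d` without common zero, and `g i = P i (f)`. By Krull's height theorem, `N` forms in `N + 1`
variables have a common zero other than the origin, so the `P i` are linearly independent
(`eq_zero_of_linear_relation`). Since `f` is algebraically nondegenerate, the Wronskian `W` of the
`g i` is then not identically zero.

The Wronskian does not change when one `g k` is replaced by `∑ g i`. Writing its entries through
logarithmic derivatives gives, for every `k`, the pointwise bound `log |g k| ≤ ∑ log |g i| + log |∑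
g i| - log |W| + error` (`log_norm_le_sum_sub_log_wronskian`). At each point some `|g k|` dominates
a multiple of `‖f‖ ^ e`. Averaging over the boundary circles and applying Jensen's formula
(`weightCounting_order_eq`) turns the left side into `e T` and the right side into counting
functions. The zeros of `W` absorb the multiplicities beyond `N`
(`sum_order_le_order_wronskian_add`). The result is `second_main_theorem`: `(n + d) T` is at most
the sum of the `N`-truncated counting functions of the `P i` and of their sum, up to an error.

Each zero of `H i` costs at most `N` in the truncated count of `P i`, so by the first main theorem
(`exists_weightCounting_eval_le`) that count is at most `N T` plus the truncated count of `Q i`, up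
to a constant. Adding `∑ N(Q i) ≤ (N + 1) d T + O(1)` and collecting the coefficients of `T` gives
the claim.

Two analytic facts control the error. The first is a lemma on the logarithmic derivative
(`exists_boundary_majorant_log_derivs`) with bound `O(log r + log S + 1)`, where `S` is a monotone
function comparable with `T`. It is proved circle by circle: around each point of a boundary circle
a small circle is chosen on which the mean of `|log |p/q||` is controlled, the zeros nearby are
divided out, and the remaining poles are averaged through the integrable power `|z - a| ^ (-1/2)`
and the concavity of the logarithm. Borel's lemma keeps `S` under control on a collar of width `1 /
S r`, outside a set of radii of finite measure. The monotone `S` comes from Cartan's formula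
`bdryAvg_log_max`.

The second fact is `log r = o(T)` (`eventually_mul_log_le_characteristic`). If `T` were below `K log
r` for arbitrarily large `r`, then `f 0` and all `f 0 + a f i` with `|a| = 1` would have boundedly
many zeros. The quotients `f i / f 0` would then have polynomial growth at infinity and at the
punctures once the poles are removed, hence be rational. For `N = 1` this is excluded by assumption;
for `N ≥ 2` three coordinates proportional to polynomials satisfy a homogeneous relation, against
nondegeneracy. -/

/-- The closed discs of radius `1 / t` about the punctures are disjoint and lie in the open disc of
radius `t` about the origin. -/
structure Separated {M : ℕ} (c : Fin M → ℂ) (t : ℝ) : Prop where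
  pos : 0 < t
  outer : ∀ j, ‖c j‖ + 1 / t < t
  inner : ∀ j k, j ≠ k → 2 / t < ‖c j - c k‖

theorem Separated.mono {M : ℕ} {c : Fin M → ℂ} {t s : ℝ} (h : Separated c t) (hts : t ≤ s) :
    Separated c s := by
  have h0 := h.pos
  have h1 : 1 / s ≤ 1 / t := one_div_le_one_div_of_le h0 hts
  refine ⟨h0.trans_le hts, fun j => ?_, fun j k hjk => ?_⟩
  · have := h.outer j
    linarith
  · have := h.inner j k hjk
    have h2 : 2 / s ≤ 2 / t := div_le_div_of_nonneg_left (by norm_num) h0 hts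
    linarith

theorem separated_rZero {M : ℕ} (hM : 2 ≤ M) {c : Fin M → ℂ} (hc : Function.Injective c) :
    Separated c (rZero c) := by
  set ρ := halfMinDist c with hρ
  set m := ⨆ j, ‖c j‖ with hm
  have hr : rZero c = 1 / ρ + m := rfl
  have hne : (⟨0, by omega⟩ : Fin M) ≠ ⟨1, by omega⟩ := by simp
  have : Nonempty {p : Fin M × Fin M // p.1 ≠ p.2} := ⟨⟨(⟨0, by omega⟩, ⟨1, by omega⟩), hne⟩⟩
  have hle : ∀ j k, j ≠ k → 2 * ρ ≤ ‖c j - c k‖ := by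
    intro j k hjk
    have := ciInf_le (Set.finite_range
      (fun p : {p : Fin M × Fin M // p.1 ≠ p.2} => ‖c p.1.1 - c p.1.2‖)).bddBelow ⟨(j, k), hjk⟩
    have h2 : 2 * ρ = ⨅ p : {p : Fin M × Fin M // p.1 ≠ p.2}, ‖c p.1.1 - c p.1.2‖ := by
      rw [hρ, halfMinDist]; ring
    rw [h2]; exact this
  have hρ0 : 0 < ρ := by
    obtain ⟨p, hp⟩ := exists_eq_ciInf_of_finite
      (f := fun p : {p : Fin M × Fin M // p.1 ≠ p.2} => ‖c p.1.1 - c p.1.2‖)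
    rw [hρ, halfMinDist, ← hp]
    have : c p.1.1 - c p.1.2 ≠ 0 := sub_ne_zero.2 (fun h => p.2 (hc h))
    positivity
  have hcm : ∀ j, ‖c j‖ ≤ m := fun j => le_ciSup (Set.finite_range fun j => ‖c j‖).bddAbove j
  -- `2ρ ≤ |c_j - c_k| ≤ 2m` for two distinct punctures, so `m > 0` and `r₀ > ρ`. The first gives
  -- `1/r₀ < ρ`, so the discs are disjoint; the second gives `1/r₀ < 1/ρ = r₀ - m`, so they lie
  -- inside the large disc.
  have hρm : ρ ≤ m := by
    have h1 := hle _ _ hne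
    have h2 := norm_sub_le (c ⟨0, by omega⟩) (c ⟨1, by omega⟩)
    have h3 := hcm ⟨0, by omega⟩
    have h4 := hcm ⟨1, by omega⟩
    linarith
  have hi : 0 < 1 / ρ := by positivity
  have ht : 0 < 1 / ρ + m := by linarith
  have h1 : 1 / (1 / ρ + m) < ρ := by
    rw [div_lt_iff₀ ht]
    have : ρ * (1 / ρ) = 1 := by field_simp
    nlinarith [mul_pos hρ0 (hρ0.trans_le hρm)]
  have h2 : 1 / (1 / ρ + m) < 1 / ρ := one_div_lt_one_div_of_lt hρ0 (by linarith)
  rw [hr]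
  refine ⟨ht, fun j => ?_, fun j k hjk => ?_⟩
  · have := hcm j
    linarith
  · have := hle j k hjk
    have h3 : 2 / (1 / ρ + m) = 2 * (1 / (1 / ρ + m)) := by ring
    linarith

/-- The closed region bounded by the circle of radius `t` about the origin and the circles of
radius `1 / t` about the punctures. -/
def closedRegion {M : ℕ} (c : Fin M → ℂ) (t : ℝ) : Set ℂ :=
  {z | ‖z‖ ≤ t ∧ ∀ j, 1 / t ≤ ‖z - c j‖}

theorem isCompact_closedRegion {M : ℕ} (c : Fin M → ℂ) (t : ℝ) :
    IsCompact (closedRegion c t) := by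
  refine (isCompact_closedBall (0 : ℂ) t).of_isClosed_subset ?_ fun z hz => by simpa using hz.1
  rw [show closedRegion c t = {z | ‖z‖ ≤ t} ∩ ⋂ j, {z | 1 / t ≤ ‖z - c j‖} by
    ext z; simp [closedRegion]]
  exact (isClosed_le (by fun_prop) (by fun_prop)).inter
    (isClosed_iInter fun j => isClosed_le (by fun_prop) (by fun_prop))

theorem closedRegion_subset_Omega {M : ℕ} {c : Fin M → ℂ} {t : ℝ} (ht : 0 < t) :
    closedRegion c t ⊆ Omega c := by
  rintro z hz ⟨j, rfl⟩
  have := hz.2 j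
  have h2 : 0 < 1 / t := by positivity
  simp at this
  linarith

theorem closedRegion_mono {M : ℕ} {c : Fin M → ℂ} {s t : ℝ} (hs : 0 < s) (h : s ≤ t) :
    closedRegion c s ⊆ closedRegion c t := fun _ hz =>
  ⟨hz.1.trans h, fun j => (one_div_le_one_div_of_le hs h).trans (hz.2 j)⟩

theorem isOpen_Omega {M : ℕ} (c : Fin M → ℂ) : IsOpen (Omega c) :=
  (Set.finite_range c).isClosed.isOpen_compl

theorem isPreconnected_Omega {M : ℕ} (c : Fin M → ℂ) : IsPreconnected (Omega c) := by
  have h := (Set.finite_range c).countable.isPathConnected_compl_of_one_lt_rank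
    (by rw [Complex.rank_real_complex]; norm_num)
  exact h.isConnected.isPreconnected

theorem Separated.outer_circle_subset {M : ℕ} {c : Fin M → ℂ} {t : ℝ} (h : Separated c t) :
    sphere 0 t ⊆ closedRegion c t := by
  intro z hz
  have hz' : ‖z‖ = t := by simpa using hz
  refine ⟨hz'.le, fun j => ?_⟩
  have := norm_sub_norm_le z (c j)
  have := h.outer j
  linarith

theorem Separated.inner_circle_subset {M : ℕ} {c : Fin M → ℂ} {t : ℝ} (h : Separated c t)
    (j : Fin M) : sphere (c j) (1 / t) ⊆ closedRegion c t := by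
  intro z hz
  have hz' : ‖z - c j‖ = 1 / t := by simpa [dist_eq_norm] using hz
  refine ⟨?_, fun k => ?_⟩
  · have := norm_sub_norm_le z (c j)
    have := h.outer j
    linarith
  · rcases eq_or_ne j k with rfl | hjk
    · exact hz'.ge
    · have h1 := h.inner j k hjk
      have h2 : ‖c j - c k‖ ≤ ‖z - c j‖ + ‖z - c k‖ := by
        have := norm_sub_le (z - c k) (z - c j)
        simp at this
        linarith
      have h3 : 2 / t = 2 * (1 / t) := by ring
      linarith

/-- The boundary circles are disjoint, so at a point of the closed region at most one constraint is
an equality. Moving towards the origin, or away from the puncture in question, makes it strict and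
preserves the others. Hence the zero counts, defined over `closure (OmegaR c t)`, range over
`closedRegion c t`. -/
theorem Separated.closure_OmegaR {M : ℕ} {c : Fin M → ℂ} {t : ℝ} (h : Separated c t) :
    closure (OmegaR c t) = closedRegion c t := by
  have ht := h.pos
  have hsub : OmegaR c t ⊆ closedRegion c t := by
    rintro z ⟨hz, hz'⟩
    simp only [mem_iUnion, not_exists, mem_closedBall, dist_eq_norm, not_le] at hz'
    exact ⟨by simpa using (mem_ball_zero_iff.1 hz).le, fun j => (hz' j).le⟩
  refine Subset.antisymm
    (closure_minimal hsub (isCompact_closedRegion c t).isClosed) fun z hz => ?_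
  -- push `z` by `s • v`, towards the interior
  suffices H : ∃ v : ℂ, ∀ᶠ s : ℝ in 𝓝[>] 0, z + (s : ℂ) * v ∈ OmegaR c t by
    obtain ⟨v, hv⟩ := H
    have ht : Tendsto (fun s : ℝ => z + (s : ℂ) * v) (𝓝[>] 0) (𝓝 z) := by
      have : Continuous (fun s : ℝ => z + (s : ℂ) * v) := by fun_prop
      simpa using (this.tendsto 0).mono_left nhdsWithin_le_nhds
    exact mem_closure_of_tendsto ht hv
  have key : ∀ v : ℂ, (‖z‖ < t ∨ v = -z) → (∀ j, 1 / t < ‖z - c j‖ ∨ v = z - c j) →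
      ∀ᶠ s : ℝ in 𝓝[>] 0, z + (s : ℂ) * v ∈ OmegaR c t := by
    intro v h1 h2
    have hc : Tendsto (fun s : ℝ => z + (s : ℂ) * v) (𝓝[>] 0) (𝓝 z) := by
      have : Continuous (fun s : ℝ => z + (s : ℂ) * v) := by fun_prop
      simpa using (this.tendsto 0).mono_left nhdsWithin_le_nhds
    have e1 : ∀ᶠ s : ℝ in 𝓝[>] 0, ‖z + (s : ℂ) * v‖ < t := by
      rcases h1 with h1 | rfl
      · exact (hc.norm).eventually (gt_mem_nhds h1)
      · filter_upwards [Ioo_mem_nhdsGT (show (0 : ℝ) < 1 by norm_num)] with s hs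
        have : z + (s : ℂ) * -z = ((1 - s : ℝ) : ℂ) * z := by push_cast; ring
        rw [this, norm_mul, Complex.norm_real, Real.norm_of_nonneg (by linarith [hs.2])]
        rcases (norm_nonneg z).eq_or_lt with h0 | h0
        · rw [← h0]; simpa using ht
        · have := hz.1
          nlinarith [hs.1]
    have e2 : ∀ᶠ s : ℝ in 𝓝[>] 0, ∀ j, 1 / t < ‖z + (s : ℂ) * v - c j‖ := by
      rw [eventually_all]
      intro j
      rcases h2 j with h2 | rfl
      · exact ((hc.sub_const _).norm).eventually (lt_mem_nhds h2)
      · filter_upwards [self_mem_nhdsWithin] with s hs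
        have hs : (0 : ℝ) < s := hs
        have : z + (s : ℂ) * (z - c j) - c j = ((1 + s : ℝ) : ℂ) * (z - c j) := by push_cast; ring
        rw [this, norm_mul, Complex.norm_real, Real.norm_of_nonneg (by linarith)]
        have h3 := hz.2 j
        have : 0 < 1 / t := by positivity
        nlinarith
    filter_upwards [e1, e2] with s h3 h4
    refine ⟨by simpa using h3, ?_⟩
    simp only [mem_iUnion, not_exists, mem_closedBall, dist_eq_norm, not_le]
    exact h4
  rcases hz.1.lt_or_eq with h1 | h1
  · by_cases h2 : ∀ j, 1 / t < ‖z - c j‖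
    · exact ⟨0, key 0 (Or.inl h1) fun j => Or.inl (h2 j)⟩
    · push Not at h2
      obtain ⟨j, hj⟩ := h2
      refine ⟨z - c j, key _ (Or.inl h1) fun k => ?_⟩
      rcases eq_or_ne j k with rfl | hjk
      · exact Or.inr rfl
      · left
        have h1 := h.inner j k hjk
        have h2 : ‖c j - c k‖ ≤ ‖z - c j‖ + ‖z - c k‖ := by
          have := norm_sub_le (z - c k) (z - c j)
          simp at this
          linarith
        have h3 : 2 / t = 2 * (1 / t) := by ring
        linarith
  · refine ⟨-z, key _ (Or.inr rfl) fun j => Or.inl ?_⟩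
    have := norm_sub_norm_le z (c j)
    have := h.outer j
    linarith

/-! ### Averages over the boundary circles. -/

/-- The sum of the circle averages over the boundary circles of `closedRegion c t`. -/
noncomputable def bdryAvg {M : ℕ} (c : Fin M → ℂ) (u : ℂ → ℝ) (t : ℝ) : ℝ :=
  Real.circleAverage u 0 t + ∑ j, Real.circleAverage u (c j) (1 / t)

/-- Integrability over each of the boundary circles of `closedRegion c t`. -/
def BdryIntegrable {M : ℕ} (c : Fin M → ℂ) (u : ℂ → ℝ) (t : ℝ) : Prop :=
  CircleIntegrable u 0 t ∧ ∀ j, CircleIntegrable u (c j) (1 / t)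

section bdryAvg
variable {M : ℕ} {c : Fin M → ℂ} {u v : ℂ → ℝ} {t : ℝ}

theorem BdryIntegrable.add (hu : BdryIntegrable c u t) (hv : BdryIntegrable c v t) :
    BdryIntegrable c (fun z => u z + v z) t :=
  ⟨hu.1.add hv.1, fun j => (hu.2 j).add (hv.2 j)⟩

theorem BdryIntegrable.sub (hu : BdryIntegrable c u t) (hv : BdryIntegrable c v t) :
    BdryIntegrable c (fun z => u z - v z) t :=
  ⟨hu.1.sub hv.1, fun j => (hu.2 j).sub (hv.2 j)⟩

theorem BdryIntegrable.const_mul (hu : BdryIntegrable c u t) (a : ℝ) :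
    BdryIntegrable c (fun z => a * u z) t :=
  ⟨hu.1.const_fun_smul (a := a), fun j => (hu.2 j).const_fun_smul (a := a)⟩

theorem BdryIntegrable.abs (hu : BdryIntegrable c u t) :
    BdryIntegrable c (fun z => |u z|) t :=
  ⟨hu.1.abs, fun j => (hu.2 j).abs⟩

theorem bdryIntegrable_const (a : ℝ) : BdryIntegrable c (fun _ => a) t :=
  ⟨circleIntegrable_const _ _ _, fun _ => circleIntegrable_const _ _ _⟩

theorem BdryIntegrable.sum {ι : Type*} {s : Finset ι} {u : ι → ℂ → ℝ}
    (hu : ∀ i ∈ s, BdryIntegrable c (u i) t) : BdryIntegrable c (fun z => ∑ i ∈ s, u i z) t :=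
  ⟨CircleIntegrable.fun_sum s fun i hi => (hu i hi).1,
    fun j => CircleIntegrable.fun_sum s fun i hi => (hu i hi).2 j⟩

theorem bdryAvg_add (hu : BdryIntegrable c u t) (hv : BdryIntegrable c v t) :
    bdryAvg c (fun z => u z + v z) t = bdryAvg c u t + bdryAvg c v t := by
  simp only [bdryAvg, Real.circleAverage_fun_add hu.1 hv.1,
    fun j => Real.circleAverage_fun_add (hu.2 j) (hv.2 j), Finset.sum_add_distrib]
  ring

theorem bdryAvg_sub (hu : BdryIntegrable c u t) (hv : BdryIntegrable c v t) :
    bdryAvg c (fun z => u z - v z) t = bdryAvg c u t - bdryAvg c v t := by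
  simp only [bdryAvg, Real.circleAverage_fun_sub hu.1 hv.1,
    fun j => Real.circleAverage_fun_sub (hu.2 j) (hv.2 j), Finset.sum_sub_distrib]
  ring

theorem bdryAvg_const_mul (a : ℝ) :
    bdryAvg c (fun z => a * u z) t = a * bdryAvg c u t := by
  have h := fun (x : ℂ) (r : ℝ) => Real.circleAverage_fun_smul (a := a) (f := u) (c := x) (R := r)
  simp only [smul_eq_mul] at h
  simp only [bdryAvg, h, mul_add, Finset.mul_sum]

theorem bdryAvg_sum {ι : Type*} {s : Finset ι} {u : ι → ℂ → ℝ}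
    (hu : ∀ i ∈ s, BdryIntegrable c (u i) t) :
    bdryAvg c (fun z => ∑ i ∈ s, u i z) t = ∑ i ∈ s, bdryAvg c (u i) t := by
  simp only [bdryAvg, Real.circleAverage_fun_sum fun i hi => (hu i hi).1,
    fun j => Real.circleAverage_fun_sum fun i hi => (hu i hi).2 j, Finset.sum_add_distrib]
  rw [Finset.sum_comm]

theorem bdryAvg_const (a : ℝ) : bdryAvg c (fun _ => a) t = (M + 1) * a := by
  simp [bdryAvg, Real.circleAverage_const]
  ring

/-- `Real.log ‖F z‖` takes the default value `0` at the zeros of `F`, so pointwise inequalities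
between such functions hold only off the zeros. These are countable and meet a circle in a null set
of angles. -/
theorem circleAverage_mono_of_countable {x : ℂ} {r : ℝ} (hr : r ≠ 0) {u v : ℂ → ℝ}
    (hu : CircleIntegrable u x r) (hv : CircleIntegrable v x r) {Z : Set ℂ} (hZ : Z.Countable)
    (h : ∀ z ∈ sphere x |r|, z ∉ Z → u z ≤ v z) :
    Real.circleAverage u x r ≤ Real.circleAverage v x r := by
  unfold Real.circleAverage
  simp only [smul_eq_mul]
  refine mul_le_mul_of_nonneg_left ?_ (by positivity)
  refine intervalIntegral.integral_mono_ae (by positivity) hu hv ?_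
  filter_upwards [MeasureTheory.compl_mem_ae_iff.2
    ((hZ.preimage_circleMap x hr).measure_zero MeasureTheory.volume)] with θ hθ
  exact h _ (circleMap_mem_sphere' x r θ) hθ

theorem bdryAvg_mono (ht : 0 < t) (hu : BdryIntegrable c u t) (hv : BdryIntegrable c v t)
    {Z : Set ℂ} (hZ : Z.Countable)
    (h : ∀ z, (z ∈ sphere 0 t ∨ ∃ j, z ∈ sphere (c j) (1 / t)) → z ∉ Z → u z ≤ v z) :
    bdryAvg c u t ≤ bdryAvg c v t := by
  have ht' : 0 < 1 / t := by positivity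
  refine add_le_add (circleAverage_mono_of_countable ht.ne' hu.1 hv.1 hZ ?_)
    (Finset.sum_le_sum fun j _ =>
      circleAverage_mono_of_countable ht'.ne' (hu.2 j) (hv.2 j) hZ ?_)
  · rw [abs_of_pos ht]; exact fun z hz => h z (Or.inl hz)
  · rw [abs_of_pos ht']; exact fun z hz => h z (Or.inr ⟨j, hz⟩)

theorem bdryAvg_congr (ht : 0 < t) (hu : BdryIntegrable c u t) (hv : BdryIntegrable c v t)
    {Z : Set ℂ} (hZ : Z.Countable)
    (h : ∀ z, (z ∈ sphere 0 t ∨ ∃ j, z ∈ sphere (c j) (1 / t)) → z ∉ Z → u z = v z) :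
    bdryAvg c u t = bdryAvg c v t :=
  le_antisymm (bdryAvg_mono ht hu hv hZ fun z hz hz' => (h z hz hz').le)
    (bdryAvg_mono ht hv hu hZ fun z hz hz' => (h z hz hz').ge)

theorem bdryIntegrable_of_continuousOn (h : Separated c t)
    (hu : ContinuousOn u (closedRegion c t)) : BdryIntegrable c u t :=
  ⟨(hu.mono h.outer_circle_subset).circleIntegrable h.pos.le,
    fun j => (hu.mono (h.inner_circle_subset j)).circleIntegrable (one_div_pos.2 h.pos).le⟩

theorem bdryIntegrable_log_norm (h : Separated c t) {F : ℂ → ℂ}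
    (hF : MeromorphicOn F (closedRegion c t)) :
    BdryIntegrable c (fun z => Real.log ‖F z‖) t := by
  have ht' : 0 < 1 / t := one_div_pos.2 h.pos
  refine ⟨MeromorphicOn.circleIntegrable_log_norm ?_,
    fun j => MeromorphicOn.circleIntegrable_log_norm ?_⟩
  · rw [abs_of_pos h.pos]; exact hF.mono_set h.outer_circle_subset
  · rw [abs_of_pos ht']; exact hF.mono_set (h.inner_circle_subset j)

/-- Each circle average of a nonnegative function is at most the sum of all of them. -/
theorem circleAverage_zero_le_bdryAvg (hu : ∀ z, 0 ≤ u z) :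
    Real.circleAverage u 0 t ≤ bdryAvg c u t :=
  le_add_of_nonneg_right (Finset.sum_nonneg fun _ _ =>
    Real.circleAverage_nonneg_of_nonneg fun _ _ => hu _)

theorem circleAverage_puncture_le_bdryAvg (hu : ∀ z, 0 ≤ u z) (j : Fin M) :
    Real.circleAverage u (c j) (1 / t) ≤ bdryAvg c u t :=
  (Finset.single_le_sum (f := fun j => Real.circleAverage u (c j) (1 / t))
    (fun _ _ => Real.circleAverage_nonneg_of_nonneg fun _ _ => hu _) (Finset.mem_univ j)).trans
    (le_add_of_nonneg_left (Real.circleAverage_nonneg_of_nonneg fun _ _ => hu _))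

end bdryAvg
end PuncturedPlane

end

/-! ### Cauchy's theorem for a disc with holes. -/

section

open Set Filter Topology Metric

namespace PuncturedPlane

/-- Differentiation under the integral sign; continuity of `φ` on the circle is enough. Both Cauchy
integrals in the Laurent splitting at a hole are of this kind. -/
theorem differentiableAt_cauchyIntegral {c : ℂ} {s : ℝ} (hs : 0 < s) {φ : ℂ → ℂ}
    (hφ : ContinuousOn φ (sphere c s)) {z₀ : ℂ} (hz₀ : z₀ ∉ sphere c s) :
    DifferentiableAt ℂ (fun z => ∮ w in C(c, s), (w - z)⁻¹ * φ w) z₀ := by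
  have hopen : (sphere c s)ᶜ ∈ 𝓝 z₀ := isClosed_sphere.isOpen_compl.mem_nhds hz₀
  obtain ⟨ε, hε, hb⟩ := Metric.mem_nhds_iff.1 hopen
  have hfar : ∀ θ : ℝ, ∀ z ∈ ball z₀ (ε / 2), ε / 2 ≤ ‖circleMap c s θ - z‖ := by
    intro θ z hz
    by_contra hlt
    push Not at hlt
    refine absurd (circleMap_mem_sphere c hs.le θ) (hb ?_)
    rw [mem_ball, dist_eq_norm] at *
    have := norm_add_le (circleMap c s θ - z) (z - z₀)
    rw [sub_add_sub_cancel] at this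
    linarith
  have hφc : Continuous fun θ : ℝ => φ (circleMap c s θ) :=
    hφ.comp_continuous (continuous_circleMap c s) fun θ => circleMap_mem_sphere c hs.le θ
  have hne : ∀ θ : ℝ, ∀ z ∈ ball z₀ (ε / 2), circleMap c s θ - z ≠ 0 := by
    intro θ z hz h0
    have := hfar θ z hz
    rw [h0, norm_zero] at this
    linarith
  have hd : Continuous fun θ : ℝ => deriv (circleMap c s) θ := by
    simp only [deriv_circleMap]
    fun_prop
  have hz₀' : z₀ ∈ ball z₀ (ε / 2) := mem_ball_self (by linarith)
  obtain ⟨B, hB⟩ := (isCompact_uIcc (a := (0 : ℝ)) (b := 2 * Real.pi)).exists_bound_of_continuousOn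
    (hd.mul hφc).continuousOn
  have := intervalIntegral.hasDerivAt_integral_of_dominated_loc_of_deriv_le
    (μ := MeasureTheory.volume) (a := 0) (b := 2 * Real.pi) (x₀ := z₀) (s := ball z₀ (ε / 2))
    (F := fun z θ => deriv (circleMap c s) θ • ((circleMap c s θ - z)⁻¹ * φ (circleMap c s θ)))
    (F' := fun z θ => deriv (circleMap c s) θ •
      (((circleMap c s θ - z) ^ 2)⁻¹ * φ (circleMap c s θ)))
    (bound := fun _ => ((ε / 2) ^ 2)⁻¹ * B) (ball_mem_nhds _ (by linarith)) ?_ ?_ ?_ ?_ ?_ ?_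
  · exact this.2.differentiableAt
  · filter_upwards [ball_mem_nhds z₀ (show 0 < ε / 2 by linarith)] with z hz
    exact (hd.smul ((((continuous_circleMap c s).sub continuous_const).inv₀
      (fun θ => hne θ z hz)).mul hφc)).aestronglyMeasurable
  · exact (hd.smul ((((continuous_circleMap c s).sub continuous_const).inv₀
      (fun θ => hne θ z₀ hz₀')).mul hφc)).intervalIntegrable _ _
  · exact (hd.smul (((((continuous_circleMap c s).sub continuous_const).pow 2).inv₀
      (fun θ => pow_ne_zero 2 (hne θ z₀ hz₀'))).mul hφc)).aestronglyMeasurable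
  · refine Eventually.of_forall fun θ hθ z hz => ?_
    have h1 := hB θ (uIoc_subset_uIcc hθ)
    have h2 := hfar θ z hz
    rw [smul_eq_mul, show ∀ a b c : ℂ, a * (b * c) = b * (a * c) by intros; ring, norm_mul]
    refine mul_le_mul ?_ h1 (norm_nonneg _) (by positivity)
    rw [norm_inv, norm_pow]
    gcongr
  · simp
  · refine Eventually.of_forall fun θ hθ z hz => ?_
    have h1 : HasDerivAt (fun z : ℂ => circleMap c s θ - z) (-1) z := by
      simpa using (hasDerivAt_id z).const_sub (circleMap c s θ)
    have h2 := ((h1.inv (hne θ z hz)).mul_const (φ (circleMap c s θ))).const_smul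
      (deriv (circleMap c s) θ)
    convert h2 using 1
    · rfl
    · rw [neg_neg, one_div]

theorem circleIntegral_circleIntegral_swap {a b : ℂ} {r s : ℝ} (hr : 0 ≤ r) (hs : 0 ≤ s)
    {F : ℂ → ℂ → ℂ}
    (hF : ContinuousOn (Function.uncurry F) (sphere a r ×ˢ sphere b s)) :
    (∮ z in C(a, r), ∮ w in C(b, s), F z w) = ∮ w in C(b, s), ∮ z in C(a, r), F z w := by
  simp only [circleIntegral, ← intervalIntegral.integral_smul]
  rw [MeasureTheory.intervalIntegral_intervalIntegral_swap]
  · congr 1; ext θ; congr 1; ext η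
    exact smul_comm _ _ _
  · have h1 : Continuous fun p : ℝ × ℝ => F (circleMap a r p.1) (circleMap b s p.2) :=
      hF.comp_continuous (f := fun p : ℝ × ℝ => (circleMap a r p.1, circleMap b s p.2))
        (by fun_prop) fun p => ⟨circleMap_mem_sphere a hr _, circleMap_mem_sphere b hs _⟩
    have h2 : Continuous fun p : ℝ × ℝ => deriv (circleMap a r) p.1 •
        deriv (circleMap b s) p.2 • F (circleMap a r p.1) (circleMap b s p.2) := by
      simp only [deriv_circleMap]
      have h3 : Continuous fun p : ℝ × ℝ => circleMap 0 r p.1 * Complex.I := by fun_prop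
      have h4 : Continuous fun p : ℝ × ℝ => circleMap 0 s p.2 * Complex.I := by fun_prop
      exact h3.smul (h4.smul h1)
    refine (h2.continuousOn.integrableOn_compact
      ((isCompact_uIcc (a := (0 : ℝ)) (b := 2 * Real.pi)).prod
        (isCompact_uIcc (a := (0 : ℝ)) (b := 2 * Real.pi)))).mono_set ?_
    exact prod_mono uIoc_subset_uIcc uIoc_subset_uIcc

/-- Cauchy's formula for an annulus. -/
theorem cauchy_formula_annulus {c : ℂ} {s₀ s₁ : ℝ} (hs : 0 < s₀) (hs' : s₀ < s₁) {φ : ℂ → ℂ}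
    {V : Set ℂ} (hV : IsOpen V) (hsub : closedBall c s₁ \ ball c s₀ ⊆ V)
    (hφ : DifferentiableOn ℂ φ V) {z : ℂ} (hz : z ∈ ball c s₁) (hz' : z ∉ closedBall c s₀) :
    (2 * Real.pi * Complex.I) * φ z =
      (∮ w in C(c, s₁), (w - z)⁻¹ * φ w) - ∮ w in C(c, s₀), (w - z)⁻¹ * φ w := by
  have hzV : z ∈ V := hsub ⟨ball_subset_closedBall hz, fun h => hz' (ball_subset_closedBall h)⟩
  -- The divided difference is holomorphic at `z` too, so its integrals over the two circles agree.
  -- When it is expanded, `1 / (w - z)` contributes `2πi` on the outer circle and `0` on the inner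
  -- one.
  have hd : DifferentiableOn ℂ (dslope φ z) V :=
    (Complex.differentiableOn_dslope (hV.mem_nhds hzV)).2 hφ
  have h1 := Complex.circleIntegral_eq_of_differentiable_on_annulus_off_countable (c := c) hs hs'.le
    countable_empty (hd.continuousOn.mono hsub) fun w hw => (hd.differentiableAt (hV.mem_nhds
      (hsub ⟨ball_subset_closedBall hw.1.1, fun h => hw.1.2 (ball_subset_closedBall h)⟩)))
  have hφs : ∀ s, s₀ ≤ s → s ≤ s₁ → ContinuousOn φ (sphere c s) := fun s h h' =>
    hφ.continuousOn.mono (Subset.trans (fun w hw => by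
      rw [mem_sphere] at hw
      exact ⟨by rw [mem_closedBall]; linarith, by rw [mem_ball]; linarith⟩) hsub)
  have key : ∀ s, s₀ ≤ s → s ≤ s₁ → z ∉ sphere c s →
      (∮ w in C(c, s), dslope φ z w) =
        (∮ w in C(c, s), (w - z)⁻¹ * φ w) - φ z * ∮ w in C(c, s), (w - z)⁻¹ := by
    intro s h h' hzs
    have hs0 : 0 < s := hs.trans_le h
    have hne : ∀ w ∈ sphere c s, w - z ≠ 0 := fun w hw h0 =>
      hzs (by rwa [← sub_eq_zero.1 h0])
    have hinv : ContinuousOn (fun w => (w - z)⁻¹) (sphere c s) :=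
      ContinuousOn.inv₀ (by fun_prop) hne
    have i1 : CircleIntegrable (fun w => (w - z)⁻¹ * φ w) c s :=
      (hinv.mul (hφs s h h')).circleIntegrable hs0.le
    have i2 : CircleIntegrable (fun w => φ z * (w - z)⁻¹) c s :=
      (continuousOn_const.mul hinv).circleIntegrable hs0.le
    rw [← circleIntegral.integral_const_mul, ← circleIntegral.integral_sub i1 i2]
    refine circleIntegral.integral_congr hs0.le fun w hw => ?_
    have hwz : w ≠ z := fun h => hne w hw (sub_eq_zero.2 h)
    simp only [dslope_of_ne _ hwz, slope, vsub_eq_sub, smul_eq_mul]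
    ring
  have hz1 : z ∉ sphere c s₁ := fun h => by rw [mem_sphere] at h; rw [mem_ball] at hz; linarith
  have hz2 : z ∉ sphere c s₀ := fun h => hz' (sphere_subset_closedBall h)
  rw [key s₁ hs'.le le_rfl hz1, key s₀ le_rfl hs'.le hz2,
    circleIntegral.integral_sub_inv_of_mem_ball hz] at h1
  have h0 : (∮ w in C(c, s₀), (w - z)⁻¹) = 0 := by
    refine Complex.circleIntegral_eq_zero_of_differentiable_on_off_countable hs.le countable_empty
      ?_ ?_
    · exact ContinuousOn.inv₀ (by fun_prop) fun w hw h0 => hz' (by rwa [← sub_eq_zero.1 h0])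
    · intro w hw
      refine DifferentiableAt.inv (by fun_prop) fun h0 => hz' ?_
      rw [← sub_eq_zero.1 h0]; exact ball_subset_closedBall hw.1
  rw [h0] at h1
  linear_combination -h1

/-- Splitting off the principal part of a holomorphic function at one hole. -/
theorem exists_extension_across_hole {c : ℂ} {s₀ s₁ : ℝ} (hs : 0 < s₀) (hs' : s₀ < s₁)
    {φ : ℂ → ℂ} {V : Set ℂ} (hV : IsOpen V) (hsub : closedBall c s₁ \ ball c s₀ ⊆ V)
    (hφ : DifferentiableOn ℂ φ V) :
    ∃ φ' : ℂ → ℂ, DifferentiableOn ℂ φ' (V ∪ ball c s₁) ∧ ∀ z ∈ V, z ∉ closedBall c s₀ →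
      φ z = φ' z - (2 * Real.pi * Complex.I)⁻¹ * ∮ w in C(c, s₀), (w - z)⁻¹ * φ w := by
  classical
  have hpi : (2 * Real.pi * Complex.I : ℂ) ≠ 0 := Complex.two_pi_I_ne_zero
  set J : ℝ → ℂ → ℂ := fun s z =>
    (2 * Real.pi * Complex.I)⁻¹ * ∮ w in C(c, s), (w - z)⁻¹ * φ w with hJ
  have hφs : ∀ s, s₀ ≤ s → s ≤ s₁ → ContinuousOn φ (sphere c s) := fun s h h' =>
    hφ.continuousOn.mono (Subset.trans (fun w hw => by
      rw [mem_sphere] at hw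
      exact ⟨by rw [mem_closedBall]; linarith, by rw [mem_ball]; linarith⟩) hsub)
  -- Cauchy's formula for the annulus says that the two branches agree where both make sense; the
  -- outer Cauchy integral extends across the hole.
  set φ' : ℂ → ℂ := fun z => if z ∈ ball c s₁ then J s₁ z else φ z + J s₀ z with hφ'
  have hout : ∀ z ∈ V, z ∉ closedBall c s₀ → φ' z = φ z + J s₀ z := by
    intro z hz hz'
    by_cases h : z ∈ ball c s₁
    · have := cauchy_formula_annulus hs hs' hV hsub hφ h hz'
      simp only [hφ', if_pos h, hJ]
      rw [← sub_eq_iff_eq_add, ← mul_sub, ← this, inv_mul_cancel_left₀ hpi]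
    · exact if_neg h
  refine ⟨φ', fun z hz => ?_, fun z hz hz' => by rw [hout z hz hz']; simp [hJ]⟩
  by_cases h : z ∈ ball c s₁
  · have hd : DifferentiableAt ℂ (J s₁) z :=
      (differentiableAt_cauchyIntegral (hs.trans hs') (hφs s₁ hs'.le le_rfl) (fun h' => by
        rw [mem_sphere] at h'; rw [mem_ball] at h; linarith)).const_mul _
    refine (hd.congr_of_eventuallyEq ?_).differentiableWithinAt
    filter_upwards [isOpen_ball.mem_nhds h] with w hw
    simp only [hφ', if_pos hw]
  · have hzV : z ∈ V := hz.resolve_right h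
    have hz0 : z ∉ closedBall c s₀ := fun h' => h (closedBall_subset_ball hs' h')
    have hd : DifferentiableAt ℂ (fun z => φ z + J s₀ z) z :=
      (hφ.differentiableAt (hV.mem_nhds hzV)).add
      ((differentiableAt_cauchyIntegral hs (hφs s₀ le_rfl hs'.le)
        (fun h' => hz0 (sphere_subset_closedBall h'))).const_mul _)
    refine (hd.congr_of_eventuallyEq ?_).differentiableWithinAt
    filter_upwards [hV.mem_nhds hzV, isClosed_closedBall.isOpen_compl.mem_nhds hz0] with w hw hw'
    exact hout w hw hw'

/-- Cauchy's theorem for a disc with finitely many holes. -/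
theorem circleIntegral_eq_sum_holes {ι : Type*} [DecidableEq ι] {x : ι → ℂ} {a b : ι → ℝ} {t : ℝ}
    (ht : 0 < t) (J : Finset ι) (ha : ∀ j ∈ J, 0 < a j) (hab : ∀ j ∈ J, a j < b j)
    (hin : ∀ j ∈ J, closedBall (x j) (b j) ⊆ ball 0 t)
    (hdisj : ∀ j ∈ J, ∀ k ∈ J, j ≠ k → Disjoint (closedBall (x j) (b j)) (closedBall (x k) (b k)))
    {U : Set ℂ} (hU : IsOpen U) (hUt : closedBall 0 t ⊆ U) {φ : ℂ → ℂ}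
    (hφ : DifferentiableOn ℂ φ (U \ ⋃ j ∈ J, closedBall (x j) (a j))) :
    (∮ z in C(0, t), φ z) = ∑ j ∈ J, ∮ z in C(x j, b j), φ z := by
  have hpi : (2 * Real.pi * Complex.I : ℂ) ≠ 0 := Complex.two_pi_I_ne_zero
  induction J using Finset.induction_on generalizing φ with
  | empty =>
    simp only [Finset.notMem_empty, iUnion_of_empty, iUnion_empty, sdiff_empty] at hφ
    simp only [Finset.sum_empty]
    exact ((hφ.mono hUt).mono closure_ball_subset_closedBall).diffContOnCl.circleIntegral_eq_zero
      ht.le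
  | insert k J hk ih =>
    simp only [Finset.mem_insert, forall_eq_or_imp] at ha hab hin hdisj
    -- Split off the principal part of `φ` at hole `k` along an intermediate circle: `φ = φ' - ψ`
    -- outside it. The induction hypothesis applies to `φ'`, which no longer sees the hole, and `ψ`
    -- is holomorphic off that circle.
    obtain ⟨s, hs, hsb⟩ := exists_between hab.1
    have hs0 : 0 < s := ha.1.trans hs
    have hkJ : ∀ j ∈ J, Disjoint (closedBall (x k) (b k)) (closedBall (x j) (b j)) := fun j hj =>
      hdisj.1.2 j hj (fun h => hk (h ▸ hj))
    set V := U \ ⋃ j ∈ insert k J, closedBall (x j) (a j) with hVdef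
    have hclosed : ∀ J : Finset ι, IsClosed (⋃ j ∈ J, closedBall (x j) (a j)) := fun J =>
      J.finite_toSet.isClosed_biUnion fun _ _ => isClosed_closedBall
    have hV : IsOpen V := hU.sdiff (hclosed _)
    have hmemV : ∀ z ∈ U, z ∉ closedBall (x k) (a k) → (∀ j ∈ J, z ∉ closedBall (x j) (a j)) →
        z ∈ V := by
      intro z h1 h2 h3
      refine ⟨h1, ?_⟩
      simp only [Finset.mem_insert, mem_iUnion, not_exists, forall_eq_or_imp, exists_prop, not_and]
      exact ⟨h2, h3⟩
    have hann : closedBall (x k) (b k) \ ball (x k) s ⊆ V := by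
      intro z hz
      refine hmemV z (hUt (ball_subset_closedBall (hin.1 hz.1))) (fun h => hz.2 ?_) fun j hj h => ?_
      · exact closedBall_subset_ball hs h
      · exact disjoint_left.1 (hkJ j hj) hz.1 (closedBall_subset_closedBall (hab.2 j hj).le h)
    obtain ⟨φ', hd', heq⟩ := exists_extension_across_hole hs0 hsb hV hann hφ
    have hφ'd : DifferentiableOn ℂ φ' (U \ ⋃ j ∈ J, closedBall (x j) (a j)) := by
      refine hd'.mono fun z hz => ?_
      by_cases h : z ∈ closedBall (x k) (a k)
      · exact Or.inr (closedBall_subset_ball hab.1 h)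
      · refine Or.inl (hmemV z hz.1 h ?_)
        have := hz.2
        simp only [mem_iUnion, not_exists] at this
        exact this
    have hIH := ih ha.2 hab.2 hin.2 (fun j hj l hl => hdisj.2 j hj |>.2 l hl) hφ'd
    set ψ : ℂ → ℂ := fun z => (2 * Real.pi * Complex.I)⁻¹ * ∮ w in C(x k, s), (w - z)⁻¹ * φ w
    have hφs : ContinuousOn φ (sphere (x k) s) := hφ.continuousOn.mono (Subset.trans (fun w hw => by
      rw [mem_sphere] at hw
      exact ⟨by rw [mem_closedBall]; linarith, by rw [mem_ball]; linarith⟩) hann)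
    have hψ : ∀ z ∉ sphere (x k) s, DifferentiableAt ℂ ψ z := fun z hz =>
      (differentiableAt_cauchyIntegral hs0 hφs hz).const_mul _
    have hV0 : sphere 0 t ⊆ V := by
      intro z hz
      have hzt : z ∉ ball (0 : ℂ) t := fun h => by rw [mem_sphere] at hz; rw [mem_ball] at h; linarith
      refine hmemV z (hUt (sphere_subset_closedBall hz)) (fun h => hzt (hin.1 ?_))
        fun j hj h => hzt (hin.2 j hj ?_)
      · exact closedBall_subset_closedBall hab.1.le h
      · exact closedBall_subset_closedBall (hab.2 j hj).le h
    have hout0 : ∀ z ∈ sphere (0 : ℂ) t, z ∉ closedBall (x k) s := fun z hz h => by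
      have := hin.1 (closedBall_subset_closedBall hsb.le h)
      rw [mem_sphere] at hz; rw [mem_ball] at this; linarith
    have hVj : ∀ j ∈ J, sphere (x j) (b j) ⊆ V := by
      intro j hj z hz
      have hzb := sphere_subset_closedBall hz
      refine hmemV z (hUt (ball_subset_closedBall (hin.2 j hj hzb))) (fun h => ?_)
        fun l hl h => ?_
      · exact disjoint_left.1 (hkJ j hj) (closedBall_subset_closedBall hab.1.le h) hzb
      · rcases eq_or_ne j l with rfl | hjl
        · have := hab.2 j hj
          rw [mem_sphere] at hz; rw [mem_closedBall] at h; linarith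
        · exact disjoint_left.1 ((hdisj.2 j hj).2 l hl hjl) hzb
            (closedBall_subset_closedBall (hab.2 l hl).le h)
    have houtj : ∀ j ∈ J, ∀ z ∈ closedBall (x j) (b j), z ∉ closedBall (x k) s :=
      fun j hj z hz h => disjoint_left.1 (hkJ j hj) (closedBall_subset_closedBall hsb.le h) hz
    have hψc : ∀ S : Set ℂ, (∀ z ∈ S, z ∉ closedBall (x k) s) → ContinuousOn ψ S := fun S hS z hz =>
      (hψ z fun h => hS z hz (sphere_subset_closedBall h)).continuousAt.continuousWithinAt
    have hφ'c : ContinuousOn φ' V := hd'.continuousOn.mono subset_union_left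
    -- the outer circle
    have e0 : (∮ z in C(0, t), φ z) = (∮ z in C(0, t), φ' z) - ∮ z in C(0, t), ψ z := by
      rw [← circleIntegral.integral_sub ((hφ'c.mono hV0).circleIntegrable ht.le)
        ((hψc _ hout0).circleIntegrable ht.le)]
      exact circleIntegral.integral_congr ht.le fun z hz => heq z (hV0 hz) (hout0 z hz)
    have ej : ∀ j ∈ J, (∮ z in C(x j, b j), φ z) = ∮ z in C(x j, b j), φ' z := by
      intro j hj
      have hb : 0 ≤ b j := ((ha.2 j hj).trans (hab.2 j hj)).le
      have hz : (∮ z in C(x j, b j), ψ z) = 0 :=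
        Complex.circleIntegral_eq_zero_of_differentiable_on_off_countable hb countable_empty
          (hψc _ (houtj j hj)) fun z hz => hψ z fun h =>
            houtj j hj z (ball_subset_closedBall hz.1) (sphere_subset_closedBall h)
      rw [← sub_zero (∮ z in C(x j, b j), φ' z), ← hz,
        ← circleIntegral.integral_sub ((hφ'c.mono (hVj j hj)).circleIntegrable hb)
        ((hψc _ fun z hz => houtj j hj z (sphere_subset_closedBall hz)).circleIntegrable hb)]
      exact circleIntegral.integral_congr hb fun z hz => heq z (hVj j hj hz)
        (houtj j hj z (sphere_subset_closedBall hz))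
    -- After exchanging the integrals, `1 / (w - z)` integrates over the large circle to `-2πi`, so
    -- the principal part returns the integral of `φ` around hole `k`.
    have eψ : (∮ z in C(0, t), ψ z) = - ∮ z in C(x k, s), φ z := by
      have hne : ∀ p ∈ sphere (0 : ℂ) t ×ˢ sphere (x k) s, p.2 - p.1 ≠ 0 := fun p hp h0 =>
        hout0 p.1 hp.1 (by rw [← sub_eq_zero.1 h0]; exact sphere_subset_closedBall hp.2)
      simp only [ψ]
      rw [circleIntegral.integral_const_mul, circleIntegral_circleIntegral_swap ht.le hs0.le]
      · have : ∀ w ∈ sphere (x k) s, (∮ z in C(0, t), (w - z)⁻¹ * φ w) =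
            -(2 * Real.pi * Complex.I) * φ w := by
          intro w hw
          have hwb : w ∈ ball (0 : ℂ) t := hin.1
            (closedBall_subset_closedBall hsb.le (sphere_subset_closedBall hw))
          have h1 : (fun z => (w - z)⁻¹ * φ w) = fun z => (-φ w) * (z - w)⁻¹ := by
            ext z; rw [← neg_sub z w, inv_neg]; ring
          rw [h1, circleIntegral.integral_const_mul,
            circleIntegral.integral_sub_inv_of_mem_ball hwb]
          ring
        rw [circleIntegral.integral_congr hs0.le this, circleIntegral.integral_const_mul]
        field_simp
      · refine ContinuousOn.mul (ContinuousOn.inv₀ ?_ hne) ?_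
        · fun_prop
        · exact hφs.comp continuousOn_snd fun p hp => hp.2
    have ek : (∮ z in C(x k, b k), φ z) = ∮ z in C(x k, s), φ z :=
      Complex.circleIntegral_eq_of_differentiable_on_annulus_off_countable hs0 hsb.le
        countable_empty (hφ.continuousOn.mono hann) fun w hw => (hφ.differentiableAt (hV.mem_nhds
      (hann ⟨ball_subset_closedBall hw.1.1, fun h => hw.1.2 (ball_subset_closedBall h)⟩)))
    rw [Finset.sum_insert hk, e0, eψ, hIH, ek, Finset.sum_congr rfl ej]
    ring

end PuncturedPlane

end

/-! ### Dividing out zeros. -/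

section

open Set Filter Topology Metric

namespace PuncturedPlane

section factor

theorem analyticOrderAt_ne_top_of_exists_ne_zero {V : Set ℂ} (hV : IsOpen V)
    (hVc : IsPreconnected V) {F : ℂ → ℂ} (hF : DifferentiableOn ℂ F V)
    (hne : ∃ z ∈ V, F z ≠ 0) {z : ℂ} (hz : z ∈ V) : analyticOrderAt F z ≠ ⊤ := by
  intro htop
  obtain ⟨w, hw, hFw⟩ := hne
  refine hFw ((hF.analyticOnNhd hV).eqOn_zero_of_preconnected_of_frequently_eq_zero hVc hz ?_ hw)
  exact ((analyticOrderAt_eq_top.1 htop).filter_mono nhdsWithin_le_nhds).frequently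

theorem finite_zeros_inter_compact {V : Set ℂ} (hV : IsOpen V) {F : ℂ → ℂ}
    (hF : DifferentiableOn ℂ F V) (hord : ∀ z ∈ V, analyticOrderAt F z ≠ ⊤) {K : Set ℂ}
    (hK : IsCompact K) (hKV : K ⊆ V) : {z ∈ K | F z = 0}.Finite := by
  by_contra hinf
  obtain ⟨x, hxK, hx⟩ := Set.Infinite.exists_accPt_of_subset_isCompact hinf hK fun z hz => hz.1
  have han := hF.analyticOnNhd hV x (hKV hxK)
  rcases han.eventually_eq_zero_or_eventually_ne_zero with h | h
  · exact hord x (hKV hxK) (analyticOrderAt_eq_top.2 h)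
  · rw [accPt_iff_frequently_nhdsNE] at hx
    exact (hx.mono fun z hz => hz.2) h

theorem exists_factor_zero {V : Set ℂ} (hV : IsOpen V) {F : ℂ → ℂ} (hF : DifferentiableOn ℂ F V)
    {a : ℂ} (ha : a ∈ V) (hord : analyticOrderAt F a ≠ ⊤) :
    ∃ G : ℂ → ℂ, DifferentiableOn ℂ G V ∧ G a ≠ 0 ∧
      ∀ z ∈ V, F z = (z - a) ^ analyticOrderNatAt F a * G z := by
  classical
  obtain ⟨g, hg, hga, hFg⟩ := ((hF.analyticOnNhd hV a ha).analyticOrderAt_ne_top).1 hord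
  set m := analyticOrderNatAt F a
  set G : ℂ → ℂ := fun z => if z = a then g a else F z / (z - a) ^ m with hG
  have hGa : G a = g a := if_pos rfl
  have hGne : ∀ z, z ≠ a → G z = F z / (z - a) ^ m := fun z hz => if_neg hz
  have hev : G =ᶠ[𝓝 a] g := by
    filter_upwards [hFg] with z hz
    by_cases h : z = a
    · rw [h, hGa]
    · rw [hGne z h, hz, smul_eq_mul, mul_div_cancel_left₀]
      exact pow_ne_zero _ (sub_ne_zero.2 h)
  refine ⟨G, fun z hz => ?_, by rwa [hGa], fun z hz => ?_⟩
  · by_cases h : z = a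
    · subst h
      exact (hg.differentiableAt.congr_of_eventuallyEq hev).differentiableWithinAt
    · have : DifferentiableAt ℂ (fun z => F z / (z - a) ^ m) z :=
        (hF.differentiableAt (hV.mem_nhds hz)).div (by fun_prop) (pow_ne_zero _ (sub_ne_zero.2 h))
      refine (this.congr_of_eventuallyEq ?_).differentiableWithinAt
      filter_upwards [isOpen_ne.mem_nhds h] with w hw using hGne w hw
  · by_cases h : z = a
    · subst h
      rw [hGa]
      exact hFg.self_of_nhds
    · rw [hGne z h, mul_div_cancel₀]
      exact pow_ne_zero _ (sub_ne_zero.2 h)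

theorem analyticOrderAt_mul_of_ne_zero {P G : ℂ → ℂ} {z : ℂ} (hP : AnalyticAt ℂ P z)
    (hG : AnalyticAt ℂ G z) (hPz : P z ≠ 0) :
    analyticOrderAt (fun w => P w * G w) z = analyticOrderAt G z := by
  have := analyticOrderAt_mul hP hG
  rw [hP.analyticOrderAt_eq_zero.2 hPz, zero_add] at this
  exact this

/-- Finitely many zeros of a holomorphic function can be divided out. -/
theorem exists_factor_zeros {V : Set ℂ} (hV : IsOpen V) (Z : Finset ℂ) {F : ℂ → ℂ}
    (hF : DifferentiableOn ℂ F V) (hZ : ∀ a ∈ Z, a ∈ V)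
    (hord : ∀ z ∈ V, analyticOrderAt F z ≠ ⊤) :
    ∃ G : ℂ → ℂ, DifferentiableOn ℂ G V ∧ (∀ a ∈ Z, G a ≠ 0) ∧
      ∀ z ∈ V, F z = (∏ a ∈ Z, (z - a) ^ analyticOrderNatAt F a) * G z := by
  induction Z using Finset.induction_on generalizing F with
  | empty => exact ⟨F, hF, by simp, by simp⟩
  | insert a Z haZ ih =>
    simp only [Finset.mem_insert, forall_eq_or_imp] at hZ ⊢
    obtain ⟨G₁, hG₁, hG₁a, hFG₁⟩ := exists_factor_zero hV hF hZ.1 (hord a hZ.1)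
    have hev : ∀ z ∈ V, F =ᶠ[𝓝 z] fun w => (w - a) ^ analyticOrderNatAt F a * G₁ w := fun z hz => by
      filter_upwards [hV.mem_nhds hz] with w hw using hFG₁ w hw
    have han : ∀ z ∈ V, AnalyticAt ℂ G₁ z := hG₁.analyticOnNhd hV
    have horder : ∀ z ∈ V, z ≠ a → analyticOrderAt F z = analyticOrderAt G₁ z := by
      intro z hz hza
      rw [analyticOrderAt_congr (hev z hz)]
      exact analyticOrderAt_mul_of_ne_zero (by fun_prop) (han z hz)
        (pow_ne_zero _ (sub_ne_zero.2 hza))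
    have hord₁ : ∀ z ∈ V, analyticOrderAt G₁ z ≠ ⊤ := by
      intro z hz
      by_cases h : z = a
      · subst h
        rw [(han z hz).analyticOrderAt_eq_zero.2 hG₁a]; simp
      · rw [← horder z hz h]; exact hord z hz
    obtain ⟨G, hG, hGZ, hGG⟩ := ih hG₁ hZ.2 hord₁
    have hne : ∀ b ∈ Z, b ≠ a := fun b hb h => haZ (h ▸ hb)
    refine ⟨G, hG, ⟨fun h0 => hG₁a ?_, hGZ⟩, fun z hz => ?_⟩
    · rw [hGG a hZ.1, h0, mul_zero]
    · rw [hFG₁ z hz, hGG z hz, Finset.prod_insert haZ, mul_assoc]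
      congr 2
      refine Finset.prod_congr rfl fun b hb => ?_
      rw [analyticOrderNatAt, analyticOrderNatAt, horder b (hZ.2 b hb) (hne b hb)]

end factor

/-! ### Boundary averages of `log ‖G‖` for zero-free `G`. -/

section nonvanishing

theorem hasDerivAt_log_norm {g : ℝ → ℂ} {g' : ℂ} {t : ℝ} (hg : HasDerivAt g g' t) (h0 : g t ≠ 0) :
    HasDerivAt (fun s => Real.log ‖g s‖) (g' / g t).re t := by
  have h1 := (hg.norm_sq.log (pow_ne_zero 2 (norm_ne_zero_iff.2 h0))).const_mul (1 / 2)
  have h2 : (fun s => 1 / 2 * Real.log (‖g s‖ ^ 2)) = fun s => Real.log ‖g s‖ := by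
    ext s; rw [Real.log_pow]; push_cast; ring
  rw [h2] at h1
  refine h1.congr_deriv ?_
  rw [Complex.inner, Complex.div_re, ← Complex.normSq_eq_norm_sq]
  have : Complex.normSq (g t) ≠ 0 := by simpa using h0
  simp
  field_simp

/-- The radial derivative of `log ‖G‖` is `Re (e^{iθ} G'/G)`, whose mean over the circle is a
contour integral of `G'/G`. This reduces the constancy of boundary averages to Cauchy's theorem. -/
theorem hasDerivAt_circleAverage_log_norm {G : ℂ → ℂ} {V : Set ℂ} (hV : IsOpen V)
    (hG : DifferentiableOn ℂ G V) (h0 : ∀ z ∈ V, G z ≠ 0) {x : ℂ} {t : ℝ} (ht : 0 < t)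
    (hsub : sphere x t ⊆ V) :
    HasDerivAt (fun s => Real.circleAverage (fun z => Real.log ‖G z‖) x s)
      ((1 / t) * ((2 * Real.pi * Complex.I)⁻¹ * ∮ z in C(x, t), deriv G z / G z).re) t := by
  -- a closed annulus around the circle
  obtain ⟨ε, hε, hεV⟩ := (isCompact_sphere x t).exists_thickening_subset_open hV hsub
  set η := min (ε / 2) (t / 2) with hη
  have hη0 : 0 < η := by positivity
  have hmem : ∀ s ∈ Icc (t - η) (t + η), ∀ θ, circleMap x s θ ∈ V := by
    intro s hs θ
    refine hεV (mem_thickening_iff.2 ⟨circleMap x t θ, circleMap_mem_sphere x ht.le θ, ?_⟩)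
    rw [dist_eq_norm]
    have : circleMap x s θ - circleMap x t θ = ((s - t : ℝ) : ℂ) * Complex.exp (θ * Complex.I) := by
      simp [circleMap]; ring
    rw [this, norm_mul, Complex.norm_exp_ofReal_mul_I, mul_one, Complex.norm_real, Real.norm_eq_abs]
    have h1 : |s - t| ≤ η := abs_le.2 ⟨by linarith [hs.1], by linarith [hs.2]⟩
    have := min_le_left (ε / 2) (t / 2)
    linarith
  have hdG : ContinuousOn (deriv G) V := (hG.deriv hV).continuousOn
  have hcm : Continuous fun p : ℝ × ℝ => circleMap x p.1 p.2 := by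
    unfold circleMap; fun_prop
  have hq : ContinuousOn (fun p : ℝ × ℝ => (Complex.exp (p.2 * Complex.I) *
      deriv G (circleMap x p.1 p.2) / G (circleMap x p.1 p.2)).re)
      (Icc (t - η) (t + η) ×ˢ uIcc 0 (2 * Real.pi)) := by
    have hm : MapsTo (fun p : ℝ × ℝ => circleMap x p.1 p.2)
        (Icc (t - η) (t + η) ×ˢ uIcc 0 (2 * Real.pi)) V := fun p hp => hmem p.1 hp.1 p.2
    refine Complex.continuous_re.comp_continuousOn (ContinuousOn.div (ContinuousOn.mul ?_
      (hdG.comp hcm.continuousOn hm)) (hG.continuousOn.comp hcm.continuousOn hm)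
      fun p hp => h0 _ (hm hp))
    fun_prop
  obtain ⟨B, hB⟩ := (isCompact_Icc.prod isCompact_uIcc).exists_bound_of_continuousOn hq
  have hlogc : ∀ s ∈ Icc (t - η) (t + η),
      Continuous fun θ => Real.log ‖G (circleMap x s θ)‖ := by
    intro s hs
    refine Continuous.log ?_ fun θ => norm_ne_zero_iff.2 (h0 _ (hmem s hs θ))
    exact (hG.continuousOn.comp_continuous (continuous_circleMap x s) (hmem s hs)).norm
  have hqc : Continuous fun θ : ℝ => (Complex.exp (θ * Complex.I) *
      deriv G (circleMap x t θ) / G (circleMap x t θ)).re := by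
    have hm := hmem t ⟨by linarith, by linarith⟩
    refine Complex.continuous_re.comp (Continuous.div (Continuous.mul (by fun_prop)
      (hdG.comp_continuous (continuous_circleMap x t) hm))
      (hG.continuousOn.comp_continuous (continuous_circleMap x t) hm) fun θ => h0 _ (hm θ))
  have htmem : t ∈ Icc (t - η) (t + η) := ⟨by linarith, by linarith⟩
  have key := intervalIntegral.hasDerivAt_integral_of_dominated_loc_of_deriv_le
    (μ := MeasureTheory.volume) (a := 0) (b := 2 * Real.pi) (x₀ := t) (s := Icc (t - η) (t + η))
    (F := fun s θ => Real.log ‖G (circleMap x s θ)‖)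
    (F' := fun s θ => (Complex.exp (θ * Complex.I) *
      deriv G (circleMap x s θ) / G (circleMap x s θ)).re)
    (bound := fun _ => B) (Icc_mem_nhds (by linarith) (by linarith)) ?_ ?_ ?_ ?_ ?_ ?_
  · have h2 := key.2.const_mul (2 * Real.pi)⁻¹
    unfold Real.circleAverage
    simp only [smul_eq_mul]
    refine h2.congr_deriv ?_
    have hcont : Continuous fun θ : ℝ => Complex.exp (θ * Complex.I) *
        deriv G (circleMap x t θ) / G (circleMap x t θ) := by
      refine Continuous.div (Continuous.mul (by fun_prop)
        (hdG.comp_continuous (continuous_circleMap x t) (hmem t htmem)))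
        (hG.continuousOn.comp_continuous (continuous_circleMap x t) (hmem t htmem))
        fun θ => h0 _ (hmem t htmem θ)
    have h3 : (∮ z in C(x, t), deriv G z / G z) = (t * Complex.I) *
        ∫ θ in (0 : ℝ)..2 * Real.pi, Complex.exp (θ * Complex.I) *
        deriv G (circleMap x t θ) / G (circleMap x t θ) := by
      rw [circleIntegral, ← intervalIntegral.integral_const_mul]
      congr 1; ext θ
      simp [deriv_circleMap, circleMap]
      ring
    have h4 : (∫ θ in (0 : ℝ)..2 * Real.pi, (Complex.exp (θ * Complex.I) *
        deriv G (circleMap x t θ) / G (circleMap x t θ)).re) =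
        (∫ θ in (0 : ℝ)..2 * Real.pi, Complex.exp (θ * Complex.I) *
        deriv G (circleMap x t θ) / G (circleMap x t θ)).re := by
      have := Complex.reCLM.intervalIntegral_comp_comm
        (hcont.intervalIntegrable (μ := MeasureTheory.volume) 0 (2 * Real.pi))
      simpa using this
    rw [h4, h3]
    set A := ∫ θ in (0 : ℝ)..2 * Real.pi, Complex.exp (θ * Complex.I) *
        deriv G (circleMap x t θ) / G (circleMap x t θ)
    have h5 : (2 * Real.pi * Complex.I)⁻¹ * (t * Complex.I * A) =
        ((t * (2 * Real.pi)⁻¹ : ℝ) : ℂ) * A := by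
      push_cast
      field_simp [Complex.I_ne_zero, Real.pi_ne_zero]
    rw [h5, Complex.re_ofReal_mul]
    field_simp
  · filter_upwards [Icc_mem_nhds (show t - η < t by linarith) (show t < t + η by linarith)]
      with s hs using (hlogc s hs).aestronglyMeasurable
  · exact (hlogc t htmem).intervalIntegrable _ _
  · exact hqc.aestronglyMeasurable
  · exact Eventually.of_forall fun θ hθ s hs => hB (s, θ) ⟨hs, uIoc_subset_uIcc hθ⟩
  · simp
  · refine Eventually.of_forall fun θ hθ s hs => ?_
    have hzV := hmem s hs θ
    have h1 : HasDerivAt (fun s : ℝ => circleMap x s θ) (Complex.exp (θ * Complex.I)) s := by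
      have := ((Complex.ofRealCLM.hasDerivAt (x := s)).mul_const
        (Complex.exp (θ * Complex.I))).const_add x
      simpa [circleMap] using this
    have h2 : HasDerivAt (fun s : ℝ => G (circleMap x s θ))
        (deriv G (circleMap x s θ) * Complex.exp (θ * Complex.I)) s :=
      ((hG.differentiableAt (hV.mem_nhds hzV)).hasDerivAt).comp s h1
    have := hasDerivAt_log_norm h2 (h0 _ hzV)
    rwa [mul_comm (deriv G _)] at this

variable {M : ℕ} {c : Fin M → ℂ} {t : ℝ}

/-- Cauchy's theorem for the boundary of `closedRegion c t`. -/
theorem Separated.circleIntegral_eq_sum (h : Separated c t) {V : Set ℂ} (hV : IsOpen V)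
    (hsub : closedRegion c t ⊆ V) {φ : ℂ → ℂ} (hφ : DifferentiableOn ℂ φ V) :
    (∮ z in C(0, t), φ z) = ∑ j, ∮ z in C(c j, 1 / t), φ z := by
  have ht := h.pos
  have ht1 : 0 < 1 / t := by positivity
  obtain ⟨ε, hε, hεV⟩ := (isCompact_closedRegion c t).exists_thickening_subset_open hV hsub
  -- The holes shrink and the outer disc grows by `η`; the bound by `1 / (2 * t)` keeps the radii of
  -- the holes positive.
  set η := min ε (1 / (2 * t)) with hη
  have hη0 : 0 < η := by positivity
  have hηε : η ≤ ε := min_le_left _ _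
  have hη1 : η < 1 / t := by
    have h1 : η ≤ 1 / (2 * t) := min_le_right _ _
    have h2 : 1 / (2 * t) = (1 / t) / 2 := by ring
    linarith
  refine circleIntegral_eq_sum_holes (U := ball 0 (t + η)) (a := fun _ => 1 / t - η) ht _
    (fun _ _ => by linarith) (fun _ _ => by linarith) (fun j _ z hz => ?_)
    (fun j _ k _ hjk => ?_) isOpen_ball (closedBall_subset_ball (by linarith)) (hφ.mono ?_)
  · have h1 := h.outer j
    rw [mem_closedBall, dist_eq_norm] at hz
    rw [mem_ball_zero_iff]
    have := norm_sub_norm_le z (c j)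
    linarith
  · refine closedBall_disjoint_closedBall ?_
    have := h.inner j k hjk
    rw [dist_eq_norm]
    have h3 : 2 / t = 1 / t + 1 / t := by ring
    linarith
  · rintro z ⟨hz, hz'⟩
    simp only [Finset.mem_univ, iUnion_true, mem_iUnion, not_exists, mem_closedBall, not_le,
      dist_eq_norm] at hz'
    rw [mem_ball_zero_iff] at hz
    -- A point of the enlarged region outside `closedRegion c t` is within `η` of its radial
    -- projection to a boundary circle, hence in the thickening inside `V`.
    have push : ∀ (x : ℂ) (s : ℝ), 0 < s → |‖z - x‖ - s| < η → z ≠ x →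
        sphere x s ⊆ closedRegion c t → z ∈ V := by
      intro x s hs hlt hzx hsph
      have hn : 0 < ‖z - x‖ := norm_pos_iff.2 (sub_ne_zero.2 hzx)
      refine hεV (mem_thickening_iff.2 ⟨x + ((s / ‖z - x‖ : ℝ) : ℂ) * (z - x), hsph ?_, ?_⟩)
      · rw [mem_sphere, dist_eq_norm, add_sub_cancel_left, norm_mul, Complex.norm_real,
          Real.norm_of_nonneg (by positivity)]
        field_simp
      · have h1 : z - (x + ((s / ‖z - x‖ : ℝ) : ℂ) * (z - x)) =
            (((‖z - x‖ - s) / ‖z - x‖ : ℝ) : ℂ) * (z - x) := by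
          have h0 : (‖z - x‖ : ℂ) ≠ 0 := by exact_mod_cast hn.ne'
          push_cast
          field_simp
          ring
        rw [dist_eq_norm, h1, norm_mul, Complex.norm_real, Real.norm_eq_abs, abs_div,
          abs_of_pos hn, div_mul_cancel₀ _ hn.ne']
        linarith
    by_cases h1 : ‖z‖ ≤ t
    · by_cases h2 : ∀ j, 1 / t ≤ ‖z - c j‖
      · exact hsub ⟨h1, h2⟩
      · push Not at h2
        obtain ⟨j, hj⟩ := h2
        refine push (c j) (1 / t) ht1 ?_ ?_ (h.inner_circle_subset j)
        · have := hz' j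
          rw [abs_lt]; constructor <;> linarith
        · intro h0
          have := hz' j
          rw [h0, sub_self, norm_zero] at this
          linarith
    · refine push 0 t ht ?_ ?_ h.outer_circle_subset
      · rw [sub_zero, abs_lt]; constructor <;> linarith
      · rintro rfl
        simp at h1
        linarith

/-- The boundary average of `log ‖G‖` does not change across a region without zeros. -/
theorem bdryAvg_log_norm_eq_of_ne_zero {s : ℝ} (hs : Separated c s) (hst : s ≤ t) {G : ℂ → ℂ}
    (hG : DifferentiableOn ℂ G (Omega c)) (h0 : ∀ z ∈ closedRegion c t, G z ≠ 0) :
    bdryAvg c (fun z => Real.log ‖G z‖) t = bdryAvg c (fun z => Real.log ‖G z‖) s := by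
  set V := {z ∈ Omega c | G z ≠ 0} with hVdef
  have hV : IsOpen V := hG.continuousOn.isOpen_inter_preimage (isOpen_Omega c) isOpen_ne
  have hGV : DifferentiableOn ℂ G V := hG.mono fun z hz => hz.1
  have hder : ∀ x ∈ Icc s t, HasDerivAt (bdryAvg c fun z => Real.log ‖G z‖) 0 x := by
    intro x hx
    have hsx := hs.mono hx.1
    have hx0 := hsx.pos
    have hKV : closedRegion c x ⊆ V := fun z hz =>
      ⟨closedRegion_subset_Omega hx0 hz, h0 z (closedRegion_mono hx0 hx.2 hz)⟩
    have e0 := hasDerivAt_circleAverage_log_norm hV hGV (fun z hz => hz.2) hx0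
      (hsx.outer_circle_subset.trans hKV)
    -- On an inner circle the factor `1 / (1 / x) = x` meets `-1 / x²` from the chain rule. The
    -- inner fluxes thus enter with `-1 / x` and the outer one with `1 / x`, and Cauchy's theorem
    -- makes the total vanish.
    have hinv : HasDerivAt (fun y : ℝ => 1 / y) (-(x ^ 2)⁻¹) x := by
      simpa using hasDerivAt_inv hx0.ne'
    have ej : ∀ j, HasDerivAt (fun y : ℝ =>
        Real.circleAverage (fun z => Real.log ‖G z‖) (c j) (1 / y)) _ x := fun j =>
      (hasDerivAt_circleAverage_log_norm hV hGV (fun z hz => hz.2) (one_div_pos.2 hx0)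
      ((hsx.inner_circle_subset j).trans hKV)).comp x hinv
    have hC := hsx.circleIntegral_eq_sum hV hKV (φ := fun z => deriv G z / G z)
      ((hGV.deriv hV).div hGV fun z hz => hz.2)
    have hsum := e0.add (HasDerivAt.fun_sum fun j (_ : j ∈ Finset.univ) => ej j)
    refine hsum.congr_deriv ?_
    rw [hC, Finset.mul_sum, Complex.re_sum, Finset.mul_sum, ← Finset.sum_add_distrib]
    refine Finset.sum_eq_zero fun j _ => ?_
    field_simp
    ring
  exact constant_of_has_deriv_right_zero
    (fun x hx => (hder x hx).continuousAt.continuousWithinAt)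
    (fun x hx => (hder x ⟨hx.1, hx.2.le⟩).hasDerivWithinAt) t ⟨hst, le_rfl⟩

end nonvanishing

end PuncturedPlane

end

/-! ### Counting functions. -/

section

open Set Filter Topology Metric

namespace PuncturedPlane

section counting
variable {M : ℕ} {c : Fin M → ℂ}

/-- The total weight `∑ m z` over `closure (OmegaR c t)`. -/
noncomputable def weightCount (c : Fin M → ℂ) (m : ℂ → ℕ) (t : ℝ) : ℕ :=
  ∑ᶠ z ∈ closure (OmegaR c t), m z

/-- The logarithmic integral of `weightCount`. -/
noncomputable def weightCounting (c : Fin M → ℂ) (m : ℂ → ℕ) (s r : ℝ) : ℝ :=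
  ∫ t in s..r, (weightCount c m t : ℝ) / t

/-- The support of `m` is locally finite in the punctured plane. -/
def LocallyFiniteWeight (c : Fin M → ℂ) (m : ℂ → ℕ) : Prop :=
  ∀ t, 0 < t → {z ∈ closedRegion c t | m z ≠ 0}.Finite

theorem locallyFiniteWeight_mono {m m' : ℂ → ℕ} (hm : LocallyFiniteWeight c m)
    (h : ∀ z ∈ Omega c, m' z ≠ 0 → m z ≠ 0) : LocallyFiniteWeight c m' := fun t ht =>
  (hm t ht).subset fun z hz => ⟨hz.1, h z (closedRegion_subset_Omega ht hz.1) hz.2⟩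

/-- One finite set `Z` serves every `t ≤ r`, so the finitely supported sum becomes a fixed finite
sum that can be integrated in `t`. -/
theorem weightCount_eq_sum {m : ℂ → ℕ} {t r : ℝ} (ht : Separated c t) (htr : t ≤ r) {Z : Finset ℂ}
    (hZ : ∀ z ∈ closedRegion c r, m z ≠ 0 → z ∈ Z) :
    weightCount c m t = ∑ a ∈ Z, (closedRegion c t).indicator m a := by
  classical
  rw [weightCount, ht.closure_OmegaR, finsum_mem_def]
  refine finsum_eq_sum_of_support_subset _ fun z hz => ?_
  rw [Function.mem_support, Set.indicator_apply_ne_zero] at hz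
  exact hZ z (closedRegion_mono ht.pos htr hz.1) hz.2

theorem Separated.closedRegion_of_mem_sphere {t : ℝ} (ht : Separated c t) {a : ℂ}
    (h : ‖a‖ = t ∨ ∃ j, ‖a - c j‖ = 1 / t) : a ∈ closedRegion c t := by
  rcases h with h | ⟨j, hj⟩
  · exact ht.outer_circle_subset (by simpa using h)
  · exact ht.inner_circle_subset j (by simpa [dist_eq_norm] using hj)

/-- A point of the punctured plane enters the exhaustion `closedRegion c t` at a time `τ`, where the
boundary average of `log ‖z - a‖` begins to grow. -/
theorem exists_entry_time {s r : ℝ} (hs : Separated c s) (hsr : s ≤ r) {a : ℂ}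
    (ha : a ∈ closedRegion c r) :
    ∃ τ ∈ Icc s r, (∀ t, s ≤ t → (a ∈ closedRegion c t ↔ τ ≤ t)) ∧
      bdryAvg c (fun z => Real.log ‖z - a‖) r - bdryAvg c (fun z => Real.log ‖z - a‖) s =
        Real.log (r / τ) := by
  classical
  have hs0 := hs.pos
  have hcirc : ∀ (x : ℂ) (ρ : ℝ), 0 < ρ → Real.circleAverage (fun z => Real.log ‖z - a‖) x ρ =
      Real.log (max ρ ‖x - a‖) := by
    intro x ρ hρ
    rw [circleAverage_log_norm_sub_const_eq_log_radius_add_posLog hρ.ne']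
    by_cases h : ‖x - a‖ ≤ ρ
    · rw [max_eq_left h, (Real.posLog_eq_zero_iff _).2, add_zero]
      rw [abs_of_nonneg (by positivity), inv_mul_le_iff₀ hρ]; linarith
    · push Not at h
      rw [max_eq_right h.le, Real.posLog_eq_log, Real.log_mul (by positivity)
        (hρ.trans h).ne', Real.log_inv]
      · ring
      · rw [abs_of_nonneg (by positivity), le_inv_mul_iff₀ hρ]; linarith
  have hbdry : ∀ t, 0 < t → bdryAvg c (fun z => Real.log ‖z - a‖) t =
      Real.log (max t ‖a‖) + ∑ j, Real.log (max (1 / t) ‖a - c j‖) := by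
    intro t ht
    rw [bdryAvg, hcirc 0 t ht, zero_sub, norm_neg]
    congr 1
    exact Finset.sum_congr rfl fun j _ => by
      rw [hcirc (c j) (1 / t) (by positivity), norm_sub_rev]
  have hin : ∀ t, 0 < t → a ∈ closedRegion c t → bdryAvg c (fun z => Real.log ‖z - a‖) t =
      Real.log t + ∑ j, Real.log ‖a - c j‖ := by
    intro t ht hat
    rw [hbdry t ht, max_eq_left hat.1]
    congr 1
    exact Finset.sum_congr rfl fun j _ => by rw [max_eq_right (hat.2 j)]
  -- Since the discs are disjoint, a point outside `closedRegion c s` violates exactly one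
  -- constraint. The entry time is `s`, `1 / ‖a - c j‖` or `‖a‖` accordingly. The average takes the
  -- same value at `s` and at `τ`: in the disc about `c j` the terms `log t` and `log (1 / t)`
  -- cancel, and beyond the outer circle the maximum is `‖a‖` at both times. After the entry it is
  -- `log t` plus a constant.
  suffices H : ∃ τ ∈ Icc s r, a ∈ closedRegion c τ ∧ (∀ t, s ≤ t → a ∈ closedRegion c t → τ ≤ t) ∧
      bdryAvg c (fun z => Real.log ‖z - a‖) s = bdryAvg c (fun z => Real.log ‖z - a‖) τ by
    obtain ⟨τ, hτ, h1, h2, h3⟩ := H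
    have hτ0 : 0 < τ := hs0.trans_le hτ.1
    have hr0 : 0 < r := hτ0.trans_le hτ.2
    refine ⟨τ, hτ, fun t ht => ⟨h2 t ht, fun h => closedRegion_mono hτ0 h h1⟩, ?_⟩
    rw [h3, hin r hr0 ha, hin τ hτ0 h1, Real.log_div hr0.ne' hτ0.ne']
    ring
  by_cases h1 : ‖a‖ ≤ s
  · by_cases h2 : ∀ j, 1 / s ≤ ‖a - c j‖
    · exact ⟨s, ⟨le_rfl, hsr⟩, ⟨h1, h2⟩, fun t ht _ => ht, rfl⟩
    · push Not at h2
      obtain ⟨j, hj⟩ := h2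
      have hr0 : 0 < r := hs0.trans_le hsr
      have haj : 0 < ‖a - c j‖ := (one_div_pos.2 hr0).trans_le (ha.2 j)
      set τ := 1 / ‖a - c j‖ with hτ
      have hτj : ‖a - c j‖ = 1 / τ := by rw [hτ, one_div_one_div]
      have hsτ : s ≤ τ := by
        rw [hτ, le_one_div hs0 haj]; exact hj.le
      have hsep := hs.mono hsτ
      have haτ : a ∈ closedRegion c τ := hsep.closedRegion_of_mem_sphere (Or.inr ⟨j, hτj⟩)
      refine ⟨τ, ⟨hsτ, ?_⟩, haτ, fun t ht hat => ?_, ?_⟩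
      · rw [hτ, one_div_le haj hr0]; exact ha.2 j
      · rw [hτ, one_div_le haj (hs0.trans_le ht)]; exact hat.2 j
      · rw [hin τ hsep.pos haτ, hbdry s hs0, max_eq_left h1,
          ← Finset.add_sum_erase _ _ (Finset.mem_univ j),
          ← Finset.add_sum_erase _ (fun j => Real.log ‖a - c j‖) (Finset.mem_univ j)]
        rw [max_eq_left hj.le, hτj, Real.log_div one_ne_zero hs0.ne',
          Real.log_div one_ne_zero hsep.pos.ne', Real.log_one]
        have : ∑ k ∈ Finset.univ.erase j, Real.log (max (1 / s) ‖a - c k‖) =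
            ∑ k ∈ Finset.univ.erase j, Real.log ‖a - c k‖ := by
          refine Finset.sum_congr rfl fun k hk => ?_
          rw [max_eq_right]
          have hjk : j ≠ k := (Finset.ne_of_mem_erase hk).symm
          have h1 := hs.inner j k hjk
          have h2 : ‖c j - c k‖ ≤ ‖a - c j‖ + ‖a - c k‖ := by
            have := norm_sub_le (a - c k) (a - c j)
            simp at this
            linarith
          have h3 : 2 / s = 2 * (1 / s) := by ring
          linarith
        rw [this]
        ring
  · push Not at h1
    have hsep := hs.mono h1.le
    have haa : a ∈ closedRegion c ‖a‖ := hsep.closedRegion_of_mem_sphere (Or.inl rfl)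
    refine ⟨‖a‖, ⟨h1.le, ha.1⟩, haa, fun t ht hat => hat.1, ?_⟩
    rw [hin _ hsep.pos haa, hbdry s hs0, max_eq_right h1.le]
    congr 1
    refine Finset.sum_congr rfl fun j _ => ?_
    rw [max_eq_right]
    have := hs.outer j
    have := norm_sub_norm_le a (c j)
    linarith

theorem integral_indicator_Ici_div {s τ r : ℝ} (hs : 0 < s) (hτ : τ ∈ Icc s r) (m : ℝ) :
    IntervalIntegrable (fun t => (Ici τ).indicator (fun _ => m) t / t) MeasureTheory.volume s r ∧
    ∫ t in s..r, (Ici τ).indicator (fun _ => m) t / t = m * Real.log (r / τ) := by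
  have hτ0 : 0 < τ := hs.trans_le hτ.1
  have hfun : (fun t => (Ici τ).indicator (fun _ => m) t / t) =
      (Ici τ).indicator (fun t => m * t⁻¹) := by
    ext t
    by_cases h : t ∈ Ici τ
    · simp only [indicator_of_mem h, div_eq_mul_inv]
    · simp only [indicator_of_notMem h, zero_div]
  have hsr := hτ.1.trans hτ.2
  have hcont : ContinuousOn (fun t : ℝ => m * t⁻¹) (Icc s r) :=
    continuousOn_const.mul (continuousOn_inv₀.mono fun t ht => (hs.trans_le ht.1).ne')
  have hint : IntervalIntegrable (fun t : ℝ => m * t⁻¹) MeasureTheory.volume s r :=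
    hcont.intervalIntegrable_of_Icc hsr
  rw [hfun]
  constructor
  · rw [intervalIntegrable_iff_integrableOn_Ioc_of_le hsr] at hint ⊢
    exact hint.indicator measurableSet_Ici
  · rw [intervalIntegral.integral_of_le hsr,
      ← MeasureTheory.integral_Icc_eq_integral_Ioc,
      MeasureTheory.setIntegral_indicator measurableSet_Ici]
    have hinter : Icc s r ∩ Ici τ = Icc τ r := by
      ext t
      simp only [mem_inter_iff, mem_Icc, mem_Ici]
      exact ⟨fun h => ⟨h.2, h.1.2⟩, fun h => ⟨⟨hτ.1.trans h.1, h.2⟩, h.1⟩⟩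
    rw [hinter, MeasureTheory.integral_Icc_eq_integral_Ioc, ← intervalIntegral.integral_of_le hτ.2,
      intervalIntegral.integral_const_mul, integral_inv]
    rw [uIcc_of_le hτ.2]
    exact fun h => absurd h.1 (not_le.2 hτ0)

/-- A point with entry time `τ` contributes `∫_τ^r dt / t = log (r / τ)`, which is the growth of the
boundary average of `log ‖z - a‖` by `exists_entry_time`. This is Jensen's formula for linear
factors. -/
theorem weightCounting_eq_sum {s r : ℝ} (hs : Separated c s) (hsr : s ≤ r) {m : ℂ → ℕ}
    {Z : Finset ℂ} (hZr : ∀ a ∈ Z, a ∈ closedRegion c r)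
    (hZ : ∀ z ∈ closedRegion c r, m z ≠ 0 → z ∈ Z) :
    IntervalIntegrable (fun t => (weightCount c m t : ℝ) / t) MeasureTheory.volume s r ∧
    weightCounting c m s r = ∑ a ∈ Z, m a * (bdryAvg c (fun z => Real.log ‖z - a‖) r
      - bdryAvg c (fun z => Real.log ‖z - a‖) s) := by
  classical
  choose! τ hτ hmem hval using fun a (ha : a ∈ Z) => exists_entry_time hs hsr (hZr a ha)
  have hfun : ∀ t ∈ Icc s r, (weightCount c m t : ℝ) / t =
      ∑ a ∈ Z, (Ici (τ a)).indicator (fun _ => (m a : ℝ)) t / t := by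
    intro t ht
    rw [weightCount_eq_sum (hs.mono ht.1) ht.2 hZ, Nat.cast_sum, Finset.sum_div]
    refine Finset.sum_congr rfl fun a ha => ?_
    congr 1
    by_cases h : a ∈ closedRegion c t
    · rw [indicator_of_mem h, indicator_of_mem (mem_Ici.2 ((hmem a ha t ht.1).1 h))]
    · rw [indicator_of_notMem h, indicator_of_notMem (s := Ici (τ a)) fun h' => h ((hmem a ha t ht.1).2 h')]
      simp
  have hI := fun a ha => integral_indicator_Ici_div hs.pos (hτ a ha) (m a)
  constructor
  · refine (IntervalIntegrable.sum Z fun a ha => (hI a ha).1).congr ?_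
    intro t ht
    rw [uIoc_of_le hsr] at ht
    simp [hfun t ⟨ht.1.le, ht.2⟩]
  · rw [weightCounting, intervalIntegral.integral_congr
      (g := fun t => ∑ a ∈ Z, (Ici (τ a)).indicator (fun _ => (m a : ℝ)) t / t)
      (fun t ht => hfun t (by rwa [uIcc_of_le hsr] at ht)),
      intervalIntegral.integral_finsetSum fun a ha => (hI a ha).1]
    exact Finset.sum_congr rfl fun a ha => by rw [(hI a ha).2, hval a ha]

theorem LocallyFiniteWeight.intervalIntegrable {s r : ℝ} (hs : Separated c s) (hsr : s ≤ r)
    {m : ℂ → ℕ} (hm : LocallyFiniteWeight c m) :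
    IntervalIntegrable (fun t => (weightCount c m t : ℝ) / t) MeasureTheory.volume s r :=
  (weightCounting_eq_sum hs hsr (Z := (hm r (hs.pos.trans_le hsr)).toFinset)
    (fun _ ha => ((hm r (hs.pos.trans_le hsr)).mem_toFinset.1 ha).1)
    fun _ hz hz' => (hm r (hs.pos.trans_le hsr)).mem_toFinset.2 ⟨hz, hz'⟩).1

theorem LocallyFiniteWeight.weightCount_mono {s t : ℝ} (hs : Separated c s) (hst : s ≤ t)
    {m : ℂ → ℕ} (hm : LocallyFiniteWeight c m) : weightCount c m s ≤ weightCount c m t := by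
  have hfin := hm t (hs.pos.trans_le hst)
  have hZ : ∀ z ∈ closedRegion c t, m z ≠ 0 → z ∈ hfin.toFinset := fun z hz hz' =>
    hfin.mem_toFinset.2 ⟨hz, hz'⟩
  rw [weightCount_eq_sum hs hst hZ, weightCount_eq_sum (hs.mono hst) le_rfl hZ]
  exact Finset.sum_le_sum fun a _ =>
    indicator_le_indicator_of_subset (closedRegion_mono hs.pos hst) (fun _ => Nat.zero_le _) a

/-- A pointwise inequality between sums of weights integrates. -/
theorem sum_weightCounting_le {ι κ : Type*} {I : Finset ι} {J : Finset κ} {m : ι → ℂ → ℕ}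
    {m' : κ → ℂ → ℕ} {s r : ℝ} (hs : Separated c s) (hsr : s ≤ r)
    (hm : ∀ i ∈ I, LocallyFiniteWeight c (m i)) (hm' : ∀ j ∈ J, LocallyFiniteWeight c (m' j))
    (h : ∀ z ∈ Omega c, ∑ i ∈ I, m i z ≤ ∑ j ∈ J, m' j z) :
    ∑ i ∈ I, weightCounting c (m i) s r ≤ ∑ j ∈ J, weightCounting c (m' j) s r := by
  classical
  simp only [weightCounting]
  rw [← intervalIntegral.integral_finsetSum fun i hi => (hm i hi).intervalIntegrable hs hsr,
    ← intervalIntegral.integral_finsetSum fun j hj => (hm' j hj).intervalIntegrable hs hsr]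
  refine intervalIntegral.integral_mono_on hsr ?_ ?_ fun t ht => ?_
  · exact (IntervalIntegrable.sum I fun i hi => (hm i hi).intervalIntegrable hs hsr).congr
      fun t _ => by simp
  · exact (IntervalIntegrable.sum J fun j hj => (hm' j hj).intervalIntegrable hs hsr).congr
      fun t _ => by simp
  have hst := hs.mono ht.1
  have hfin : ({z ∈ closedRegion c t | (∃ i ∈ I, m i z ≠ 0) ∨ ∃ j ∈ J, m' j z ≠ 0}).Finite := by
    refine ((I.finite_toSet.biUnion fun i hi => hm i hi t hst.pos).union
      (J.finite_toSet.biUnion fun j hj => hm' j hj t hst.pos)).subset ?_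
    rintro z ⟨hz, ⟨i, hi, h⟩ | ⟨j, hj, h⟩⟩
    · exact Or.inl (mem_biUnion hi ⟨hz, h⟩)
    · exact Or.inr (mem_biUnion hj ⟨hz, h⟩)
  have e1 : ∀ i ∈ I, weightCount c (m i) t = ∑ a ∈ hfin.toFinset, m i a := fun i hi => by
    rw [weightCount_eq_sum hst le_rfl (Z := hfin.toFinset)
      fun z hz hz' => hfin.mem_toFinset.2 ⟨hz, Or.inl ⟨i, hi, hz'⟩⟩]
    exact Finset.sum_congr rfl fun a ha => indicator_of_mem (hfin.mem_toFinset.1 ha).1 _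
  have e2 : ∀ j ∈ J, weightCount c (m' j) t = ∑ a ∈ hfin.toFinset, m' j a := fun j hj => by
    rw [weightCount_eq_sum hst le_rfl (Z := hfin.toFinset)
      fun z hz hz' => hfin.mem_toFinset.2 ⟨hz, Or.inr ⟨j, hj, hz'⟩⟩]
    exact Finset.sum_congr rfl fun a ha => indicator_of_mem (hfin.mem_toFinset.1 ha).1 _
  rw [← Finset.sum_div, ← Finset.sum_div]
  refine div_le_div_of_nonneg_right ?_ hst.pos.le
  rw [← Nat.cast_sum, ← Nat.cast_sum, Nat.cast_le, Finset.sum_congr rfl e1,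
    Finset.sum_congr rfl e2, Finset.sum_comm, Finset.sum_comm (s := J)]
  exact Finset.sum_le_sum fun a ha =>
    h a (closedRegion_subset_Omega hst.pos (hfin.mem_toFinset.1 ha).1)

end counting

/-! ### Jensen's formula. -/

section Jensen
variable {M : ℕ} {c : Fin M → ℂ} {F : ℂ → ℂ}

theorem order_ne_top_Omega (hF : DifferentiableOn ℂ F (Omega c)) (hne : ∃ z ∈ Omega c, F z ≠ 0) :
    ∀ z ∈ Omega c, analyticOrderAt F z ≠ ⊤ := fun _ hz =>
  analyticOrderAt_ne_top_of_exists_ne_zero (isOpen_Omega c) (isPreconnected_Omega c) hF hne hz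

theorem order_natAt_ne_zero_iff {V : Set ℂ} (hV : IsOpen V) (hF : DifferentiableOn ℂ F V)
    (hord : ∀ z ∈ V, analyticOrderAt F z ≠ ⊤) {z : ℂ} (hz : z ∈ V) :
    analyticOrderNatAt F z ≠ 0 ↔ F z = 0 := by
  have h1 := (hF.analyticOnNhd hV z hz).analyticOrderAt_eq_zero
  rw [analyticOrderNatAt, Ne, ENat.toNat_eq_zero, or_iff_left (hord z hz), h1, not_not]

theorem locallyFiniteWeight_order (hF : DifferentiableOn ℂ F (Omega c))
    (hne : ∃ z ∈ Omega c, F z ≠ 0) : LocallyFiniteWeight c (analyticOrderNatAt F) := fun t ht =>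
  (finite_zeros_inter_compact (isOpen_Omega c) hF (order_ne_top_Omega hF hne)
    (isCompact_closedRegion c t) (closedRegion_subset_Omega ht)).subset fun _ hz =>
    ⟨hz.1, (order_natAt_ne_zero_iff (isOpen_Omega c) hF (order_ne_top_Omega hF hne)
      (closedRegion_subset_Omega ht hz.1)).1 hz.2⟩

theorem bdryIntegrable_log_norm_of_differentiableOn {t : ℝ} (ht : Separated c t)
    (hF : DifferentiableOn ℂ F (Omega c)) : BdryIntegrable c (fun z => Real.log ‖F z‖) t :=
  bdryIntegrable_log_norm ht fun z hz =>
    (hF.analyticOnNhd (isOpen_Omega c) z (closedRegion_subset_Omega ht.pos hz)).meromorphicAt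

/-- Jensen's formula for the punctured plane. -/
theorem weightCounting_order_eq {s r : ℝ} (hs : Separated c s) (hsr : s ≤ r)
    (hF : DifferentiableOn ℂ F (Omega c)) (hne : ∃ z ∈ Omega c, F z ≠ 0) :
    weightCounting c (analyticOrderNatAt F) s r =
      bdryAvg c (fun z => Real.log ‖F z‖) r - bdryAvg c (fun z => Real.log ‖F z‖) s := by
  have hord := order_ne_top_Omega hF hne
  have hr := hs.mono hsr
  have hsub := closedRegion_subset_Omega (c := c) hr.pos
  have hfin := finite_zeros_inter_compact (isOpen_Omega c) hF hord (isCompact_closedRegion c r) hsub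
  -- The linear factors account for the count through their entry times; the quotient `G` has no
  -- zeros in the region and its boundary average does not change.
  obtain ⟨G, hG, hGZ, hFG⟩ := exists_factor_zeros (isOpen_Omega c) hfin.toFinset hF
    (fun a ha => hsub (hfin.mem_toFinset.1 ha).1) hord
  have hG0 : ∀ z ∈ closedRegion c r, G z ≠ 0 := by
    intro z hz
    by_cases h : F z = 0
    · exact hGZ z (hfin.mem_toFinset.2 ⟨hz, h⟩)
    · intro h0
      rw [hFG z (hsub hz), h0, mul_zero] at h
      exact h rfl
  rw [(weightCounting_eq_sum hs hsr (Z := hfin.toFinset)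
    (fun a ha => (hfin.mem_toFinset.1 ha).1) fun z hz hz' => hfin.mem_toFinset.2
      ⟨hz, (order_natAt_ne_zero_iff (isOpen_Omega c) hF hord (hsub hz)).1 hz'⟩).2]
  have hexp : ∀ t, s ≤ t → t ≤ r → bdryAvg c (fun z => Real.log ‖F z‖) t =
      ∑ a ∈ hfin.toFinset, analyticOrderNatAt F a * bdryAvg c (fun z => Real.log ‖z - a‖) t +
        bdryAvg c (fun z => Real.log ‖G z‖) t := by
    intro t hst htr
    have ht := hs.mono hst
    have hlin : ∀ a : ℂ, BdryIntegrable c (fun z => Real.log ‖z - a‖) t := fun a =>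
      bdryIntegrable_log_norm_of_differentiableOn ht (by fun_prop)
    have hGi := bdryIntegrable_log_norm_of_differentiableOn ht hG
    simp only [← bdryAvg_const_mul]
    rw [← bdryAvg_sum fun a _ => (hlin a).const_mul _,
      ← bdryAvg_add (BdryIntegrable.sum fun a _ => (hlin a).const_mul _) hGi]
    refine bdryAvg_congr ht.pos (bdryIntegrable_log_norm_of_differentiableOn ht hF)
      ((BdryIntegrable.sum fun a _ => (hlin a).const_mul _).add hGi)
      hfin.countable fun z hz hz' => ?_
    have hzt : z ∈ closedRegion c t := by
      rcases hz with hz | ⟨j, hz⟩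
      · exact ht.outer_circle_subset hz
      · exact ht.inner_circle_subset j hz
    have hzr := closedRegion_mono ht.pos htr hzt
    rw [hFG z (hsub hzr), norm_mul, norm_prod, Real.log_mul _ (norm_ne_zero_iff.2 (hG0 z hzr)),
      Real.log_prod]
    · simp
    · intro a ha
      simp only [norm_pow]
      refine pow_ne_zero _ (norm_ne_zero_iff.2 (sub_ne_zero.2 ?_))
      rintro rfl
      exact hz' (hfin.mem_toFinset.1 ha)
    · refine Finset.prod_ne_zero_iff.2 fun a ha => ?_
      simp only [norm_pow]
      refine pow_ne_zero _ (norm_ne_zero_iff.2 (sub_ne_zero.2 ?_))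
      rintro rfl
      exact hz' (hfin.mem_toFinset.1 ha)
  rw [hexp r hsr le_rfl, hexp s le_rfl hsr, bdryAvg_log_norm_eq_of_ne_zero hs hsr hG hG0]
  simp only [mul_sub, Finset.sum_sub_distrib]
  ring

/-- The counting function in Jensen's formula is nonnegative. This bounds averages of `-log ‖F‖` at
every later radius by their value at the initial one. -/
theorem bdryAvg_log_norm_mono {s r : ℝ} (hs : Separated c s) (hsr : s ≤ r)
    (hF : DifferentiableOn ℂ F (Omega c)) (hne : ∃ z ∈ Omega c, F z ≠ 0) :
    bdryAvg c (fun z => Real.log ‖F z‖) s ≤ bdryAvg c (fun z => Real.log ‖F z‖) r := by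
  have h := weightCounting_order_eq hs hsr hF hne
  have h0 : 0 ≤ weightCounting c (analyticOrderNatAt F) s r :=
    intervalIntegral.integral_nonneg hsr fun t ht =>
      div_nonneg (Nat.cast_nonneg _) (hs.pos.le.trans ht.1)
  linarith

/-- The number of zeros in a smaller region is controlled by the counting function. -/
theorem weightCount_mul_log_le {s t r : ℝ} (hs : Separated c s) (hst : s ≤ t) (htr : t ≤ r)
    {m : ℂ → ℕ} (hm : LocallyFiniteWeight c m) :
    weightCount c m t * Real.log (r / t) ≤ weightCounting c m s r := by
  have ht := hs.mono hst
  have hsplit : weightCounting c m s r = weightCounting c m s t + weightCounting c m t r :=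
    (intervalIntegral.integral_add_adjacent_intervals (hm.intervalIntegrable hs hst)
      (hm.intervalIntegrable ht htr)).symm
  have h0 : 0 ≤ weightCounting c m s t :=
    intervalIntegral.integral_nonneg hst fun t ht =>
      div_nonneg (Nat.cast_nonneg _) (hs.pos.le.trans ht.1)
  have hcont : ContinuousOn (fun x : ℝ => (weightCount c m t : ℝ) * x⁻¹) (Icc t r) :=
    continuousOn_const.mul (continuousOn_inv₀.mono fun x hx => (ht.pos.trans_le hx.1).ne')
  have h1 : (weightCount c m t : ℝ) * Real.log (r / t) =
      ∫ x in t..r, (weightCount c m t : ℝ) * x⁻¹ := by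
    rw [intervalIntegral.integral_const_mul, integral_inv]
    rw [uIcc_of_le htr]
    exact fun h => absurd h.1 (not_le.2 ht.pos)
  have h2 : (weightCount c m t : ℝ) * Real.log (r / t) ≤ weightCounting c m t r := by
    rw [h1]
    refine intervalIntegral.integral_mono_on htr (hcont.intervalIntegrable_of_Icc htr)
      (hm.intervalIntegrable ht htr) fun x hx => ?_
    rw [← div_eq_mul_inv]
    have := hm.weightCount_mono ht hx.1
    have hx0 : 0 < x := ht.pos.trans_le hx.1
    gcongr
  linarith

end Jensen

end PuncturedPlane

end

/-! ### Cartan's averaging formula. -/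

section

open Set Filter Topology Metric

namespace PuncturedPlane

section Cartan
open MeasureTheory

/-- Jensen's formula for the polynomial `a ↦ w₁ + a w₂`. Averaging over `a` trades a maximum of
norms for norms of holomorphic functions, to which Jensen's formula in `z` applies. -/
theorem circleAverage_log_norm_add_mul (w₁ w₂ : ℂ) :
    CircleIntegrable (fun a => Real.log ‖w₁ + a * w₂‖) 0 1 ∧
    Real.circleAverage (fun a => Real.log ‖w₁ + a * w₂‖) 0 1 = Real.log (max ‖w₁‖ ‖w₂‖) := by
  constructor
  · exact MeromorphicOn.circleIntegrable_log_norm fun z _ => by fun_prop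
  by_cases h : w₂ = 0
  · simp [h, Real.circleAverage_const]
  have h1 : Real.circleAverage (fun a => Real.log ‖w₁ + a * w₂‖) 0 1 =
      Real.circleAverage (fun a => Real.log ‖w₂‖ + Real.log ‖a + w₁ / w₂‖) 0 1 := by
    have h2 : CircleIntegrable (fun a => Real.log ‖a + w₁ / w₂‖) 0 1 :=
      MeromorphicOn.circleIntegrable_log_norm fun z _ => by fun_prop
    have h3 : CircleIntegrable (fun a => Real.log ‖w₂‖ + Real.log ‖a + w₁ / w₂‖) 0 1 :=
      (circleIntegrable_const _ _ _).add h2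
    have h4 : CircleIntegrable (fun a => Real.log ‖w₁ + a * w₂‖) 0 1 :=
      MeromorphicOn.circleIntegrable_log_norm fun z _ => by fun_prop
    have key : ∀ z ∉ ({-(w₁ / w₂)} : Set ℂ),
        Real.log ‖w₁ + z * w₂‖ = Real.log ‖w₂‖ + Real.log ‖z + w₁ / w₂‖ := by
      intro z hz
      have hz' : z + w₁ / w₂ ≠ 0 := fun h0 => hz (eq_neg_of_add_eq_zero_left h0)
      rw [← Real.log_mul (norm_ne_zero_iff.2 h) (norm_ne_zero_iff.2 hz'), ← norm_mul]
      congr 2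
      field_simp
      ring
    exact le_antisymm
      (circleAverage_mono_of_countable one_ne_zero h4 h3 (countable_singleton _)
        fun z _ hz => (key z hz).le)
      (circleAverage_mono_of_countable one_ne_zero h3 h4 (countable_singleton _)
        fun z _ hz => (key z hz).ge)
  rw [h1, Real.circleAverage_fun_add (circleIntegrable_const _ _ _)
    (MeromorphicOn.circleIntegrable_log_norm fun z _ => by fun_prop), Real.circleAverage_const,
    circleAverage_log_norm_add_const_eq_posLog]
  have hw : 0 < ‖w₂‖ := norm_pos_iff.2 h
  by_cases hle : ‖w₁‖ ≤ ‖w₂‖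
  · rw [max_eq_right hle, (Real.posLog_eq_zero_iff _).2, add_zero]
    rw [norm_div, abs_of_nonneg (by positivity), div_le_one hw]
    exact hle
  · push Not at hle
    rw [max_eq_left hle.le, Real.posLog_eq_log, norm_div, Real.log_div (hw.trans hle).ne' hw.ne']
    · ring
    · rw [norm_div, abs_of_nonneg (by positivity), le_div_iff₀ hw]
      linarith

/-- Fubini in the angles of `a` and `z`. The kernel `K` has logarithmic singularities but is bounded
above by `B`, so its absolute integrability follows from `|K| ≤ 2B - K` and the known integral of
`K` over `a`. -/
theorem circleAverage_log_max {p q : ℂ → ℂ} {x : ℂ} {ρ : ℝ} (hρ : 0 < ρ)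
    (hp : ContinuousOn p (sphere x ρ)) (hq : ContinuousOn q (sphere x ρ))
    (hmax : CircleIntegrable (fun z => Real.log (max ‖p z‖ ‖q z‖)) x ρ) :
    CircleIntegrable (fun a => Real.circleAverage (fun z => Real.log ‖p z + a * q z‖) x ρ) 0 1 ∧
    Real.circleAverage (fun a => Real.circleAverage (fun z => Real.log ‖p z + a * q z‖) x ρ) 0 1 =
      Real.circleAverage (fun z => Real.log (max ‖p z‖ ‖q z‖)) x ρ := by
  have hpi := Real.two_pi_pos
  obtain ⟨B₀, hB₀⟩ := (isCompact_sphere x ρ).exists_bound_of_continuousOn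
    ((continuous_norm.comp_continuousOn hp).add (continuous_norm.comp_continuousOn hq))
  set B := Real.log (max B₀ 1) with hB
  have hB1 : 0 ≤ B := Real.log_nonneg (le_max_right _ _)
  set p' : ℝ → ℂ := fun β => p (circleMap x ρ β) with hp'
  set q' : ℝ → ℂ := fun β => q (circleMap x ρ β) with hq'
  have hpc : Continuous p' := hp.comp_continuous (continuous_circleMap x ρ)
    fun θ => circleMap_mem_sphere x hρ.le θ
  have hqc : Continuous q' := hq.comp_continuous (continuous_circleMap x ρ)
    fun θ => circleMap_mem_sphere x hρ.le θ
  set K : ℝ → ℝ → ℝ := fun α β => Real.log ‖p' β + circleMap 0 1 α * q' β‖ with hK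
  have hKmeas : Measurable (Function.uncurry K) := by
    have : Continuous fun r : ℝ × ℝ => ‖p' r.2 + circleMap 0 1 r.1 * q' r.2‖ := by fun_prop
    exact Real.measurable_log.comp this.measurable
  have hKB : ∀ α β, K α β ≤ B := by
    intro α β
    have h1 : ‖p' β + circleMap 0 1 α * q' β‖ ≤ max B₀ 1 := by
      have h2 := hB₀ _ (circleMap_mem_sphere x hρ.le β)
      have h3 := norm_add_le (p' β) (circleMap 0 1 α * q' β)
      rw [norm_mul, norm_circleMap_zero, abs_one, one_mul] at h3
      have h4 := (le_abs_self _).trans h2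
      exact (h3.trans h4).trans (le_max_left _ _)
    rcases (norm_nonneg (p' β + circleMap 0 1 α * q' β)).eq_or_lt with h0 | h0
    · simp only [hK, ← h0, Real.log_zero]; exact hB1
    · exact Real.log_le_log h0 h1
  have hin : ∀ β, IntegrableOn (fun α => K α β) (Ioc 0 (2 * Real.pi)) ∧
      ∫ α in Ioc 0 (2 * Real.pi), K α β = 2 * Real.pi * Real.log (max ‖p' β‖ ‖q' β‖) := by
    intro β
    obtain ⟨h1, h2⟩ := circleAverage_log_norm_add_mul (p' β) (q' β)
    rw [CircleIntegrable, intervalIntegrable_iff_integrableOn_Ioc_of_le hpi.le] at h1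
    refine ⟨h1, ?_⟩
    rw [Real.circleAverage, intervalIntegral.integral_of_le hpi.le, smul_eq_mul] at h2
    rw [← h2, mul_inv_cancel_left₀ hpi.ne']
  have hL : IntegrableOn (fun β => Real.log (max ‖p' β‖ ‖q' β‖)) (Ioc 0 (2 * Real.pi)) := by
    rwa [CircleIntegrable, intervalIntegrable_iff_integrableOn_Ioc_of_le hpi.le] at hmax
  have hprod : Integrable (Function.uncurry K)
      ((volume.restrict (Ioc 0 (2 * Real.pi))).prod (volume.restrict (Ioc 0 (2 * Real.pi)))) := by
    refine (integrable_prod_iff' hKmeas.aestronglyMeasurable).2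
      ⟨Eventually.of_forall fun β => (hin β).1, ?_⟩
    refine Integrable.mono' (g := fun β => 2 * Real.pi * (2 * B) -
      2 * Real.pi * Real.log (max ‖p' β‖ ‖q' β‖)) ((integrable_const _).sub (hL.const_mul _))
      hKmeas.norm.stronglyMeasurable.integral_prod_left'.aestronglyMeasurable
      (Eventually.of_forall fun β => ?_)
    rw [Real.norm_of_nonneg (integral_nonneg fun _ => norm_nonneg _), ← (hin β).2]
    have hc : 2 * Real.pi * (2 * B) = ∫ α in Ioc 0 (2 * Real.pi), 2 * B := by
      simp [Real.pi_pos.le]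
    rw [hc, ← integral_sub (integrable_const _) (hin β).1]
    refine integral_mono (hin β).1.norm ((integrable_const _).sub (hin β).1) fun α => ?_
    have := hKB α β
    simp only [Function.uncurry, Real.norm_eq_abs]
    rw [abs_le]
    constructor <;> linarith
  have hInt := hprod.integral_prod_left
  constructor
  · rw [CircleIntegrable, intervalIntegrable_iff_integrableOn_Ioc_of_le hpi.le]
    refine (hInt.const_mul (2 * Real.pi)⁻¹).congr (Eventually.of_forall fun α => ?_)
    simp only [Real.circleAverage, intervalIntegral.integral_of_le hpi.le, smul_eq_mul]
    rfl
  · have hswap := integral_integral_swap hprod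
    simp only [Real.circleAverage, intervalIntegral.integral_of_le hpi.le, smul_eq_mul]
    congr 1
    calc _ = (2 * Real.pi)⁻¹ * ∫ α in Ioc 0 (2 * Real.pi), ∫ β in Ioc 0 (2 * Real.pi), K α β := by
          rw [← integral_const_mul]
      _ = (2 * Real.pi)⁻¹ * ∫ β in Ioc 0 (2 * Real.pi),
            2 * Real.pi * Real.log (max ‖p' β‖ ‖q' β‖) := by
          rw [hswap]; simp only [(hin _).2]
      _ = _ := by rw [integral_const_mul, inv_mul_cancel_left₀ hpi.ne']

end Cartan

section Bdry
variable {M : ℕ} {c : Fin M → ℂ} {p q : ℂ → ℂ} {t : ℝ}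

/-- `log u` is bounded above by compactness and below by the integrable `log ‖p‖`, off a countable
set. -/
theorem circleIntegrable_of_le_of_log_norm_le {u : ℂ → ℝ} {x : ℂ} {ρ : ℝ} (hρ : 0 < ρ)
    (hu : ContinuousOn u (sphere x ρ)) (hp : CircleIntegrable (fun z => Real.log ‖p z‖) x ρ)
    {Z : Set ℂ} (hZ : Z.Countable) (hpZ : ∀ z ∈ sphere x ρ, z ∉ Z → 0 < ‖p z‖ ∧ ‖p z‖ ≤ u z) :
    CircleIntegrable (fun z => Real.log (u z)) x ρ := by
  obtain ⟨B₀, hB₀⟩ := (isCompact_sphere x ρ).exists_bound_of_continuousOn hu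
  have huc : Continuous fun θ => u (circleMap x ρ θ) :=
    hu.comp_continuous (continuous_circleMap x ρ) fun θ => circleMap_mem_sphere x hρ.le θ
  have hg : CircleIntegrable (fun z => |Real.log ‖p z‖| + |Real.log (max B₀ 1)|) x ρ :=
    hp.abs.add (circleIntegrable_const _ _ _)
  unfold CircleIntegrable at hg ⊢
  rw [intervalIntegrable_iff] at hg ⊢
  refine hg.mono' (Real.measurable_log.comp huc.measurable).aestronglyMeasurable ?_
  refine MeasureTheory.ae_restrict_of_ae ?_
  filter_upwards [MeasureTheory.compl_mem_ae_iff.2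
    ((hZ.preimage_circleMap x hρ.ne').measure_zero MeasureTheory.volume)] with θ hθ
  obtain ⟨h1, h2⟩ := hpZ _ (circleMap_mem_sphere x hρ.le θ) hθ
  have h3 := (le_abs_self _).trans (hB₀ _ (circleMap_mem_sphere x hρ.le θ))
  have h4 := Real.log_le_log h1 h2
  have h5 := Real.log_le_log (h1.trans_le h2) (h3.trans (le_max_left B₀ 1))
  have h6 := neg_abs_le (Real.log ‖p (circleMap x ρ θ)‖)
  have h7 := le_abs_self (Real.log (max B₀ 1))
  have h8 := abs_nonneg (Real.log (max B₀ 1))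
  have h9 := abs_nonneg (Real.log ‖p (circleMap x ρ θ)‖)
  rw [Real.norm_eq_abs, abs_le]
  constructor <;> linarith

theorem countable_zeros_inter_closedRegion (ht : 0 < t) (hp : DifferentiableOn ℂ p (Omega c))
    (hpne : ∃ z ∈ Omega c, p z ≠ 0) : {z ∈ closedRegion c t | p z = 0}.Countable :=
  (finite_zeros_inter_compact (isOpen_Omega c) hp (order_ne_top_Omega hp hpne)
    (isCompact_closedRegion c t) (closedRegion_subset_Omega ht)).countable

theorem bdryIntegrable_log_of_norm_le {u : ℂ → ℝ} (ht : Separated c t)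
    (hp : DifferentiableOn ℂ p (Omega c)) (hpne : ∃ z ∈ Omega c, p z ≠ 0)
    (hu : ContinuousOn u (closedRegion c t)) (hpu : ∀ z ∈ closedRegion c t, ‖p z‖ ≤ u z) :
    BdryIntegrable c (fun z => Real.log (u z)) t := by
  have hi := bdryIntegrable_log_norm_of_differentiableOn ht hp
  have hZ := countable_zeros_inter_closedRegion ht.pos hp hpne
  have key : ∀ z ∈ closedRegion c t, z ∉ {z ∈ closedRegion c t | p z = 0} →
      0 < ‖p z‖ ∧ ‖p z‖ ≤ u z := fun z hz hz' =>
    ⟨norm_pos_iff.2 fun h => hz' ⟨hz, h⟩, hpu z hz⟩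
  exact ⟨circleIntegrable_of_le_of_log_norm_le ht.pos (hu.mono ht.outer_circle_subset) hi.1 hZ
      fun z hz => key z (ht.outer_circle_subset hz),
    fun j => circleIntegrable_of_le_of_log_norm_le (one_div_pos.2 ht.pos)
      (hu.mono (ht.inner_circle_subset j)) (hi.2 j) hZ
      fun z hz => key z (ht.inner_circle_subset j hz)⟩

theorem bdryIntegrable_log_max (ht : Separated c t) (hp : DifferentiableOn ℂ p (Omega c))
    (hq : DifferentiableOn ℂ q (Omega c)) (hpne : ∃ z ∈ Omega c, p z ≠ 0) :
    BdryIntegrable c (fun z => Real.log (max ‖p z‖ ‖q z‖)) t := by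
  have hsub := closedRegion_subset_Omega (c := c) ht.pos
  exact bdryIntegrable_log_of_norm_le ht hp hpne
    ((hp.continuousOn.mono hsub).norm.sup (hq.continuousOn.mono hsub).norm)
    fun z _ => le_max_left _ _

/-- Cartan's averaging formula. -/
theorem bdryAvg_log_max (ht : Separated c t) (hp : DifferentiableOn ℂ p (Omega c))
    (hq : DifferentiableOn ℂ q (Omega c)) (hpne : ∃ z ∈ Omega c, p z ≠ 0) :
    CircleIntegrable (fun a => bdryAvg c (fun z => Real.log ‖p z + a * q z‖) t) 0 1 ∧
    Real.circleAverage (fun a => bdryAvg c (fun z => Real.log ‖p z + a * q z‖) t) 0 1 =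
      bdryAvg c (fun z => Real.log (max ‖p z‖ ‖q z‖)) t := by
  have hi := bdryIntegrable_log_max ht hp hq hpne
  have hsub := closedRegion_subset_Omega (c := c) ht.pos
  have hpc := hp.continuousOn.mono hsub
  have hqc := hq.continuousOn.mono hsub
  have h0 := circleAverage_log_max ht.pos (hpc.mono ht.outer_circle_subset)
    (hqc.mono ht.outer_circle_subset) hi.1
  have hj := fun j => circleAverage_log_max (one_div_pos.2 ht.pos)
    (hpc.mono (ht.inner_circle_subset j)) (hqc.mono (ht.inner_circle_subset j)) (hi.2 j)
  have hs : CircleIntegrable (fun a => ∑ j,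
      Real.circleAverage (fun z => Real.log ‖p z + a * q z‖) (c j) (1 / t)) 0 1 :=
    CircleIntegrable.fun_sum _ fun j _ => (hj j).1
  refine ⟨h0.1.add hs, ?_⟩
  simp only [bdryAvg]
  rw [Real.circleAverage_fun_add h0.1 hs, h0.2,
    Real.circleAverage_fun_sum fun j _ => (hj j).1]
  congr 1
  exact Finset.sum_congr rfl fun j _ => (hj j).2

/-- By Cartan's formula both sides are means over `a` of boundary averages of `log ‖p + a q‖`, each
of which is monotone by Jensen's formula. -/
theorem bdryAvg_log_max_mono {s r : ℝ} (hs : Separated c s) (hsr : s ≤ r)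
    (hp : DifferentiableOn ℂ p (Omega c)) (hq : DifferentiableOn ℂ q (Omega c))
    (hpne : ∃ z ∈ Omega c, p z ≠ 0)
    (hpq : ∀ a : ℂ, ‖a‖ = 1 → ∃ z ∈ Omega c, p z + a * q z ≠ 0) :
    bdryAvg c (fun z => Real.log (max ‖p z‖ ‖q z‖)) s ≤
      bdryAvg c (fun z => Real.log (max ‖p z‖ ‖q z‖)) r := by
  have h1 := bdryAvg_log_max hs hp hq hpne
  have h2 := bdryAvg_log_max (hs.mono hsr) hp hq hpne
  rw [← h1.2, ← h2.2]
  refine Real.circleAverage_mono h1.1 h2.1 fun a ha => ?_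
  refine bdryAvg_log_norm_mono hs hsr (hp.add (hq.const_mul a)) (hpq a ?_)
  simpa using ha

/-- If the values `p + a q` have at most `K` zeros, the boundary average of
`log (max ‖p‖ ‖q‖)` grows at most like `K log r`. -/
theorem bdryAvg_log_max_le_of_weightCount_le {s : ℝ} (hs : Separated c s)
    (hp : DifferentiableOn ℂ p (Omega c)) (hq : DifferentiableOn ℂ q (Omega c))
    (hpne : ∃ z ∈ Omega c, p z ≠ 0)
    (hpq : ∀ a : ℂ, ‖a‖ = 1 → ∃ z ∈ Omega c, p z + a * q z ≠ 0) {K : ℝ}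
    (hK : ∀ a : ℂ, ‖a‖ = 1 → ∀ t, s ≤ t →
      (weightCount c (analyticOrderNatAt fun z => p z + a * q z) t : ℝ) ≤ K) {r : ℝ} (hsr : s ≤ r) :
    bdryAvg c (fun z => Real.log (max ‖p z‖ ‖q z‖)) r ≤
      bdryAvg c (fun z => Real.log (max ‖p z‖ ‖q z‖)) s + K * Real.log (r / s) := by
  have h1 := bdryAvg_log_max hs hp hq hpne
  have h2 := bdryAvg_log_max (hs.mono hsr) hp hq hpne
  rw [← h1.2, ← h2.2, ← Real.circleAverage_const (K * Real.log (r / s)) 0 1,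
    ← Real.circleAverage_fun_add h1.1 (circleIntegrable_const _ _ _)]
  refine Real.circleAverage_mono h2.1 (h1.1.add (circleIntegrable_const _ _ _)) fun a ha => ?_
  have ha1 : ‖a‖ = 1 := by simpa using ha
  have hd : DifferentiableOn ℂ (fun z => p z + a * q z) (Omega c) := hp.add (hq.const_mul a)
  have hJ := weightCounting_order_eq hs hsr hd (hpq a ha1)
  have hm := locallyFiniteWeight_order hd (hpq a ha1)
  have h3 : weightCounting c (analyticOrderNatAt fun z => p z + a * q z) s r ≤
      K * Real.log (r / s) := by
    have h4 : K * Real.log (r / s) = ∫ x in s..r, K * x⁻¹ := by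
      rw [intervalIntegral.integral_const_mul, integral_inv]
      rw [uIcc_of_le hsr]
      exact fun h => absurd h.1 (not_le.2 hs.pos)
    rw [h4]
    have hcont : ContinuousOn (fun x : ℝ => K * x⁻¹) (Icc s r) :=
      continuousOn_const.mul (continuousOn_inv₀.mono fun x hx => (hs.pos.trans_le hx.1).ne')
    refine intervalIntegral.integral_mono_on hsr (hm.intervalIntegrable hs hsr)
      (hcont.intervalIntegrable_of_Icc hsr) fun x hx => ?_
    rw [← div_eq_mul_inv]
    exact div_le_div_of_nonneg_right (hK a ha1 x hx.1) (hs.pos.le.trans hx.1)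
  linarith

end Bdry

/-! ### Borel's growth lemma. -/

section Borel

/-- Borel's growth lemma: for monotone `S ≥ 1`, the inequality `S (r + 1 / S r) < 2 S r` holds
outside a set of finite measure. -/
theorem exists_borel_exceptional {S : ℝ → ℝ} {r₀ : ℝ} (hS : MonotoneOn S (Ici r₀))
    (h1 : ∀ r ∈ Ici r₀, 1 ≤ S r) :
    ∃ E : Set ℝ, MeasurableSet E ∧ MeasureTheory.volume E < ⊤ ∧
      ∀ r ∈ Ici r₀, r ∉ E → S (r + 1 / S r) < 2 * S r := by
  set E₀ : Set ℝ := {r ∈ Ici r₀ | 2 * S r ≤ S (r + 1 / S r)} with hE₀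
  -- Two exceptional points of one dyadic level more than `2 ^ (-k)` apart would force `S` to double
  -- inside the level. So level `k` has diameter at most `2 ^ (-k)`, and these bounds are summable.
  set A : ℕ → Set ℝ := fun k => {r ∈ E₀ | 2 ^ k ≤ S r ∧ S r < 2 ^ (k + 1)} with hA
  have hdiam : ∀ k, MeasureTheory.volume (A k) ≤ ENNReal.ofReal ((1 / 2) ^ k) := by
    intro k
    refine Real.volume_le_diam (A k) |>.trans (Metric.ediam_le ?_)
    have key : ∀ x ∈ A k, ∀ y ∈ A k, x ≤ y → y - x ≤ (1 / 2 : ℝ) ^ k := by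
      intro x hx y hy hxy
      by_contra hlt
      push Not at hlt
      have hxpos : 0 < S x := zero_lt_one.trans_le (h1 x hx.1.1)
      have h2 : 1 / S x ≤ (1 / 2 : ℝ) ^ k := by
        rw [one_div_pow]
        exact one_div_le_one_div_of_le (by positivity) hx.2.1
      have h3 : S (x + 1 / S x) ≤ S y := hS
        (mem_Ici.2 ((mem_Ici.1 hx.1.1).trans (le_add_of_nonneg_right (by positivity)))) hy.1.1
        (by linarith)
      have h4 := hx.1.2
      have h5 := hx.2.1
      have h6 := hy.2.2
      rw [pow_succ] at h6
      linarith
    intro x hx y hy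
    rw [edist_dist, Real.dist_eq]
    refine ENNReal.ofReal_le_ofReal ?_
    rcases le_total x y with h | h
    · rw [abs_of_nonpos (by linarith), neg_sub]
      exact key x hx y hy h
    · rw [abs_of_nonneg (by linarith)]
      exact key y hy x hx h
  have hcover : E₀ ⊆ ⋃ k, A k := by
    intro r hr
    obtain ⟨k, hk⟩ := exists_nat_pow_near (h1 r hr.1) one_lt_two
    exact mem_iUnion.2 ⟨k, hr, hk⟩
  have hfin : MeasureTheory.volume E₀ < ⊤ := by
    refine (MeasureTheory.measure_mono hcover).trans_lt
      ((MeasureTheory.measure_iUnion_le A).trans_lt ?_)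
    refine (ENNReal.tsum_le_tsum hdiam).trans_lt ?_
    rw [← ENNReal.ofReal_tsum_of_nonneg (fun k => by positivity)
      (summable_geometric_of_lt_one (by norm_num) (by norm_num))]
    exact ENNReal.ofReal_lt_top
  refine ⟨MeasureTheory.toMeasurable MeasureTheory.volume E₀,
    MeasureTheory.measurableSet_toMeasurable _ _, by rwa [MeasureTheory.measure_toMeasurable],
    fun r hr hrE => ?_⟩
  by_contra hlt
  push Not at hlt
  exact hrE (MeasureTheory.subset_toMeasurable _ _ ⟨hr, hlt⟩)

end Borel

end PuncturedPlane

end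

/-! ### Choosing small circles; derivative estimates from the real part. -/

section

open Set Filter Topology Metric MeasureTheory

namespace PuncturedPlane

/-- Polar coordinates about `x`. With `lintegral` the integrand may have singularities, and no
integrability over the plane has to be known beforehand. -/
theorem lintegral_annulus {U : ℂ → ENNReal} (hU : Measurable U) (x : ℂ) {a b : ℝ} (ha : 0 ≤ a) :
    ∫⁻ w in {w : ℂ | ‖w - x‖ ∈ Ioo a b}, U w =
      ∫⁻ t in Ioo a b, ENNReal.ofReal t *
        ∫⁻ θ in Ioo (-Real.pi) Real.pi, U (circleMap x t θ) := by
  have hms : MeasurableSet {w : ℂ | ‖w - x‖ ∈ Ioo a b} :=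
    measurableSet_Ioo.preimage (by fun_prop : Measurable fun w : ℂ => ‖w - x‖)
  rw [← lintegral_indicator hms, ← lintegral_add_right_eq_self _ x,
    ← Complex.lintegral_comp_polarCoord_symm, polarCoord_target, Measure.volume_eq_prod,
    ← Measure.prod_restrict]
  have hfun : ∀ p : ℝ × ℝ, p ∈ Ioi (0 : ℝ) ×ˢ Ioo (-Real.pi) Real.pi →
      ENNReal.ofReal p.1 • ({w : ℂ | ‖w - x‖ ∈ Ioo a b}.indicator U
        (Complex.polarCoord.symm p + x)) =
      (Ioo a b).indicator (fun t => ENNReal.ofReal t) p.1 * U (circleMap x p.1 p.2) := by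
    rintro ⟨t, θ⟩ ⟨ht, hθ⟩
    have ht0 : 0 < t := ht
    have h1 : Complex.polarCoord.symm (t, θ) + x = circleMap x t θ := by
      rw [Complex.polarCoord_symm_apply, circleMap, Complex.exp_mul_I]
      push_cast; ring
    simp only [h1, smul_eq_mul]
    have h2 : ‖circleMap x t θ - x‖ = t := by simp [circleMap, abs_of_pos ht0]
    by_cases h : t ∈ Ioo a b
    · rw [indicator_of_mem (by simpa [h2, abs_of_pos ht0] using h), indicator_of_mem h]
    · rw [indicator_of_notMem (by simpa [h2, abs_of_pos ht0] using h), indicator_of_notMem h]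
      simp
  have hcm : Measurable fun p : ℝ × ℝ => circleMap x p.1 p.2 := by
    unfold circleMap
    fun_prop
  have hmeas : Measurable fun p : ℝ × ℝ =>
      (Ioo a b).indicator (fun t => ENNReal.ofReal t) p.1 * U (circleMap x p.1 p.2) :=
    ((Measurable.indicator (by fun_prop) measurableSet_Ioo).comp measurable_fst).mul (hU.comp hcm)
  rw [Measure.prod_restrict, setLIntegral_congr_fun
    (measurableSet_Ioi.prod measurableSet_Ioo) (fun p hp => hfun p hp), ← Measure.prod_restrict,
    lintegral_prod _ hmeas.aemeasurable]
  have h3 : ∀ t : ℝ, ∫⁻ θ in Ioo (-Real.pi) Real.pi,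
      (Ioo a b).indicator (fun t => ENNReal.ofReal t) t * U (circleMap x t θ) =
      (Ioo a b).indicator (fun t => ENNReal.ofReal t *
        ∫⁻ θ in Ioo (-Real.pi) Real.pi, U (circleMap x t θ)) t := by
    intro t
    have hUt : Measurable fun θ => U (circleMap x t θ) := hU.comp (continuous_circleMap x t).measurable
    rw [lintegral_const_mul _ hUt]
    by_cases h : t ∈ Ioo a b
    · simp [h]
    · simp [h]
  simp only [h3]
  rw [lintegral_indicator measurableSet_Ioo, Measure.restrict_restrict measurableSet_Ioo,
    inter_eq_self_of_subset_left fun t ht => mem_Ioi.2 (lt_of_le_of_lt ha ht.1)]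

theorem lintegral_circle {u : ℂ → ℝ} (hu : ∀ w, 0 ≤ u w) {x : ℂ} {t : ℝ}
    (hi : CircleIntegrable u x t) :
    ∫⁻ θ in Ioo (-Real.pi) Real.pi, ENNReal.ofReal (u (circleMap x t θ)) =
      ENNReal.ofReal (2 * Real.pi * Real.circleAverage u x t) := by
  have hper : Function.Periodic (fun θ => u (circleMap x t θ)) (2 * Real.pi) := fun θ => by
    simp only [periodic_circleMap x t θ]
  have h1 : IntervalIntegrable (fun θ => u (circleMap x t θ)) volume (-Real.pi) Real.pi :=
    hper.intervalIntegrable₀ Real.two_pi_pos.ne' hi _ _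
  have h2 : ∫ θ in (0 : ℝ)..2 * Real.pi, u (circleMap x t θ) =
      ∫ θ in (-Real.pi)..Real.pi, u (circleMap x t θ) := by
    have := hper.intervalIntegral_add_eq 0 (-Real.pi)
    rw [zero_add] at this
    rw [this]; congr 1; ring
  have hlt : -Real.pi ≤ Real.pi := by linarith [Real.pi_pos]
  rw [Real.circleAverage_def, smul_eq_mul, ← mul_assoc,
    mul_inv_cancel₀ Real.two_pi_pos.ne', one_mul, h2, intervalIntegral.integral_of_le hlt,
    ofReal_integral_eq_lintegral_ofReal ((intervalIntegrable_iff_integrableOn_Ioc_of_le hlt).1 h1)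
      (Eventually.of_forall fun θ => hu _), Measure.restrict_congr_set Ioo_ae_eq_Ioc]

/-- The integral over a disc is bounded through the averages over the circles of an annulus that
contains the disc. -/
theorem lintegral_ball_le_of_circleAverage_le {u : ℂ → ℝ} (hum : Measurable u) (hu : ∀ w, 0 ≤ u w)
    {x z : ℂ} {ρ δ B : ℝ} (hδ : 0 < δ) (hδρ : δ ≤ ρ) (hz : ‖z - x‖ = ρ)
    (hB : ∀ t ∈ Ioo (ρ - δ) (ρ + δ), CircleIntegrable u x t ∧ Real.circleAverage u x t ≤ B) :
    ∫⁻ w in {w : ℂ | ‖w - z‖ ∈ Ioo 0 δ}, ENNReal.ofReal (u w) ≤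
      ENNReal.ofReal (8 * Real.pi * δ * ρ * B) := by
  have hB0 : 0 ≤ B := (Real.circleAverage_nonneg_of_nonneg fun w _ => hu w).trans
    (hB ρ ⟨by linarith, by linarith⟩).2
  have hsub : {w : ℂ | ‖w - z‖ ∈ Ioo 0 δ} ⊆ {w : ℂ | ‖w - x‖ ∈ Ioo (ρ - δ) (ρ + δ)} := by
    intro w hw
    have h1 : ‖w - x‖ ≤ ‖w - z‖ + ‖z - x‖ := norm_sub_le_norm_sub_add_norm_sub _ _ _
    have h2 : ‖z - x‖ ≤ ‖z - w‖ + ‖w - x‖ := norm_sub_le_norm_sub_add_norm_sub _ _ _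
    rw [norm_sub_rev z w] at h2
    rw [hz] at h1 h2
    exact ⟨by linarith [hw.2], by linarith [hw.2]⟩
  refine (lintegral_mono_set hsub).trans ?_
  rw [lintegral_annulus hum.ennreal_ofReal x (by linarith)]
  -- The annulus has width `2δ`, its radii are below `2ρ`, and each angular integral is at most
  -- `2πB`: the product is `8πδρB`.
  have h1 : ∀ t ∈ Ioo (ρ - δ) (ρ + δ), ENNReal.ofReal t *
      ∫⁻ θ in Ioo (-Real.pi) Real.pi, ENNReal.ofReal (u (circleMap x t θ)) ≤
      ENNReal.ofReal (2 * ρ * (2 * Real.pi * B)) := by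
    intro t ht
    rw [lintegral_circle hu (hB t ht).1, ← ENNReal.ofReal_mul (by linarith [ht.1])]
    refine ENNReal.ofReal_le_ofReal ?_
    have := Real.pi_pos
    have h3 : 0 ≤ Real.circleAverage u x t := Real.circleAverage_nonneg_of_nonneg fun w _ => hu w
    refine mul_le_mul (by linarith [ht.2]) ?_ (by positivity) (by linarith)
    gcongr
    exact (hB t ht).2
  refine (setLIntegral_mono' measurableSet_Ioo h1).trans ?_
  rw [setLIntegral_const, Real.volume_Ioo, ← ENNReal.ofReal_mul (by
    have := Real.pi_pos
    have : 0 ≤ ρ := by linarith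
    positivity)]
  refine ENNReal.ofReal_le_ofReal (le_of_eq ?_)
  ring

/-- Otherwise the annulus `δ/2 < |w - z| < δ` alone would carry more than `(δ/2) · (δ/2) · 2π ·
16ρB/δ = 8πδρB`, the bound for the whole disc. Thus a bound on circles about `x` passes to a circle
about a point `z`. -/
theorem exists_radius_circleAverage_le {u : ℂ → ℝ} (hum : Measurable u) (hu : ∀ w, 0 ≤ u w)
    {x z : ℂ} {ρ δ B : ℝ} (hδ : 0 < δ) (hδρ : δ ≤ ρ) (hz : ‖z - x‖ = ρ)
    (hB : ∀ t ∈ Ioo (ρ - δ) (ρ + δ), CircleIntegrable u x t ∧ Real.circleAverage u x t ≤ B)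
    (hi : ∀ s ∈ Ioo (δ / 2) δ, CircleIntegrable u z s) :
    ∃ s ∈ Ioo (δ / 2) δ, Real.circleAverage u z s ≤ 16 * ρ * B / δ := by
  by_contra! hcon
  have h1 := lintegral_ball_le_of_circleAverage_le hum hu hδ hδρ hz hB
  have hB0 : 0 ≤ B := (Real.circleAverage_nonneg_of_nonneg fun w _ => hu w).trans
    (hB ρ ⟨by linarith, by linarith⟩).2
  have hρ : 0 < ρ := by linarith
  set κ := 16 * ρ * B / δ with hκ
  have hκ0 : 0 ≤ κ := by positivity
  have hpi := Real.pi_pos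
  have hsub : Ioo (δ / 2) δ ⊆ Ioo 0 δ := Ioo_subset_Ioo_left (by linarith)
  rw [lintegral_annulus hum.ennreal_ofReal z le_rfl] at h1
  have h2 := (lintegral_mono_set hsub).trans h1
  have hv : ENNReal.ofReal (8 * Real.pi * δ * ρ * B) =
      ∫⁻ t in Ioo (δ / 2) δ, ENNReal.ofReal (δ / 2 * (2 * Real.pi * κ)) := by
    rw [setLIntegral_const, Real.volume_Ioo, ← ENNReal.ofReal_mul (by positivity)]
    congr 1
    rw [hκ]
    field_simp
    ring
  rw [hv] at h2
  have hlt : ∀ t ∈ Ioo (δ / 2) δ, ENNReal.ofReal (δ / 2 * (2 * Real.pi * κ)) < ENNReal.ofReal t *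
      ∫⁻ θ in Ioo (-Real.pi) Real.pi, ENNReal.ofReal (u (circleMap z t θ)) := by
    intro t ht
    have ht0 : 0 < t := (hsub ht).1
    have h5 := hcon t ht
    rw [lintegral_circle hu (hi t ht), ← ENNReal.ofReal_mul (by linarith [ht.1])]
    refine (ENNReal.ofReal_lt_ofReal_iff (by nlinarith [mul_pos hpi ht0])).2 ?_
    have h6 : 2 * Real.pi * κ < 2 * Real.pi * Real.circleAverage u z t := by gcongr
    calc δ / 2 * (2 * Real.pi * κ) ≤ t * (2 * Real.pi * κ) := by
          gcongr; exact ht.1.le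
      _ < _ := by gcongr
  refine absurd h2 (not_le.2 ?_)
  refine setLIntegral_strict_mono measurableSet_Ioo ?_ ?_ ?_ (Eventually.of_forall hlt)
  · rw [Real.volume_Ioo]
    simp [hδ]
  · have : Measurable fun p : ℝ × ℝ => ENNReal.ofReal (u (circleMap z p.1 p.2)) :=
      (hum.comp (by unfold circleMap; fun_prop)).ennreal_ofReal
    exact ENNReal.measurable_ofReal.mul (this.lintegral_prod_right' (ν := volume.restrict _))
  · rw [setLIntegral_const, Real.volume_Ioo]
    exact ENNReal.mul_ne_top ENNReal.ofReal_ne_top ENNReal.ofReal_ne_top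

/-- Derivatives of a holomorphic function are controlled by averages of its real part. -/
theorem norm_iteratedDeriv_le_circleAverage_re {L : ℂ → ℂ} {z : ℂ} {s : ℝ} (hs : 0 < s)
    (hL : DifferentiableOn ℂ L (closedBall z s)) {k : ℕ} (hk : 1 ≤ k) :
    ‖iteratedDeriv k L z‖ ≤
      2 * k.factorial / s ^ k * Real.circleAverage (fun w => |(L w).re|) z s := by
  have hcont : Continuous fun θ => L (circleMap z s θ) :=
    (hL.continuousOn.mono sphere_subset_closedBall).comp_continuous (continuous_circleMap z s)
      fun θ => circleMap_mem_sphere z hs.le θ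
  have hpi := Real.two_pi_pos
  -- the two Fourier coefficients
  have h1 : ∫ θ in (0 : ℝ)..2 * Real.pi, L (circleMap z s θ) * Complex.exp (-(k * θ * Complex.I)) =
      2 * Real.pi * s ^ k / k.factorial * iteratedDeriv k L z := by
    have h := hL.circleIntegral_one_div_sub_center_pow_smul hs k
    rw [circleIntegral] at h
    have hfun : ∀ θ : ℝ, deriv (circleMap z s) θ • (1 / (circleMap z s θ - z) ^ (k + 1)) •
        L (circleMap z s θ) = Complex.I / s ^ k *
          (L (circleMap z s θ) * Complex.exp (-(k * θ * Complex.I))) := by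
      intro θ
      have hs' : (s : ℂ) ≠ 0 := by exact_mod_cast hs.ne'
      have he : Complex.exp (-(k * θ * Complex.I)) = (Complex.exp (θ * Complex.I) ^ k)⁻¹ := by
        rw [Complex.exp_neg, ← Complex.exp_nat_mul]; ring_nf
      have hne := Complex.exp_ne_zero (θ * Complex.I)
      simp only [deriv_circleMap, circleMap, smul_eq_mul, zero_add, add_sub_cancel_left, he]
      field_simp
      ring
    simp only [hfun] at h
    rw [intervalIntegral.integral_const_mul] at h
    have hs' : (s : ℂ) ≠ 0 := by exact_mod_cast hs.ne'
    have hI := Complex.I_ne_zero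
    have hk' : (k.factorial : ℂ) ≠ 0 := by exact_mod_cast k.factorial_ne_zero
    simp only [smul_eq_mul] at h
    field_simp at h ⊢
    linear_combination h
  have h2 : ∫ θ in (0 : ℝ)..2 * Real.pi, L (circleMap z s θ) * Complex.exp (k * θ * Complex.I) =
      0 := by
    have h : (∮ w in C(z, s), (w - z) ^ (k - 1) * L w) = 0 := by
      refine Complex.circleIntegral_eq_zero_of_differentiable_on_off_countable hs.le
        countable_empty ((by fun_prop : Continuous fun w : ℂ => (w - z) ^ (k - 1)).continuousOn.mul
          hL.continuousOn) fun w hw => ?_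
      exact (by fun_prop : DifferentiableAt ℂ (fun w : ℂ => (w - z) ^ (k - 1)) w).mul
        (hL.differentiableAt (closedBall_mem_nhds_of_mem hw.1))
    rw [circleIntegral] at h
    have hfun : ∀ θ : ℝ, deriv (circleMap z s) θ • ((circleMap z s θ - z) ^ (k - 1) *
        L (circleMap z s θ)) = Complex.I * s ^ k *
          (L (circleMap z s θ) * Complex.exp (k * θ * Complex.I)) := by
      intro θ
      have he : Complex.exp (k * θ * Complex.I) = Complex.exp (θ * Complex.I) ^ k := by
        rw [← Complex.exp_nat_mul]; ring_nf
      obtain ⟨j, rfl⟩ : ∃ j, k = j + 1 := ⟨k - 1, by omega⟩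
      simp only [deriv_circleMap, circleMap, smul_eq_mul, zero_add, add_sub_cancel_left, he,
        Nat.add_sub_cancel]
      ring
    simp only [hfun] at h
    rw [intervalIntegral.integral_const_mul] at h
    have hs' : (s : ℂ) ≠ 0 := by exact_mod_cast hs.ne'
    exact (mul_eq_zero.1 h).resolve_left (mul_ne_zero Complex.I_ne_zero (pow_ne_zero _ hs'))
  have h3 : ∫ θ in (0 : ℝ)..2 * Real.pi, (starRingEnd ℂ) (L (circleMap z s θ)) *
      Complex.exp (-(k * θ * Complex.I)) = 0 := by
    have : ∀ θ : ℝ, (starRingEnd ℂ) (L (circleMap z s θ)) * Complex.exp (-(k * θ * Complex.I)) =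
        (starRingEnd ℂ) (L (circleMap z s θ) * Complex.exp (k * θ * Complex.I)) := by
      intro θ
      rw [map_mul, ← Complex.exp_conj]
      simp
    simp only [this]
    rw [intervalIntegral.integral_of_le hpi.le, integral_conj,
      ← intervalIntegral.integral_of_le hpi.le, h2, map_zero]
  -- The opposite Fourier coefficient of `L` vanishes by holomorphy, so adding the conjugate of `L`
  -- leaves the integral unchanged and replaces `L` by `2 Re L`.
  have h4 : ∫ θ in (0 : ℝ)..2 * Real.pi, (2 * ((L (circleMap z s θ)).re : ℂ)) *
      Complex.exp (-(k * θ * Complex.I)) =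
      2 * Real.pi * s ^ k / k.factorial * iteratedDeriv k L z := by
    rw [← h1, ← add_zero (∫ θ in (0 : ℝ)..2 * Real.pi, L (circleMap z s θ) *
      Complex.exp (-(k * θ * Complex.I))), ← h3, ← intervalIntegral.integral_add]
    · refine intervalIntegral.integral_congr fun θ _ => ?_
      rw [← add_mul, Complex.add_conj]
      push_cast; ring
    · exact (hcont.mul (by fun_prop)).intervalIntegrable _ _
    · exact ((Complex.continuous_conj.comp hcont).mul (by fun_prop)).intervalIntegrable _ _
  have h5 : ‖2 * Real.pi * s ^ k / k.factorial * iteratedDeriv k L z‖ ≤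
      ∫ θ in (0 : ℝ)..2 * Real.pi, 2 * |(L (circleMap z s θ)).re| := by
    rw [← h4]
    refine (intervalIntegral.norm_integral_le_integral_norm hpi.le).trans (le_of_eq ?_)
    refine intervalIntegral.integral_congr fun θ _ => ?_
    have : ‖Complex.exp (-(k * θ * Complex.I))‖ = 1 := by
      rw [show -(k * θ * Complex.I) = ((-(k * θ) : ℝ) : ℂ) * Complex.I by push_cast; ring]
      exact Complex.norm_exp_ofReal_mul_I _
    simp [this]
  rw [intervalIntegral.integral_const_mul] at h5
  rw [Real.circleAverage_def, smul_eq_mul]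
  have h6 : ‖(2 * Real.pi * s ^ k / k.factorial : ℂ) * iteratedDeriv k L z‖ =
      2 * Real.pi * s ^ k / k.factorial * ‖iteratedDeriv k L z‖ := by
    rw [norm_mul]
    congr 1
    rw [show (2 * Real.pi * s ^ k / k.factorial : ℂ) =
      ((2 * Real.pi * s ^ k / k.factorial : ℝ) : ℂ) by push_cast; ring]
    rw [Complex.norm_real, Real.norm_of_nonneg (by positivity)]
  rw [h6] at h5
  have hk' : (0 : ℝ) < k.factorial := by exact_mod_cast k.factorial_pos
  have hsk : 0 < s ^ k := by positivity
  have hp := Real.pi_pos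
  set I := ∫ θ in (0 : ℝ)..2 * Real.pi, |(L (circleMap z s θ)).re|
  rw [show 2 * (k.factorial : ℝ) / s ^ k * ((2 * Real.pi)⁻¹ * I) =
    (2 * I) / (2 * Real.pi * s ^ k / k.factorial) by field_simp]
  rw [le_div_iff₀ (by positivity)]
  linarith

/-- A nonvanishing holomorphic function on a disc has a holomorphic logarithm. -/
theorem exists_log_on_ball {P : ℂ → ℂ} {z : ℂ} {R : ℝ} (hR : 0 < R)
    (hP : DifferentiableOn ℂ P (ball z R)) (h0 : ∀ w ∈ ball z R, P w ≠ 0) :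
    ∃ L : ℂ → ℂ, (∀ w ∈ ball z R, HasDerivAt L (logDeriv P w) w) ∧
      ∀ w ∈ ball z R, (L w).re = Real.log ‖P w‖ := by
  have hφ : DifferentiableOn ℂ (logDeriv P) (ball z R) := (hP.deriv isOpen_ball).div hP h0
  obtain ⟨L₀, hL₀⟩ := hφ.isExactOn_ball
  have hder : ∀ w ∈ ball z R, HasDerivAt (fun w => P w * Complex.exp (-L₀ w)) 0 w := by
    intro w hw
    have h1 := (hP.differentiableAt (isOpen_ball.mem_nhds hw)).hasDerivAt
    refine (h1.mul (hL₀ w hw).neg.cexp).congr_deriv ?_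
    have := h0 w hw
    rw [logDeriv_apply]
    field_simp
    ring
  obtain ⟨κ, hκ⟩ : ∃ κ, ∀ w ∈ ball z R, P w * Complex.exp (-L₀ w) = κ := by
    refine ⟨P z * Complex.exp (-L₀ z), fun w hw => ?_⟩
    exact (convex_ball z R).is_const_of_fderivWithin_eq_zero (𝕜 := ℂ)
      (f := fun w => P w * Complex.exp (-L₀ w))
      (fun w hw => (hder w hw).differentiableAt.differentiableWithinAt)
      (fun w hw => by
        rw [fderivWithin_of_isOpen isOpen_ball hw]
        ext
        simp [(hder w hw).deriv]) hw (mem_ball_self hR)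
  -- Only the real part has to be normalized, so a real constant suffices and no logarithm of `κ`
  -- itself is chosen.
  refine ⟨fun w => L₀ w + Real.log ‖κ‖, fun w hw => (hL₀ w hw).add_const _, fun w hw => ?_⟩
  have h1 : P w = κ * Complex.exp (L₀ w) := by
    rw [← hκ w hw, mul_assoc, ← Complex.exp_add]; simp
  have hκ0 : κ ≠ 0 := by rintro rfl; exact h0 w hw (by rw [h1]; simp)
  rw [h1, norm_mul, Real.log_mul (norm_ne_zero_iff.2 hκ0) (norm_ne_zero_iff.2
    (Complex.exp_ne_zero _)), Complex.norm_exp, Real.log_exp]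
  simp [add_comm]

end PuncturedPlane

end

/-! ### Averages of pole terms and the concavity of the logarithm. -/

section

open Set Filter Topology Metric MeasureTheory

namespace PuncturedPlane

/-- On `[0, π/2]` Jordan's inequality `2θ/π ≤ sin θ` compares the integrand with `θ ^ (-1/2)`;
symmetry and the period `π` do the rest. -/
theorem intervalIntegrable_inv_sqrt_abs_sin (a b : ℝ) :
    IntervalIntegrable (fun θ => (√|Real.sin θ|)⁻¹) volume a b := by
  have hpi := Real.pi_pos
  have hper : Function.Periodic (fun θ => (√|Real.sin θ|)⁻¹) Real.pi := fun θ => by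
    simp [Real.sin_add_pi]
  have hmeas : Measurable fun θ => (√|Real.sin θ|)⁻¹ := by fun_prop
  have h1 : IntervalIntegrable (fun θ => (√|Real.sin θ|)⁻¹) volume 0 (Real.pi / 2) := by
    have h := (intervalIntegral.intervalIntegrable_rpow' (a := 0) (b := Real.pi / 2)
      (r := -(1 / 2)) (by norm_num)).const_mul (√(2 / Real.pi))⁻¹
    refine h.mono_fun hmeas.aestronglyMeasurable ?_
    refine (ae_restrict_iff' measurableSet_uIoc).2 (Eventually.of_forall fun θ hθ => ?_)
    rw [uIoc_of_le (by positivity)] at hθ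
    change ‖(√|Real.sin θ|)⁻¹‖ ≤ ‖(√(2 / Real.pi))⁻¹ * θ ^ (-(1 / 2) : ℝ)‖
    rw [Real.norm_of_nonneg (by positivity), Real.norm_of_nonneg
      (mul_nonneg (by positivity) (Real.rpow_nonneg hθ.1.le _)), Real.rpow_neg hθ.1.le,
      ← Real.sqrt_eq_rpow, ← mul_inv, ← Real.sqrt_mul (by positivity)]
    have h2 : 2 / Real.pi * θ ≤ |Real.sin θ| :=
      (Real.mul_le_sin hθ.1.le hθ.2).trans (le_abs_self _)
    have h3 : 0 < √(2 / Real.pi * θ) := Real.sqrt_pos.2 (by have := hθ.1; positivity)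
    exact inv_anti₀ h3 (Real.sqrt_le_sqrt h2)
  have h2 : IntervalIntegrable (fun θ => (√|Real.sin θ|)⁻¹) volume (-(Real.pi / 2)) 0 := by
    have := (IntervalIntegrable.iff_comp_neg (f := fun θ => (√|Real.sin θ|)⁻¹)).1 h1
    simpa using this.symm
  refine hper.intervalIntegrable hpi.ne' (t := -(Real.pi / 2)) ?_ a b
  rw [show -(Real.pi / 2) + Real.pi = Real.pi / 2 by ring]
  exact h2.trans h1

/-- Rotate so that `a - x` becomes a nonnegative real number; the imaginary part is then a lower
bound for the distance. -/
theorem mul_abs_sin_le_norm_circleMap_sub (x a : ℂ) {ρ : ℝ} (hρ : 0 ≤ ρ) (θ : ℝ) :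
    ρ * |Real.sin (θ - (a - x).arg)| ≤ ‖circleMap x ρ θ - a‖ := by
  set b := a - x with hb
  have h1 : ‖circleMap x ρ θ - a‖ =
      ‖(ρ : ℂ) * Complex.exp ((θ - b.arg : ℝ) * Complex.I) - ‖b‖‖ := by
    have h2 : circleMap x ρ θ - a = ((ρ : ℂ) * Complex.exp ((θ - b.arg : ℝ) * Complex.I) - ‖b‖) *
        Complex.exp (b.arg * Complex.I) := by
      rw [sub_mul, mul_assoc, ← Complex.exp_add, Complex.norm_mul_exp_arg_mul_I, circleMap, hb]
      push_cast
      ring_nf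
    rw [h2, norm_mul, Complex.norm_exp_ofReal_mul_I, mul_one]
  rw [h1]
  refine le_trans (le_of_eq ?_) (Complex.abs_im_le_norm _)
  rw [Complex.exp_mul_I, ← Complex.ofReal_sin, ← Complex.ofReal_cos, Complex.sub_im,
    Complex.im_ofReal_mul, Complex.ofReal_im, sub_zero, Complex.add_im, Complex.ofReal_im, zero_add,
    Complex.im_ofReal_mul, Complex.I_im, mul_one, abs_mul, abs_of_nonneg hρ]

/-- The exponent `1/2` keeps the mean finite, uniformly in `a`, even for `a` on the circle. The
poles `|z - a| ^ (-(k+1))` are not integrable there; under the logarithm they are reduced to powers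
of this function. -/
theorem exists_circleAverage_inv_sqrt_le : ∃ C : ℝ, 0 < C ∧ ∀ (x a : ℂ) (ρ : ℝ), 0 < ρ →
    CircleIntegrable (fun z => (√‖z - a‖)⁻¹) x ρ ∧
    Real.circleAverage (fun z => (√‖z - a‖)⁻¹) x ρ ≤ C / √ρ := by
  set I := ∫ θ in (0 : ℝ)..2 * Real.pi, (√|Real.sin θ|)⁻¹ with hI
  have hpi := Real.two_pi_pos
  have hI0 : 0 ≤ I := intervalIntegral.integral_nonneg hpi.le fun θ _ => by positivity
  refine ⟨(2 * Real.pi)⁻¹ * I + 1, by positivity, fun x a ρ hρ => ?_⟩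
  set α := (a - x).arg
  have hg : IntervalIntegrable (fun θ => (√ρ)⁻¹ * (√|Real.sin (θ - α)|)⁻¹) volume 0
      (2 * Real.pi) := by
    have := (intervalIntegrable_inv_sqrt_abs_sin (0 - α) (2 * Real.pi - α)).comp_sub_right α
    simpa using this.const_mul (√ρ)⁻¹
  have hmeas : Measurable fun θ => (√‖circleMap x ρ θ - a‖)⁻¹ := by unfold circleMap; fun_prop
  have hZ : {θ : ℝ | Real.sin (θ - α) = 0}.Countable := by
    refine (countable_range fun n : ℤ => (n : ℝ) * Real.pi + α).mono fun θ hθ => ?_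
    obtain ⟨n, hn⟩ := Real.sin_eq_zero_iff.1 hθ
    exact ⟨n, by simp [hn]⟩
  have hae : ∀ᵐ θ : ℝ, (√‖circleMap x ρ θ - a‖)⁻¹ ≤ (√ρ)⁻¹ * (√|Real.sin (θ - α)|)⁻¹ := by
    filter_upwards [hZ.ae_notMem volume] with θ hθ
    rw [← mul_inv, ← Real.sqrt_mul hρ.le]
    have : 0 < |Real.sin (θ - α)| := abs_pos.2 hθ
    exact inv_anti₀ (by positivity)
      (Real.sqrt_le_sqrt (mul_abs_sin_le_norm_circleMap_sub x a hρ.le θ))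
  have hi : CircleIntegrable (fun z => (√‖z - a‖)⁻¹) x ρ := by
    refine hg.mono_fun hmeas.aestronglyMeasurable ?_
    filter_upwards [ae_restrict_of_ae hae] with θ hθ
    rwa [Real.norm_of_nonneg (by positivity), Real.norm_of_nonneg (by positivity)]
  refine ⟨hi, ?_⟩
  have h1 : ∫ θ in (0 : ℝ)..2 * Real.pi, (√‖circleMap x ρ θ - a‖)⁻¹ ≤
      ∫ θ in (0 : ℝ)..2 * Real.pi, (√ρ)⁻¹ * (√|Real.sin (θ - α)|)⁻¹ :=
    intervalIntegral.integral_mono_ae hpi.le hi hg hae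
  have hper : Function.Periodic (fun θ => (√|Real.sin θ|)⁻¹) (2 * Real.pi) := fun θ => by simp
  have h2 : ∫ θ in (0 : ℝ)..2 * Real.pi, (√|Real.sin (θ - α)|)⁻¹ = I := by
    rw [intervalIntegral.integral_comp_sub_right (fun θ => (√|Real.sin θ|)⁻¹), hI]
    have := hper.intervalIntegral_add_eq (0 - α) 0
    rw [zero_add] at this
    rw [← this]; congr 1; ring
  rw [intervalIntegral.integral_const_mul, h2] at h1
  rw [Real.circleAverage_def, smul_eq_mul]
  calc (2 * Real.pi)⁻¹ * ∫ θ in (0 : ℝ)..2 * Real.pi, (√‖circleMap x ρ θ - a‖)⁻¹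
      ≤ (2 * Real.pi)⁻¹ * ((√ρ)⁻¹ * I) := by gcongr
    _ = (2 * Real.pi)⁻¹ * I / √ρ := by rw [div_eq_mul_inv]; ring
    _ ≤ _ := by gcongr; linarith

/-- Concavity of the logarithm for circle averages. -/
theorem circleAverage_log_one_add_le {Y : ℂ → ℝ} (hY : ∀ z, 0 ≤ Y z) (hYm : Measurable Y) {x : ℂ}
    {ρ : ℝ} (hi : CircleIntegrable Y x ρ) :
    CircleIntegrable (fun z => Real.log (1 + Y z)) x ρ ∧
    Real.circleAverage (fun z => Real.log (1 + Y z)) x ρ ≤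
      Real.log (1 + Real.circleAverage Y x ρ) := by
  have h0 : ∀ z, 0 ≤ Real.log (1 + Y z) := fun z => Real.log_nonneg (by linarith [hY z])
  have h1 : CircleIntegrable (fun z => Real.log (1 + Y z)) x ρ := by
    have hm : Measurable fun θ => Real.log (1 + Y (circleMap x ρ θ)) :=
      Real.measurable_log.comp ((hYm.comp (continuous_circleMap x ρ).measurable).const_add 1)
    refine IntervalIntegrable.mono_fun hi hm.aestronglyMeasurable (Eventually.of_forall fun θ => ?_)
    simp only
    rw [Real.norm_of_nonneg (h0 _), Real.norm_of_nonneg (hY _)]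
    have := Real.log_le_sub_one_of_pos (by linarith [hY (circleMap x ρ θ)] :
      0 < 1 + Y (circleMap x ρ θ))
    linarith
  refine ⟨h1, ?_⟩
  set m := Real.circleAverage Y x ρ
  have hm : 0 ≤ m := Real.circleAverage_nonneg_of_nonneg fun z _ => hY z
  -- This is the tangent line of the logarithm at `1 + m`; it lies above the graph and its average
  -- is `log (1 + m)`.
  have h2 : CircleIntegrable (fun z => Real.log (1 + m) + (1 + m)⁻¹ * (Y z - m)) x ρ := by
    have h4 : CircleIntegrable (fun z => Y z - m) x ρ := hi.sub (circleIntegrable_const _ _ _)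
    have h5 : CircleIntegrable (fun z => (1 + m)⁻¹ • (Y z - m)) x ρ := h4.const_fun_smul
    exact (circleIntegrable_const _ _ _).add h5
  have h3 : Real.circleAverage (fun z => Real.log (1 + m) + (1 + m)⁻¹ * (Y z - m)) x ρ =
      Real.log (1 + m) := by
    have h4 : CircleIntegrable (fun z => Y z - m) x ρ := hi.sub (circleIntegrable_const _ _ _)
    have h5 : CircleIntegrable (fun z => (1 + m)⁻¹ • (Y z - m)) x ρ := h4.const_fun_smul
    rw [show (fun z => Real.log (1 + m) + (1 + m)⁻¹ * (Y z - m)) =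
      fun z => (fun _ => Real.log (1 + m)) z + (fun z => (1 + m)⁻¹ • (Y z - m)) z from rfl,
      Real.circleAverage_fun_add (circleIntegrable_const _ _ _) h5, Real.circleAverage_const, Real.circleAverage_fun_smul,
      Real.circleAverage_fun_sub hi (circleIntegrable_const _ _ _), Real.circleAverage_const]
    simp [m]
  rw [← h3]
  refine Real.circleAverage_mono h1 h2 fun z _ => ?_
  have hp : 0 < 1 + m := by linarith
  have hp' : 0 < 1 + Y z := by linarith [hY z]
  have := Real.log_le_sub_one_of_pos (div_pos hp' hp)
  rw [Real.log_div hp'.ne' hp.ne'] at this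
  have h6 : (1 + Y z) / (1 + m) - 1 = (1 + m)⁻¹ * (Y z - m) := by field_simp; ring
  linarith

theorem iteratedDeriv_inv_sub (l : ℕ) (a z : ℂ) :
    iteratedDeriv l (fun w => (w - a)⁻¹) z = (-1) ^ l * l.factorial * ((z - a) ^ (l + 1))⁻¹ := by
  have := congrFun (iter_deriv_inv_linear_sub l (1 : ℂ) a) z
  rw [iteratedDeriv_eq_iterate]
  simp only [one_mul, one_pow, mul_one] at this
  rw [this, show (-1 - (l : ℤ)) = -((l + 1 : ℕ) : ℤ) by push_cast; ring, zpow_neg, zpow_natCast]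

theorem analyticAt_logDeriv {F : ℂ → ℂ} {z : ℂ} (hF : AnalyticAt ℂ F z) (h : F z ≠ 0) :
    AnalyticAt ℂ (logDeriv F) z :=
  hF.deriv.div hF h

/-- Derivatives of a logarithmic derivative in terms of a factorization. -/
theorem iteratedDeriv_logDeriv_of_factor {V : Set ℂ} (hV : IsOpen V) {F P : ℂ → ℂ}
    (hP : DifferentiableOn ℂ P V) {Z : Finset ℂ} {m : ℂ → ℕ}
    (hFP : ∀ w ∈ V, F w = (∏ a ∈ Z, (w - a) ^ m a) * P w) {z : ℂ} (hz : z ∈ V)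
    (hZz : z ∉ Z) (hPz : P z ≠ 0) (l : ℕ) :
    iteratedDeriv l (logDeriv F) z =
      ∑ a ∈ Z, m a * ((-1) ^ l * l.factorial * ((z - a) ^ (l + 1))⁻¹) +
        iteratedDeriv l (logDeriv P) z := by
  have hne : ∀ a ∈ Z, z - a ≠ 0 := fun a ha h => hZz (by rwa [sub_eq_zero.1 h])
  have hPan : AnalyticAt ℂ P z := hP.analyticOnNhd hV z hz
  have hev : ∀ᶠ w in 𝓝 z, (∀ a ∈ Z, w - a ≠ 0) ∧ P w ≠ 0 ∧ w ∈ V := by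
    refine Filter.Eventually.and ?_ ((hPan.continuousAt.eventually_ne hPz).and (hV.mem_nhds hz))
    rw [Finset.eventually_all]
    intro a ha
    exact (by fun_prop : ContinuousAt (fun w => w - a) z).eventually_ne (hne a ha)
  have heq : logDeriv F =ᶠ[𝓝 z] fun w => (∑ a ∈ Z, m a * (w - a)⁻¹) + logDeriv P w := by
    filter_upwards [hev] with w hw
    have h1 : F =ᶠ[𝓝 w] fun w => (∏ a ∈ Z, (w - a) ^ m a) * P w := by
      filter_upwards [hV.mem_nhds hw.2.2] with v hv using hFP v hv
    rw [logDeriv_apply, h1.deriv_eq, h1.eq_of_nhds, ← logDeriv_apply (fun w =>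
      (∏ a ∈ Z, (w - a) ^ m a) * P w)]
    rw [logDeriv_mul (f := fun w => ∏ a ∈ Z, (w - a) ^ m a) w
      (Finset.prod_ne_zero_iff.2 fun a ha => pow_ne_zero _ (hw.1 a ha)) hw.2.1 (by fun_prop)
      (hP.differentiableAt (hV.mem_nhds hw.2.2)), logDeriv_prod (f := fun a w => (w - a) ^ m a)
      (fun a ha => pow_ne_zero _ (hw.1 a ha)) fun a _ => by fun_prop]
    congr 1
    refine Finset.sum_congr rfl fun a _ => ?_
    rw [logDeriv_fun_pow (by fun_prop), logDeriv_apply]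
    simp
  rw [heq.iteratedDeriv_eq, iteratedDeriv_fun_add, iteratedDeriv_fun_sum]
  · congr 1
    refine Finset.sum_congr rfl fun a ha => ?_
    rw [iteratedDeriv_const_mul_field, iteratedDeriv_inv_sub]
  · intro a ha
    have := hne a ha
    exact (analyticAt_const.mul ((analyticAt_id.sub analyticAt_const).inv this)).contDiffAt
  · refine AnalyticAt.contDiffAt (Finset.analyticAt_fun_sum _ fun a ha => ?_)
    exact analyticAt_const.mul ((analyticAt_id.sub analyticAt_const).inv (hne a ha))
  · exact (analyticAt_logDeriv hPan hPz).contDiffAt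

end PuncturedPlane

end

/-! ### The lemma on the logarithmic derivative over one circle. -/

section

open Set Filter Topology Metric MeasureTheory

namespace PuncturedPlane

/-- Multiplicities are natural numbers, so `m ≤ m ^ j`; the rest is superadditivity of `x ↦ x ^ j`
on nonnegative reals. -/
theorem pow_sum_natCast_mul_le (Z : Finset ℂ) (m : ℂ → ℕ) {y : ℂ → ℝ} (hy : ∀ a, 0 ≤ y a) {j : ℕ}
    (hj : j ≠ 0) : ∑ a ∈ Z, m a * y a ^ j ≤ (∑ a ∈ Z, m a * y a) ^ j := by
  classical
  induction Z using Finset.induction_on with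
  | empty => simp [hj]
  | insert a Z ha ih =>
    rw [Finset.sum_insert ha, Finset.sum_insert ha]
    have h0 : 0 ≤ ∑ a ∈ Z, m a * y a := Finset.sum_nonneg fun b _ => mul_nonneg (by positivity) (hy b)
    have h1 : (m a : ℝ) * y a ^ j ≤ (m a * y a) ^ j := by
      rw [mul_pow]
      refine mul_le_mul_of_nonneg_right ?_ (pow_nonneg (hy a) j)
      exact_mod_cast Nat.le_self_pow hj (m a)
    exact (add_le_add h1 ih).trans (pow_add_pow_le (mul_nonneg (by positivity) (hy a)) h0 hj)

theorem circleIntegrable_log_norm_of_differentiableOn {V : Set ℂ} (hV : IsOpen V) {F : ℂ → ℂ}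
    (hF : DifferentiableOn ℂ F V) {x : ℂ} {t : ℝ} (ht : 0 ≤ t) (hs : sphere x t ⊆ V) :
    CircleIntegrable (fun z => Real.log ‖F z‖) x t :=
  MeromorphicOn.circleIntegrable_log_norm fun z hz =>
    (hF.analyticOnNhd hV z (hs (by rwa [abs_of_nonneg ht] at hz))).meromorphicAt

theorem circleIntegrable_log_norm_sub (a x : ℂ) (t : ℝ) :
    CircleIntegrable (fun z => Real.log ‖z - a‖) x t :=
  MeromorphicOn.circleIntegrable_log_norm fun z _ => by fun_prop

variable {V : Set ℂ} {p q : ℂ → ℂ}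

/-- A local form of the Poisson–Jensen estimate for the derivatives of a logarithmic derivative. -/
theorem norm_iteratedDeriv_logDeriv_sub_le (hV : IsOpen V) (hp : DifferentiableOn ℂ p V)
    (hq : DifferentiableOn ℂ q V) (hpo : ∀ w ∈ V, analyticOrderAt p w ≠ ⊤)
    (hqo : ∀ w ∈ V, analyticOrderAt q w ≠ ⊤) {z : ℂ} {δ s B : ℝ} (hδ : 2 * δ ≤ 1)
    (hs : s ∈ Ioo (δ / 2) δ) (hsub : closedBall z δ ⊆ V) (hpz : p z ≠ 0) (hqz : q z ≠ 0)
    {Z : Finset ℂ} (hZ : ∀ a, a ∈ Z ↔ a ∈ closedBall z δ ∧ (p a = 0 ∨ q a = 0))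
    (hB : Real.circleAverage (fun w => |Real.log ‖p w‖ - Real.log ‖q w‖|) z s ≤ B) (k : ℕ) :
    ‖iteratedDeriv k (logDeriv p) z - iteratedDeriv k (logDeriv q) z‖ ≤
      ∑ a ∈ Z, ((analyticOrderNatAt p a + analyticOrderNatAt q a : ℕ) : ℝ) *
        (k.factorial * (‖z - a‖ ^ (k + 1))⁻¹) +
      2 * (k + 1).factorial / s ^ (k + 1) * (B +
        (∑ a ∈ Z, ((analyticOrderNatAt p a + analyticOrderNatAt q a : ℕ) : ℝ)) *
          Real.log (1 / s)) := by
  have hδ0 : 0 < δ := by linarith [hs.1, hs.2]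
  have hs0 : 0 < s := by linarith [hs.1]
  have hzV : z ∈ V := hsub (mem_closedBall_self hδ0.le)
  have hZV : ∀ a ∈ Z, a ∈ V := fun a ha => hsub ((hZ a).1 ha).1
  have hZz : z ∉ Z := fun h => ((hZ z).1 h).2.elim hpz hqz
  obtain ⟨P, hP, hPZ, hpP⟩ := exists_factor_zeros hV Z hp hZV hpo
  obtain ⟨Q, hQ, hQZ, hqQ⟩ := exists_factor_zeros hV Z hq hZV hqo
  have hP0 : ∀ w ∈ closedBall z δ, P w ≠ 0 := by
    intro w hw h0
    refine hPZ w ((hZ w).2 ⟨hw, Or.inl ?_⟩) h0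
    rw [hpP w (hsub hw), h0, mul_zero]
  have hQ0 : ∀ w ∈ closedBall z δ, Q w ≠ 0 := by
    intro w hw h0
    refine hQZ w ((hZ w).2 ⟨hw, Or.inr ?_⟩) h0
    rw [hqQ w (hsub hw), h0, mul_zero]
  have hbV : ball z δ ⊆ V := ball_subset_closedBall.trans hsub
  obtain ⟨L₁, hL₁, hL₁r⟩ := exists_log_on_ball hδ0 (hP.mono hbV)
    fun w hw => hP0 w (ball_subset_closedBall hw)
  obtain ⟨L₂, hL₂, hL₂r⟩ := exists_log_on_ball hδ0 (hQ.mono hbV)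
    fun w hw => hQ0 w (ball_subset_closedBall hw)
  set L : ℂ → ℂ := fun w => L₁ w - L₂ w with hLdef
  have hL : ∀ w ∈ ball z δ, HasDerivAt L (logDeriv P w - logDeriv Q w) w := fun w hw =>
    (hL₁ w hw).sub (hL₂ w hw)
  have hsb : closedBall z s ⊆ ball z δ := closedBall_subset_ball hs.2
  have hzb : z ∈ ball z δ := mem_ball_self hδ0
  have hLd : iteratedDeriv (k + 1) L z =
      iteratedDeriv k (logDeriv P) z - iteratedDeriv k (logDeriv Q) z := by
    rw [iteratedDeriv_succ']
    have : deriv L =ᶠ[𝓝 z] logDeriv P - logDeriv Q := by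
      filter_upwards [isOpen_ball.mem_nhds hzb] with w hw using (hL w hw).deriv
    rw [this.iteratedDeriv_eq, iteratedDeriv_sub]
    · exact (analyticAt_logDeriv (hP.analyticOnNhd hV z hzV)
        (hP0 z (ball_subset_closedBall hzb))).contDiffAt
    · exact (analyticAt_logDeriv (hQ.analyticOnNhd hV z hzV)
        (hQ0 z (ball_subset_closedBall hzb))).contDiffAt
  -- the average of the real part of `L`
  set m : ℂ → ℕ := fun a => analyticOrderNatAt p a + analyticOrderNatAt q a with hm
  have hss : sphere z s ⊆ V := sphere_subset_closedBall.trans (hsb.trans hbV)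
  have hint1 : CircleIntegrable (fun w => |Real.log ‖p w‖ - Real.log ‖q w‖|) z s :=
    ((circleIntegrable_log_norm_of_differentiableOn hV hp hs0.le hss).sub
      (circleIntegrable_log_norm_of_differentiableOn hV hq hs0.le hss)).abs
  have hint2 : ∀ a ∈ Z, CircleIntegrable (fun w => (-(m a : ℝ)) • Real.log ‖w - a‖) z s :=
    fun a _ => (circleIntegrable_log_norm_sub a z s).const_fun_smul
  have hLc : ContinuousOn L (sphere z s) := fun w hw =>
    (hL w (hsb (sphere_subset_closedBall hw))).continuousAt.continuousWithinAt
  have hre : Real.circleAverage (fun w => |(L w).re|) z s ≤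
      B + (∑ a ∈ Z, (m a : ℝ)) * Real.log (1 / s) := by
    have h1 : Real.circleAverage (fun w => |(L w).re|) z s ≤
        Real.circleAverage (fun w => |Real.log ‖p w‖ - Real.log ‖q w‖| +
          ∑ a ∈ Z, (-(m a : ℝ)) • Real.log ‖w - a‖) z s := by
      refine circleAverage_mono_of_countable hs0.ne'
        (ContinuousOn.circleIntegrable hs0.le (Complex.continuous_re.comp_continuousOn hLc).abs)
        (hint1.add (CircleIntegrable.fun_sum _ hint2)) (Z := (Z : Set ℂ)) Z.countable_toSet ?_
      intro w hw hwZ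
      rw [abs_of_pos hs0] at hw
      have hwb := hsb (sphere_subset_closedBall hw)
      have hne : ∀ a ∈ Z, ‖w - a‖ ≠ 0 := fun a ha h =>
        hwZ (by rw [norm_eq_zero, sub_eq_zero] at h; rwa [h])
      have hlog : ∀ (F G : ℂ → ℂ) (μ : ℂ → ℕ), F w = (∏ a ∈ Z, (w - a) ^ μ a) * G w → G w ≠ 0 →
          Real.log ‖F w‖ = ∑ a ∈ Z, μ a * Real.log ‖w - a‖ + Real.log ‖G w‖ := by
        intro F G μ hFG hG
        rw [hFG, norm_mul, norm_prod, Real.log_mul (Finset.prod_ne_zero_iff.2 fun a ha => by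
          rw [norm_pow]; exact pow_ne_zero _ (hne a ha)) (norm_ne_zero_iff.2 hG),
          Real.log_prod fun a ha => by rw [norm_pow]; exact pow_ne_zero _ (hne a ha)]
        simp
      have e1 := hlog p P _ (hpP w (hbV hwb)) (hP0 w (ball_subset_closedBall hwb))
      have e2 := hlog q Q _ (hqQ w (hbV hwb)) (hQ0 w (ball_subset_closedBall hwb))
      have e3 : (L w).re = (Real.log ‖p w‖ - Real.log ‖q w‖) -
          ∑ a ∈ Z, ((analyticOrderNatAt p a : ℝ) - analyticOrderNatAt q a) * Real.log ‖w - a‖ := by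
        simp only [hLdef, Complex.sub_re, hL₁r w hwb, hL₂r w hwb, sub_mul, Finset.sum_sub_distrib]
        linarith
      rw [e3]
      refine (abs_sub _ _).trans (add_le_add le_rfl ?_)
      refine (Finset.abs_sum_le_sum_abs _ _).trans (Finset.sum_le_sum fun a ha => ?_)
      -- The purpose of `2 * δ ≤ 1`: `log ‖w - a‖` has a constant sign, so differences of
      -- multiplicities may be replaced by sums, and the mean of `-log ‖w - a‖` over the circle is
      -- at most `log (1 / s)`.
      have hle1 : ‖w - a‖ ≤ 1 := by
        have h1 : dist w z < δ := hwb
        have h2 : dist a z ≤ δ := ((hZ a).1 ha).1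
        rw [← dist_eq_norm]
        linarith [dist_triangle_right w a z]
      have hlog0 : Real.log ‖w - a‖ ≤ 0 := Real.log_nonpos (norm_nonneg _) hle1
      rw [abs_mul, abs_of_nonpos hlog0, smul_eq_mul, neg_mul_comm]
      refine mul_le_mul_of_nonneg_right ?_ (by linarith)
      rw [hm, abs_le]
      push_cast
      have i1 : (0 : ℝ) ≤ analyticOrderNatAt p a := by positivity
      have i2 : (0 : ℝ) ≤ analyticOrderNatAt q a := by positivity
      constructor <;> linarith
    refine h1.trans ?_
    rw [Real.circleAverage_fun_add hint1 (CircleIntegrable.fun_sum _ hint2),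
      Real.circleAverage_fun_sum hint2, Finset.sum_mul]
    refine add_le_add hB (Finset.sum_le_sum fun a _ => ?_)
    rw [Real.circleAverage_fun_smul, circleAverage_log_norm_sub_const_eq_log_radius_add_posLog
      hs0.ne', one_div, Real.log_inv, smul_eq_mul, neg_mul, mul_neg, neg_le_neg_iff]
    gcongr
    linarith [Real.posLog_nonneg (x := |s|⁻¹ * ‖z - a‖), Real.posLog_nonneg (x := s⁻¹ * ‖z - a‖)]
  have hmain := norm_iteratedDeriv_le_circleAverage_re hs0 (L := L) (fun w hw =>
    (hL w (hsb hw)).differentiableAt.differentiableWithinAt) (k := k + 1) (by omega)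
  rw [hLd] at hmain
  rw [iteratedDeriv_logDeriv_of_factor hV hP hpP hzV hZz (hP0 z (ball_subset_closedBall hzb)),
    iteratedDeriv_logDeriv_of_factor hV hQ hqQ hzV hZz (hQ0 z (ball_subset_closedBall hzb)),
    add_sub_add_comm, ← Finset.sum_sub_distrib]
  refine (norm_add_le _ _).trans (add_le_add ?_ ?_)
  · refine (norm_sum_le _ _).trans (Finset.sum_le_sum fun a _ => ?_)
    rw [← sub_mul, norm_mul]
    refine mul_le_mul ?_ ?_ (norm_nonneg _) (by positivity)
    · refine (norm_sub_le _ _).trans ?_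
      simp
    · simp
  · refine hmain.trans ?_
    gcongr

theorem one_add_le_mul_of_le {A T f b n S : ℝ} (hS : S ≤ f * A + 2 * f * T * (8 * b + n))
    (hA : 1 ≤ A) (hT : 1 ≤ T) (hf : 0 ≤ f) (hb : 0 ≤ b) (hn : 0 ≤ n) :
    1 + S ≤ A * ((1 + 16 * f) * T * (2 + b + n)) := by
  have i1 : 1 ≤ A * T := one_le_mul_of_one_le_of_one_le hA hT
  have i2 : A ≤ A * T := le_mul_of_one_le_right (by linarith) hT
  have i3 : T ≤ A * T := le_mul_of_one_le_left (by linarith) hA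
  have i4 := mul_le_mul_of_nonneg_left i2 hf
  have i5 : f * T * (8 * b + n) ≤ f * (A * T) * (8 * b + n) :=
    mul_le_mul_of_nonneg_right (mul_le_mul_of_nonneg_left i3 hf) (by positivity)
  have i6 : 0 ≤ f * (A * T) * b := by positivity
  have i7 : 0 ≤ f * (A * T) * n := by positivity
  have i8 : 0 ≤ f * (A * T) := by positivity
  have i9 : 0 ≤ A * T * b := by positivity
  have i10 : 0 ≤ A * T * n := by positivity
  linarith

set_option maxHeartbeats 1000000 in
/-- A quantitative lemma on the logarithmic derivative over one circle. -/
theorem exists_majorant_log_derivs (K : ℕ) : ∃ C : ℝ, 1 ≤ C ∧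
    ∀ {V : Set ℂ} {p q : ℂ → ℂ} (_ : IsOpen V) (_ : DifferentiableOn ℂ p V)
    (_ : DifferentiableOn ℂ q V) (_ : ∀ w ∈ V, analyticOrderAt p w ≠ ⊤)
    (_ : ∀ w ∈ V, analyticOrderAt q w ≠ ⊤) {x : ℂ} {ρ δ B : ℝ} (_ : 0 < δ) (_ : δ ≤ ρ)
    (_ : 2 * δ ≤ 1) {Z : Finset ℂ}
    (_ : ∀ a, ‖a - x‖ ∈ Icc (ρ - δ) (ρ + δ) → a ∈ V ∧ (p a = 0 ∨ q a = 0 → a ∈ Z))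
    (_ : ∀ t ∈ Ioo (ρ - δ) (ρ + δ),
      Real.circleAverage (fun w => |Real.log ‖p w‖ - Real.log ‖q w‖|) x t ≤ B),
    ∃ g : ℂ → ℝ, CircleIntegrable g x ρ ∧
      Real.circleAverage g x ρ ≤ C * (Real.log (2 / δ) + Real.log (1 + 1 / ρ) +
        Real.log (2 + ρ * B + ∑ a ∈ Z, (analyticOrderNatAt p a + analyticOrderNatAt q a : ℕ))) ∧
      ∀ z ∈ sphere x ρ, p z ≠ 0 → q z ≠ 0 →
        Real.log (1 + ∑ k ∈ Finset.range K,
          ‖iteratedDeriv k (logDeriv p) z - iteratedDeriv k (logDeriv q) z‖) ≤ g z := by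
  obtain ⟨C₀, hC₀, hsq⟩ := exists_circleAverage_inv_sqrt_le
  set κ : ℝ := 1 + 16 * K * K.factorial with hκ
  have hκ1 : 1 ≤ κ := by rw [hκ]; linarith [show (0 : ℝ) ≤ 16 * K * K.factorial by positivity]
  have hlκ : 0 ≤ Real.log κ := Real.log_nonneg hκ1
  have hlC : 0 ≤ Real.log (2 * (1 + C₀)) := Real.log_nonneg (by linarith)
  have hK0 : (0 : ℝ) ≤ K := by positivity
  refine ⟨3 * K + 2 + Real.log κ + 2 * K * Real.log (2 * (1 + C₀)),
    by nlinarith [mul_nonneg hK0 hlC], ?_⟩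
  intro V p q hV hp hq hpo hqo x ρ δ B hδ hδρ hδ1 Z hZ hB
  have hρ : 0 < ρ := hδ.trans_le hδρ
  have hB0 : 0 ≤ B := (Real.circleAverage_nonneg_of_nonneg fun w _ => abs_nonneg _).trans
    (hB ρ ⟨by linarith, by linarith⟩)
  set m : ℂ → ℕ := fun a => analyticOrderNatAt p a + analyticOrderNatAt q a with hm
  set n : ℝ := ((∑ a ∈ Z, m a : ℕ) : ℝ) with hn
  have hn' : n = ∑ a ∈ Z, (m a : ℝ) := by rw [hn]; push_cast; rfl
  have hn0 : 0 ≤ n := by positivity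
  set τ := 2 / δ with hτ
  have hτ4 : 4 ≤ τ := by rw [hτ, le_div_iff₀ hδ]; linarith
  -- `‖z - a‖ ^ (-(k+1))` is the power `2 (k+1) ≤ 2K` of `‖z - a‖ ^ (-1/2)`, so the pole terms are
  -- at most a constant times `(1 + Y) ^ (2K)`. By concavity the mean of `log (1 + Y)` is at most
  -- the logarithm of `1` plus the mean of `Y`.
  set Y : ℂ → ℝ := fun z => ∑ a ∈ Z, (m a : ℝ) * (√‖z - a‖)⁻¹ with hY
  have hY0 : ∀ z, 0 ≤ Y z := fun z => Finset.sum_nonneg fun a _ => by positivity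
  have hYm : Measurable Y := by
    refine Finset.measurable_fun_sum _ fun a _ => ?_
    fun_prop
  have hYs : ∀ a ∈ Z, CircleIntegrable (fun z => (m a : ℝ) • (√‖z - a‖)⁻¹) x ρ := fun a _ =>
    (hsq x a ρ hρ).1.const_fun_smul
  have hYi : CircleIntegrable Y x ρ := CircleIntegrable.fun_sum _ hYs
  have hYa : Real.circleAverage Y x ρ ≤ n * (C₀ / √ρ) := by
    have : Y = fun z => ∑ a ∈ Z, (fun a z => (m a : ℝ) • (√‖z - a‖)⁻¹) a z := rfl
    rw [this, Real.circleAverage_fun_sum hYs, hn', Finset.sum_mul]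
    refine Finset.sum_le_sum fun a _ => ?_
    rw [Real.circleAverage_fun_smul, smul_eq_mul]
    exact mul_le_mul_of_nonneg_left (hsq x a ρ hρ).2 (by positivity)
  obtain ⟨hli, hla⟩ := circleAverage_log_one_add_le hY0 hYm hYi
  -- The part of the bound that does not depend on `z`: `κ` collects factorials and the number of
  -- terms, `K` factors `τ` bound `s ^ (-(k+1))`, and one more bounds `log (1 / s)` and the `1 / δ`
  -- in the mean over the small circle.
  set Λ := Real.log κ + (K + 1) * Real.log τ + Real.log (2 + ρ * B + n) with hΛ
  have hi2 : CircleIntegrable (fun z => ((2 * K : ℕ) : ℝ) • Real.log (1 + Y z)) x ρ :=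
    hli.const_fun_smul
  refine ⟨fun z => ((2 * K : ℕ) : ℝ) • Real.log (1 + Y z) + Λ,
    hi2.add (circleIntegrable_const _ _ _), ?_, ?_⟩
  · rw [Real.circleAverage_fun_add (f₂ := fun _ => Λ) hi2 (circleIntegrable_const _ _ _),
      Real.circleAverage_fun_smul, Real.circleAverage_const, smul_eq_mul]
    have hsρ : 0 < √ρ := Real.sqrt_pos.2 hρ
    have h1 : 1 + Real.circleAverage Y x ρ ≤
        (2 + ρ * B + n) * (2 * (1 + C₀)) * (1 + 1 / ρ) := by
      have h2 : 1 / √ρ ≤ 1 + 1 / ρ := by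
        have h3 : 1 / ρ = (1 / √ρ) ^ 2 := by rw [div_pow, Real.sq_sqrt hρ.le]; simp
        rw [h3]; nlinarith [sq_nonneg (1 / √ρ - 1), sq_nonneg (1 / √ρ)]
      have h4 : n * (C₀ / √ρ) ≤ n * (C₀ * (1 + 1 / ρ)) := by
        rw [div_eq_mul_one_div]; gcongr
      have h5 : 0 ≤ ρ * B := by positivity
      have h6 : 0 < 1 / ρ := by positivity
      refine (add_le_add_right (hYa.trans h4) 1).trans ?_
      have : 1 + n * (C₀ * (1 + 1 / ρ)) ≤ (1 + n) * (2 * (1 + C₀)) * (1 + 1 / ρ) := by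
        have h7 : 0 ≤ n * C₀ * (1 + 1 / ρ) := by positivity
        have h8 : 0 ≤ C₀ * (1 + 1 / ρ) := by positivity
        have h9 : 0 ≤ n * (1 + 1 / ρ) := by positivity
        nlinarith
      refine this.trans ?_
      gcongr
      linarith
    have hpos : 0 < 1 + Real.circleAverage Y x ρ := by
      linarith [Real.circleAverage_nonneg_of_nonneg (c := x) (R := ρ) fun z _ => hY0 z]
    have h5 : 0 ≤ ρ * B := by positivity
    have h6 : 0 < 1 / ρ := by positivity
    have h7 := hla.trans (Real.log_le_log hpos h1)
    rw [Real.log_mul (by positivity) (by positivity), Real.log_mul (by positivity) (by positivity)]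
      at h7
    -- `τ ≥ 4 > e`; additive constants can therefore be absorbed into multiples of `log τ`.
    have l1 : 1 ≤ Real.log τ := by
      rw [Real.le_log_iff_exp_le (by linarith)]
      linarith [Real.exp_one_lt_d9]
    have l2 : 0 ≤ Real.log (1 + 1 / ρ) := Real.log_nonneg (by linarith)
    have l3 : 0 ≤ Real.log (2 + ρ * B + n) := Real.log_nonneg (by linarith)
    rw [hΛ]
    push_cast
    set A₁ := Real.log (2 + ρ * B + n)
    set A₂ := Real.log (1 + 1 / ρ)
    set A₃ := Real.log τ
    set κ' := Real.log κ
    set C' := Real.log (2 * (1 + C₀))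
    have k1 := mul_le_mul_of_nonneg_left h7 (by positivity : (0 : ℝ) ≤ 2 * K)
    nlinarith [mul_nonneg hK0 l2, mul_nonneg hK0 l3, mul_nonneg hlκ l2, mul_nonneg hlκ l3,
      mul_nonneg (mul_nonneg hK0 hlC) l2, mul_nonneg (mul_nonneg hK0 hlC) l3,
      mul_nonneg hlκ (sub_nonneg.2 l1), mul_nonneg (mul_nonneg hK0 hlC) (sub_nonneg.2 l1),
      mul_nonneg hK0 (zero_le_one.trans l1)]
  · intro z hz hpz hqz
    rw [mem_sphere, dist_eq_norm] at hz
    have hball : ∀ a ∈ closedBall z δ, ‖a - x‖ ∈ Icc (ρ - δ) (ρ + δ) := by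
      intro a ha
      rw [mem_closedBall, dist_eq_norm] at ha
      have h1 : ‖a - x‖ ≤ ‖a - z‖ + ‖z - x‖ := norm_sub_le_norm_sub_add_norm_sub _ _ _
      have h2 : ‖z - x‖ ≤ ‖z - a‖ + ‖a - x‖ := norm_sub_le_norm_sub_add_norm_sub _ _ _
      rw [norm_sub_rev z a] at h2
      exact ⟨by linarith, by linarith⟩
    have hsub : closedBall z δ ⊆ V := fun a ha => (hZ a (hball a ha)).1
    -- a globally measurable version of the integrand
    classical
    set p' := V.indicator p with hp'
    set q' := V.indicator q with hq'
    have hmeas : ∀ F : ℂ → ℂ, DifferentiableOn ℂ F V → Measurable (V.indicator F) := by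
      intro F hF
      rw [← piecewise_eq_indicator]
      exact hF.continuousOn.measurable_piecewise continuousOn_const hV.measurableSet
    set u : ℂ → ℝ := fun w => |Real.log ‖p' w‖ - Real.log ‖q' w‖| with hu
    have hum : Measurable u := by
      have h1 := hmeas p hp
      have h2 := hmeas q hq
      have : Measurable fun w => Real.log ‖p' w‖ - Real.log ‖q' w‖ :=
        (Real.measurable_log.comp h1.norm).sub (Real.measurable_log.comp h2.norm)
      exact this.abs
    have hucirc : ∀ (y : ℂ) (t : ℝ), 0 ≤ t → sphere y t ⊆ V → CircleIntegrable u y t ∧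
        Real.circleAverage u y t =
          Real.circleAverage (fun w => |Real.log ‖p w‖ - Real.log ‖q w‖|) y t := by
      intro y t ht hy
      have heq : EqOn u (fun w => |Real.log ‖p w‖ - Real.log ‖q w‖|) (sphere y |t|) := by
        intro w hw
        rw [abs_of_nonneg ht] at hw
        simp [hu, hp', hq', indicator_of_mem (hy hw)]
      refine ⟨?_, Real.circleAverage_congr_sphere heq⟩
      have h1 : CircleIntegrable (fun w => |Real.log ‖p w‖ - Real.log ‖q w‖|) y t :=
        ((circleIntegrable_log_norm_of_differentiableOn hV hp ht hy).sub
          (circleIntegrable_log_norm_of_differentiableOn hV hq ht hy)).abs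
      have h2 : (fun θ => u (circleMap y t θ)) =
          fun θ => (fun w => |Real.log ‖p w‖ - Real.log ‖q w‖|) (circleMap y t θ) := by
        ext θ
        exact heq (circleMap_mem_sphere' y t θ)
      unfold CircleIntegrable
      rw [h2]
      exact h1
    have hxc : ∀ t ∈ Ioo (ρ - δ) (ρ + δ), sphere x t ⊆ V := by
      intro t ht w hw
      rw [mem_sphere, dist_eq_norm] at hw
      exact (hZ w (by rw [hw]; exact Ioo_subset_Icc_self ht)).1
    obtain ⟨s, hs, hsB⟩ := exists_radius_circleAverage_le hum (fun w => abs_nonneg _) hδ hδρ hz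
      (B := B) (fun t ht => by
        obtain ⟨h1, h2⟩ := hucirc x t (by linarith [ht.1]) (hxc t ht)
        exact ⟨h1, h2.trans_le (hB t ht)⟩)
      (fun s hs => (hucirc z s (by linarith [hs.1]) ((sphere_subset_closedBall.trans
        (closedBall_subset_closedBall hs.2.le)).trans hsub)).1)
    have hs0 : 0 < s := by linarith [hs.1]
    rw [(hucirc z s hs0.le ((sphere_subset_closedBall.trans
        (closedBall_subset_closedBall hs.2.le)).trans hsub)).2] at hsB
    -- Only the zeros in the disc about `z` are divided out. The sums over `Z'` are then enlarged to
    -- `Z`, which does not depend on `z`.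
    set Z' := Z.filter fun a => a ∈ closedBall z δ ∧ (p a = 0 ∨ q a = 0) with hZ'
    have hZ'mem : ∀ a, a ∈ Z' ↔ a ∈ closedBall z δ ∧ (p a = 0 ∨ q a = 0) := by
      intro a
      rw [hZ', Finset.mem_filter, and_iff_right_iff_imp]
      exact fun h => (hZ a (hball a h.1)).2 h.2
    have hsτ : 1 / s ≤ τ := by
      rw [hτ, div_le_div_iff₀ hs0 hδ]; linarith [hs.1]
    have hs1 : 1 ≤ 1 / s := by rw [le_div_iff₀ hs0]; linarith [hs.2]
    have hlogs : Real.log (1 / s) ≤ τ := (Real.log_le_self (by positivity)).trans hsτ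
    have hbr : 16 * ρ * B / δ + (∑ a ∈ Z', (m a : ℝ)) * Real.log (1 / s) ≤
        τ * (8 * (ρ * B) + n) := by
      have h1 : ∑ a ∈ Z', (m a : ℝ) ≤ n := by
        rw [hn']
        exact Finset.sum_le_sum_of_subset_of_nonneg (Finset.filter_subset _ _)
          fun a _ _ => by positivity
      have h2 : (∑ a ∈ Z', (m a : ℝ)) * Real.log (1 / s) ≤ n * τ :=
        mul_le_mul h1 hlogs (Real.log_nonneg hs1) hn0
      have h3 : 16 * ρ * B / δ = τ * (8 * (ρ * B)) := by rw [hτ]; ring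
      rw [h3]; linarith
    have hYz : ∀ k < K, ∑ a ∈ Z', (m a : ℝ) * (k.factorial * (‖z - a‖ ^ (k + 1))⁻¹) ≤
        K.factorial * (1 + Y z) ^ (2 * K) := by
      intro k hk
      calc ∑ a ∈ Z', (m a : ℝ) * (k.factorial * (‖z - a‖ ^ (k + 1))⁻¹)
          ≤ ∑ a ∈ Z, (m a : ℝ) * (k.factorial * (‖z - a‖ ^ (k + 1))⁻¹) :=
            Finset.sum_le_sum_of_subset_of_nonneg (Finset.filter_subset _ _)
              fun a _ _ => by positivity
        _ = k.factorial * ∑ a ∈ Z, (m a : ℝ) * ((√‖z - a‖)⁻¹) ^ (2 * (k + 1)) := by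
            rw [Finset.mul_sum]
            refine Finset.sum_congr rfl fun a _ => ?_
            rw [pow_mul, inv_pow, Real.sq_sqrt (norm_nonneg _), inv_pow]; ring
        _ ≤ k.factorial * (Y z) ^ (2 * (k + 1)) := by
            gcongr
            exact pow_sum_natCast_mul_le Z m (y := fun a => (√‖z - a‖)⁻¹)
              (fun a => by positivity) (by omega)
        _ ≤ k.factorial * (1 + Y z) ^ (2 * (k + 1)) := by
            have := hY0 z
            gcongr
            linarith
        _ ≤ K.factorial * (1 + Y z) ^ (2 * K) := by
            have h1 : (1 : ℝ) ≤ 1 + Y z := by linarith [hY0 z]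
            have h2 : (k.factorial : ℝ) ≤ K.factorial := by
              exact_mod_cast Nat.factorial_le hk.le
            have h3 : (1 + Y z) ^ (2 * (k + 1)) ≤ (1 + Y z) ^ (2 * K) :=
              pow_le_pow_right₀ h1 (by omega)
            exact mul_le_mul h2 h3 (by positivity) (by positivity)
    have hsec : ∀ k < K, 2 * ((k + 1).factorial : ℝ) / s ^ (k + 1) ≤
        2 * K.factorial * τ ^ K := by
      intro k hk
      rw [div_eq_mul_one_div, ← one_div_pow]
      have h2 : ((k + 1).factorial : ℝ) ≤ K.factorial := by
        exact_mod_cast Nat.factorial_le hk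
      have h3 : (1 / s) ^ (k + 1) ≤ τ ^ K :=
        (pow_le_pow_left₀ (by positivity) hsτ _).trans (pow_le_pow_right₀ (by linarith) hk)
      exact mul_le_mul (by linarith) h3 (by positivity) (by positivity)
    have hsum : ∑ k ∈ Finset.range K,
        ‖iteratedDeriv k (logDeriv p) z - iteratedDeriv k (logDeriv q) z‖ ≤
        K * (K.factorial * (1 + Y z) ^ (2 * K) +
          2 * K.factorial * τ ^ K * (τ * (8 * (ρ * B) + n))) := by
      have h1 : ∀ k ∈ Finset.range K,
          ‖iteratedDeriv k (logDeriv p) z - iteratedDeriv k (logDeriv q) z‖ ≤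
          K.factorial * (1 + Y z) ^ (2 * K) +
            2 * K.factorial * τ ^ K * (τ * (8 * (ρ * B) + n)) := by
        intro k hk
        have hk' := Finset.mem_range.1 hk
        refine (norm_iteratedDeriv_logDeriv_sub_le hV hp hq hpo hqo hδ1 hs hsub hpz hqz hZ'mem
          hsB k).trans (add_le_add (hYz k hk') ?_)
        refine mul_le_mul (hsec k hk') hbr ?_ (by positivity)
        have := Real.log_nonneg hs1
        positivity
      refine (Finset.sum_le_sum h1).trans (le_of_eq ?_)
      rw [Finset.sum_const, Finset.card_range, nsmul_eq_mul]
    have hY1 : (1 : ℝ) ≤ (1 + Y z) ^ (2 * K) := one_le_pow₀ (by linarith [hY0 z])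
    have hτ1 : (1 : ℝ) ≤ τ ^ (K + 1) := one_le_pow₀ (by linarith)
    have hρB : 0 ≤ ρ * B := by positivity
    have hfin : 1 + ∑ k ∈ Finset.range K,
        ‖iteratedDeriv k (logDeriv p) z - iteratedDeriv k (logDeriv q) z‖ ≤
        (1 + Y z) ^ (2 * K) * (κ * τ ^ (K + 1) * (2 + ρ * B + n)) := by
      have e1 : (K : ℝ) * (K.factorial * (1 + Y z) ^ (2 * K) +
          2 * K.factorial * τ ^ K * (τ * (8 * (ρ * B) + n))) = (K * K.factorial) *
          (1 + Y z) ^ (2 * K) + 2 * (K * K.factorial) * τ ^ (K + 1) * (8 * (ρ * B) + n) := by ring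
      rw [e1] at hsum
      have := one_add_le_mul_of_le hsum hY1 hτ1 (by positivity) hρB hn0
      rwa [← mul_assoc 16, ← hκ] at this
    have hpos : 0 < 1 + ∑ k ∈ Finset.range K,
        ‖iteratedDeriv k (logDeriv p) z - iteratedDeriv k (logDeriv q) z‖ := by
      have : 0 ≤ ∑ k ∈ Finset.range K,
        ‖iteratedDeriv k (logDeriv p) z - iteratedDeriv k (logDeriv q) z‖ :=
        Finset.sum_nonneg fun _ _ => norm_nonneg _
      linarith
    refine (Real.log_le_log hpos hfin).trans (le_of_eq ?_)
    rw [Real.log_mul (by positivity) (by positivity), Real.log_mul (by positivity) (by positivity),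
      Real.log_mul (by positivity) (by positivity), Real.log_pow, Real.log_pow, hΛ]
    simp only [smul_eq_mul]
    push_cast
    ring

end PuncturedPlane

end

/-! ### The lemma on the logarithmic derivative for the punctured plane. -/

section

open Set Filter Topology Metric MeasureTheory

namespace PuncturedPlane

theorem circleIntegrable_congr_sphere {u v : ℂ → ℝ} {x : ℂ} {t : ℝ} (ht : 0 ≤ t)
    (h : EqOn u v (sphere x t)) (hv : CircleIntegrable v x t) : CircleIntegrable u x t := by
  have h2 : (fun θ => u (circleMap x t θ)) = fun θ => v (circleMap x t θ) :=
    funext fun θ => h (circleMap_mem_sphere x ht θ)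
  unfold CircleIntegrable
  rw [h2]
  exact hv

variable {M : ℕ} {c : Fin M → ℂ}

/-- The boundary circles are disjoint, so majorants found on each of them separately glue to one
function. -/
theorem exists_eqOn_boundary {r : ℝ} (hr : Separated c r) (g₀ : ℂ → ℝ) (g' : Fin M → ℂ → ℝ) :
    ∃ g : ℂ → ℝ, EqOn g g₀ (sphere 0 r) ∧ ∀ j, EqOn g (g' j) (sphere (c j) (1 / r)) := by
  classical
  refine ⟨fun z => if ‖z‖ = r then g₀ z else ∑ j, if ‖z - c j‖ = 1 / r then g' j z else 0,
    fun z hz => ?_, fun j z hz => ?_⟩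
  · exact if_pos (by simpa using hz)
  · rw [mem_sphere, dist_eq_norm] at hz
    have h1 : ‖z‖ ≠ r := by
      have h2 : ‖z‖ ≤ ‖z - c j‖ + ‖c j‖ := by
        simpa using norm_add_le (z - c j) (c j)
      have := hr.outer j
      intro h
      linarith
    simp only [if_neg h1]
    rw [Finset.sum_eq_single j]
    · rw [if_pos hz]
    · intro k _ hkj
      refine if_neg fun hk => ?_
      have h2 : ‖c j - c k‖ ≤ ‖c j - z‖ + ‖z - c k‖ := norm_sub_le_norm_sub_add_norm_sub _ _ _
      rw [norm_sub_rev (c j) z, hz, hk] at h2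
      have h3 := hr.inner j k (Ne.symm hkj)
      have : 2 / r = 1 / r + 1 / r := by ring
      linarith
    · simp

/-- Near `1 / r` the map `s ↦ 1 / s` stretches by about `r²`. A collar of width `η / (4r²)` about
the inner circles therefore corresponds to parameters at most `r + η / 2`, and `r ≥ r₀ + 1` keeps
them above `r₀`. The other half of `η` is left for counting zeros. -/
theorem collar_radius_mem {r₀ r η : ℝ} (hr₀ : 0 < r₀) (hr : r₀ + 1 ≤ r) (hr2 : 2 ≤ r) (hη : 0 < η)
    (hη1 : η ≤ 1) :
    (∀ s ∈ Icc (r - η / (4 * r ^ 2)) (r + η / (4 * r ^ 2)), s ∈ Icc r₀ (r + η / 2)) ∧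
    ∀ s ∈ Icc (1 / r - η / (4 * r ^ 2)) (1 / r + η / (4 * r ^ 2)),
      0 < s ∧ 1 / s ∈ Icc r₀ (r + η / 2) := by
  have hr0 : 0 < r := by linarith
  have hr4 : 4 ≤ r ^ 2 := by nlinarith
  have hδ : η / (4 * r ^ 2) ≤ η / 16 := by gcongr; linarith
  constructor
  · intro s hs
    exact ⟨by linarith [hs.1], by linarith [hs.2]⟩
  · intro s hs
    set y := 1 / r with hy
    have hy0 : 0 < y := by positivity
    have hry : r * y = 1 := by rw [hy]; field_simp
    have hδy : η / (4 * r ^ 2) = η * y ^ 2 / 4 := by rw [hy]; field_simp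
    rw [hδy] at hs
    have hy2 : y ≤ 1 / 2 := by rw [hy]; gcongr
    have hηy : η * y ≤ 1 / 2 := by nlinarith
    have hs0 : 0 < s := by
      have : η * y ^ 2 / 4 ≤ y / 8 := by nlinarith
      linarith [hs.1]
    refine ⟨hs0, ?_, ?_⟩
    · rw [le_div_iff₀ hs0]
      have h1 : r₀ * s ≤ (r - 1) * (y + η * y ^ 2 / 4) :=
        mul_le_mul (by linarith) hs.2 hs0.le (by linarith)
      have h2 : (r - 1) * (y + η * y ^ 2 / 4) = r * y - y + (r * y) * (η * y) / 4 - η * y ^ 2 / 4 := by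
        ring
      rw [h2, hry] at h1
      have h3 : η * y ≤ y := by nlinarith
      have h4 : 0 ≤ η * y ^ 2 := by positivity
      linarith
    · rw [div_le_iff₀ hs0]
      have h1 : (r + η / 2) * (y - η * y ^ 2 / 4) ≤ (r + η / 2) * s := by gcongr; exact hs.1
      have h2 : (r + η / 2) * (y - η * y ^ 2 / 4) =
          r * y + η * y / 2 - (r * y) * (η * y) / 4 - (η * y) ^ 2 / 8 := by ring
      rw [h2, hry] at h1
      have h3 : 0 < η * y := by positivity
      nlinarith

/-- Data that controls a quotient `p / q` on the punctured plane by a growth function `S`. -/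
structure GrowthControl (c : Fin M → ℂ) (r₀ A : ℝ) (S : ℝ → ℝ) (p q : ℂ → ℂ) : Prop where
  holo_left : DifferentiableOn ℂ p (Omega c)
  holo_right : DifferentiableOn ℂ q (Omega c)
  ne_left : ∃ z ∈ Omega c, p z ≠ 0
  ne_right : ∃ z ∈ Omega c, q z ≠ 0
  quot : ∀ t, r₀ ≤ t → bdryAvg c (fun w => |Real.log ‖p w‖ - Real.log ‖q w‖|) t ≤ A * S t
  count_left : ∀ t, r₀ ≤ t → weightCounting c (analyticOrderNatAt p) r₀ t ≤ A * S t
  count_right : ∀ t, r₀ ≤ t → weightCounting c (analyticOrderNatAt q) r₀ t ≤ A * S t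

/-- The counting function at `r + η` weighs the zeros present at `r + η / 2` by at least `log ((r +
η) / (r + η / 2)) ≥ η / (4r)`. -/
theorem weightCount_le_of_weightCounting_le {r₀ r η A : ℝ} (h₀ : Separated c r₀)
    (hr : r₀ + 1 ≤ r) (hr2 : 2 ≤ r) (hη : 0 < η) (hη1 : η ≤ 1) {m : ℂ → ℕ}
    (hm : LocallyFiniteWeight c m) (hA : weightCounting c m r₀ (r + η) ≤ A) :
    (weightCount c m (r + η / 2) : ℝ) ≤ 4 * r * A / η := by
  have h1 := weightCount_mul_log_le h₀ (t := r + η / 2) (r := r + η) (by linarith) (by linarith) hm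
  have h2 : η / (4 * r) ≤ Real.log ((r + η) / (r + η / 2)) := by
    have hx : 0 < (r + η / 2) / (r + η) := by have : 0 < r := by linarith
                                              positivity
    have h3 := Real.log_le_sub_one_of_pos hx
    rw [← inv_div (r + η / 2) (r + η), Real.log_inv]
    have h4 : (r + η / 2) / (r + η) - 1 = -(η / (2 * (r + η))) := by
      have : r + η ≠ 0 := by linarith
      field_simp
      ring
    have h5 : η / (4 * r) ≤ η / (2 * (r + η)) := by
      have : 0 < r := by linarith
      exact div_le_div_of_nonneg_left hη.le (by positivity) (by linarith)
    linarith
  have hr0 : 0 < r := by linarith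
  have h3 : (weightCount c m (r + η / 2) : ℝ) * (η / (4 * r)) ≤ A :=
    (mul_le_mul_of_nonneg_left h2 (by positivity)).trans (h1.trans hA)
  rw [le_div_iff₀ hη]
  have h4 : (weightCount c m (r + η / 2) : ℝ) * (η / (4 * r)) * (4 * r) =
      (weightCount c m (r + η / 2) : ℝ) * η := by field_simp
  nlinarith

/-- The lemma on the logarithmic derivative for the punctured plane. -/
theorem exists_boundary_majorant_log_derivs (K : ℕ) {r₀ A : ℝ} (hA : 0 ≤ A) {S : ℝ → ℝ}
    {p q : ℂ → ℂ} (h₀ : Separated c r₀) (hS : MonotoneOn S (Ici r₀)) (hS1 : ∀ t ∈ Ici r₀, 1 ≤ S t)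
    (h : GrowthControl c r₀ A S p q) :
    ∃ C : ℝ, 0 ≤ C ∧ ∀ r, r₀ + 1 ≤ r → 2 ≤ r → S (r + 1 / S r) ≤ 2 * S r →
      ∃ g : ℂ → ℝ, BdryIntegrable c g r ∧
        bdryAvg c g r ≤ C * (Real.log r + Real.log (S r) + 1) ∧
        ∀ z ∈ Omega c, (‖z‖ = r ∨ ∃ j, ‖z - c j‖ = 1 / r) → p z ≠ 0 → q z ≠ 0 →
          Real.log (1 + ∑ k ∈ Finset.range K,
            ‖iteratedDeriv k (logDeriv p) z - iteratedDeriv k (logDeriv q) z‖) ≤ g z := by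
  classical
  obtain ⟨C₀, hC₀, hmaj⟩ := exists_majorant_log_derivs K
  have hpo := order_ne_top_Omega h.holo_left h.ne_left
  have hqo := order_ne_top_Omega h.holo_right h.ne_right
  have hlA : 0 ≤ Real.log (2 + 18 * A) := Real.log_nonneg (by linarith)
  refine ⟨(M + 1) * (C₀ * (7 + Real.log (2 + 18 * A))), by positivity, fun r hr hr2 hSr => ?_⟩
  have hr0 : 0 < r := by linarith
  have hr₀r : r₀ ≤ r := by linarith
  have hsep := h₀.mono hr₀r
  have hSr1 := hS1 r hr₀r
  have hSr0 : 0 < S r := by linarith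
  -- The width from Borel's lemma: `S` at most doubles on `[r, r + η]`, and `1 / η` costs only `log
  -- (S r)` in the bound.
  set η := 1 / S r with hη
  have hη0 : 0 < η := by positivity
  have hη1 : η ≤ 1 := by rw [hη, div_le_one hSr0]; exact hSr1
  set δ := η / (4 * r ^ 2) with hδ
  have hδ0 : 0 < δ := by positivity
  have hr4 : 4 ≤ r ^ 2 := by nlinarith
  have hδ16 : δ ≤ 1 / 16 := by
    rw [hδ, div_le_iff₀ (by positivity)]; linarith
  obtain ⟨hout, hinn⟩ := collar_radius_mem h₀.pos hr hr2 hη0 hη1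
  have hSt : ∀ t, r₀ ≤ t → t ≤ r + η → S t ≤ 2 * S r := fun t h1 h2 =>
    (hS h1 (mem_Ici.2 (by linarith)) h2).trans hSr
  -- the zeros
  set R := r + η / 2 with hR
  have hRsep := h₀.mono (show r₀ ≤ R by linarith)
  have hKO := closedRegion_subset_Omega (c := c) hRsep.pos
  have hfp := finite_zeros_inter_compact (isOpen_Omega c) h.holo_left hpo
    (isCompact_closedRegion c R) hKO
  have hfq := finite_zeros_inter_compact (isOpen_Omega c) h.holo_right hqo
    (isCompact_closedRegion c R) hKO
  set Z := hfp.toFinset ∪ hfq.toFinset with hZ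
  have hZmem : ∀ a ∈ closedRegion c R, p a = 0 ∨ q a = 0 → a ∈ Z := fun a ha h0 => by
    simp only [hZ, Finset.mem_union, Finite.mem_toFinset, mem_ofPred_eq]
    exact h0.imp (fun h => ⟨ha, h⟩) fun h => ⟨ha, h⟩
  have hZK : ∀ a ∈ Z, a ∈ closedRegion c R := fun a ha => by
    simp only [hZ, Finset.mem_union, Finite.mem_toFinset, mem_ofPred_eq] at ha
    exact ha.elim (·.1) (·.1)
  -- Each of the two functions contributes `4r · (2 A S r) / η` with `1 / η = S r`.
  have hcount : ((∑ a ∈ Z, (analyticOrderNatAt p a + analyticOrderNatAt q a) : ℕ) : ℝ) ≤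
      16 * r * A * S r ^ 2 := by
    have e : ∀ {F : ℂ → ℂ}, DifferentiableOn ℂ F (Omega c) → (∃ z ∈ Omega c, F z ≠ 0) →
        (∀ a ∈ closedRegion c R, F a = 0 → a ∈ Z) →
        weightCounting c (analyticOrderNatAt F) r₀ (r + η) ≤ A * S (r + η) →
        ((∑ a ∈ Z, analyticOrderNatAt F a : ℕ) : ℝ) ≤ 8 * r * A * S r ^ 2 := by
      intro F hF hne hFZ hcF
      have h1 := weightCount_eq_sum (c := c) (m := analyticOrderNatAt F) hRsep le_rfl (Z := Z)
        fun z hz hz' => hFZ z hz ((order_natAt_ne_zero_iff (isOpen_Omega c) hF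
          (order_ne_top_Omega hF hne) (hKO hz)).1 hz')
      rw [Finset.sum_congr rfl fun a ha => indicator_of_mem (hZK a ha) _] at h1
      rw [← h1]
      refine (weightCount_le_of_weightCounting_le h₀ hr hr2 hη0 hη1
        (locallyFiniteWeight_order hF hne) (hcF.trans
          (mul_le_mul_of_nonneg_left (hSt (r + η) (by linarith) le_rfl) hA))).trans (le_of_eq ?_)
      rw [hη]
      field_simp
      ring
    have e1 := e h.holo_left h.ne_left (fun a ha h0 => hZmem a ha (Or.inl h0))
      (h.count_left _ (by linarith))
    have e2 := e h.holo_right h.ne_right (fun a ha h0 => hZmem a ha (Or.inr h0))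
      (h.count_right _ (by linarith))
    rw [Finset.sum_add_distrib]
    push_cast at e1 e2 ⊢
    linarith
  -- one circle
  have hone : ∀ (x : ℂ) (ρ : ℝ), δ < ρ → ρ ≤ r → 1 / ρ ≤ r →
      (∀ s ∈ Icc (ρ - δ) (ρ + δ), 0 < s → sphere x s ⊆ closedRegion c R ∧
        Real.circleAverage (fun w => |Real.log ‖p w‖ - Real.log ‖q w‖|) x s ≤ 2 * A * S r) →
      ∃ g : ℂ → ℝ, CircleIntegrable g x ρ ∧ Real.circleAverage g x ρ ≤
        C₀ * (7 + Real.log (2 + 18 * A)) * (Real.log r + Real.log (S r) + 1) ∧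
        ∀ z ∈ sphere x ρ, p z ≠ 0 → q z ≠ 0 →
          Real.log (1 + ∑ k ∈ Finset.range K,
            ‖iteratedDeriv k (logDeriv p) z - iteratedDeriv k (logDeriv q) z‖) ≤ g z := by
    intro x ρ hδρ hρr hρ1 hcirc
    have hρ0 : 0 < ρ := hδ0.trans hδρ
    obtain ⟨g, hg, hga, hgb⟩ := hmaj (isOpen_Omega c) h.holo_left h.holo_right hpo hqo (x := x)
      (B := 2 * A * S r) hδ0 hδρ.le (by linarith) (Z := Z) (fun a ha => by
        have haK := (hcirc _ ha (by linarith [ha.1])).1 (mem_sphere.2 (dist_eq_norm a x))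
        exact ⟨hKO haK, hZmem a haK⟩)
      fun t ht => (hcirc t (Ioo_subset_Icc_self ht) (by linarith [ht.1])).2
    refine ⟨g, hg, hga.trans ?_, hgb⟩
    rw [mul_assoc C₀ (7 + _)]
    refine mul_le_mul_of_nonneg_left ?_ (zero_le_one.trans hC₀)
    set n : ℝ := ((∑ a ∈ Z, (analyticOrderNatAt p a + analyticOrderNatAt q a) : ℕ) : ℝ)
    have hn0 : 0 ≤ n := by positivity
    have hLr : 0 ≤ Real.log r := Real.log_nonneg (by linarith)
    have hLS : 0 ≤ Real.log (S r) := Real.log_nonneg hSr1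
    have hl2 := Real.log_two_lt_d9
    have b1 : Real.log (2 / δ) ≤ 3 + 2 * Real.log r + Real.log (S r) := by
      have : 2 / δ = 2 ^ 3 * r ^ 2 * S r := by
        rw [hδ, hη]; field_simp; ring
      rw [this, Real.log_mul (by positivity) (by positivity), Real.log_mul (by positivity)
        (by positivity), Real.log_pow, Real.log_pow]
      push_cast
      linarith
    have b2 : Real.log (1 + 1 / ρ) ≤ 1 + Real.log r := by
      have : 0 < 1 / ρ := by positivity
      have h1 : Real.log (1 + 1 / ρ) ≤ Real.log (2 * r) :=
        Real.log_le_log (by positivity) (by linarith)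
      rw [Real.log_mul (by norm_num) hr0.ne'] at h1
      linarith
    have b3 : Real.log (2 + ρ * (2 * A * S r) + n) ≤
        Real.log (2 + 18 * A) + Real.log r + 2 * Real.log (S r) := by
      have h1 : 2 + ρ * (2 * A * S r) + n ≤ (2 + 18 * A) * r * S r ^ 2 := by
        have i1 : (1 : ℝ) ≤ r * S r ^ 2 :=
          one_le_mul_of_one_le_of_one_le (by linarith) (one_le_pow₀ hSr1)
        have i2 : ρ * (2 * A * S r) ≤ r * (2 * A * S r ^ 2) := by
          have : S r ≤ S r ^ 2 := by nlinarith
          gcongr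
        linarith
      have h2 := Real.log_le_log (by positivity) h1
      rw [Real.log_mul (by positivity) (by positivity), Real.log_mul (by positivity)
        (by positivity), Real.log_pow] at h2
      exact_mod_cast h2
    nlinarith [mul_nonneg hlA hLr, mul_nonneg hlA hLS]
  have hr1 : 1 / r ≤ r := by rw [div_le_iff₀ hr0]; nlinarith
  have hδr : δ < 1 / r := by
    rw [hδ, div_lt_div_iff₀ (by positivity) hr0]; nlinarith
  obtain ⟨g₀, hg₀, hg₀a, hg₀b⟩ := hone 0 r (by linarith) le_rfl hr1 (fun s hs _ => by
    have hs' := hout s hs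
    refine ⟨(h₀.mono hs'.1).outer_circle_subset.trans
      (closedRegion_mono (h₀.pos.trans_le hs'.1) hs'.2), ?_⟩
    refine (circleAverage_zero_le_bdryAvg fun _ => abs_nonneg _).trans ((h.quot s hs'.1).trans ?_)
    have := mul_le_mul_of_nonneg_left (hSt s hs'.1 (by linarith [hs'.2])) hA
    linarith)
  have hj := fun j => hone (c j) (1 / r) hδr hr1 (by simp) (fun s hs hs0 => by
    have hs' := (hinn s hs).2
    have hss : 1 / (1 / s) = s := one_div_one_div s
    have h1 := (h₀.mono hs'.1).inner_circle_subset j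
    have h2 := circleAverage_puncture_le_bdryAvg (c := c) (t := 1 / s)
      (u := fun w => |Real.log ‖p w‖ - Real.log ‖q w‖|) (fun _ => abs_nonneg _) j
    rw [hss] at h1 h2
    refine ⟨h1.trans (closedRegion_mono (h₀.pos.trans_le hs'.1) hs'.2), ?_⟩
    refine h2.trans ((h.quot _ hs'.1).trans ?_)
    have := mul_le_mul_of_nonneg_left (hSt _ hs'.1 (by linarith [hs'.2])) hA
    linarith)
  choose g' hg' hg'a hg'b using hj
  obtain ⟨g, hg1, hg2⟩ := exists_eqOn_boundary hsep g₀ g'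
  have hr10 : (0 : ℝ) ≤ 1 / r := by positivity
  refine ⟨g, ⟨circleIntegrable_congr_sphere hr0.le hg1 hg₀, fun j =>
    circleIntegrable_congr_sphere hr10 (hg2 j) (hg' j)⟩, ?_, ?_⟩
  · rw [bdryAvg, Real.circleAverage_congr_sphere (by rw [abs_of_pos hr0]; exact hg1)]
    have : ∀ j ∈ Finset.univ, Real.circleAverage g (c j) (1 / r) ≤
        C₀ * (7 + Real.log (2 + 18 * A)) * (Real.log r + Real.log (S r) + 1) := fun j _ => by
      rw [Real.circleAverage_congr_sphere (by rw [abs_of_nonneg hr10]; exact hg2 j)]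
      exact hg'a j
    refine (add_le_add hg₀a (Finset.sum_le_sum this)).trans (le_of_eq ?_)
    rw [Finset.sum_const, Finset.card_univ, Fintype.card_fin, nsmul_eq_mul]
    ring
  · rintro z - (hz | ⟨j, hz⟩) hpz hqz
    · have hz' : z ∈ sphere (0 : ℂ) r := by simpa using hz
      rw [hg1 hz']
      exact hg₀b z hz' hpz hqz
    · have hz' : z ∈ sphere (c j) (1 / r) := by simpa [dist_eq_norm] using hz
      rw [hg2 j hz']
      exact hg'b j z hz' hpz hqz

end PuncturedPlane

end

/-! ### Wronskians. -/

section

open Set Filter Topology Metric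

namespace PuncturedPlane

/-- The matrix of derivatives of a family of functions of one variable. -/
noncomputable def wronskiMatrix {n : ℕ} (g : Fin n → ℂ → ℂ) (z : ℂ) : Matrix (Fin n) (Fin n) ℂ :=
  Matrix.of fun i j => iteratedDeriv j (g i) z

/-- The Wronskian determinant. -/
noncomputable def wronskian {n : ℕ} (g : Fin n → ℂ → ℂ) (z : ℂ) : ℂ := (wronskiMatrix g z).det

theorem wronskian_congr {n : ℕ} {g h : Fin n → ℂ → ℂ} {z : ℂ} (H : ∀ i, g i =ᶠ[𝓝 z] h i) :
    wronskian g z = wronskian h z := by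
  unfold wronskian wronskiMatrix
  congr 1
  ext i j
  exact (H i).iteratedDeriv_eq j

/-- By Leibniz's rule the matrix is multiplied on the right by an upper triangular matrix with `u z`
on the diagonal. -/
theorem wronskian_mul {n : ℕ} {u : ℂ → ℂ} {g : Fin n → ℂ → ℂ} {z : ℂ} (hu : AnalyticAt ℂ u z)
    (hg : ∀ i, AnalyticAt ℂ (g i) z) :
    wronskian (fun i w => u w * g i w) z = u z ^ n * wronskian g z := by
  set T : Matrix (Fin n) (Fin n) ℂ := Matrix.of fun l j =>
    if (l : ℕ) ≤ j then ((j : ℕ).choose l : ℂ) * iteratedDeriv (j - l) u z else 0 with hT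
  have h1 : wronskiMatrix (fun i w => u w * g i w) z = wronskiMatrix g z * T := by
    ext i j
    rw [Matrix.mul_apply]
    have h2 : iteratedDeriv j (fun w => u w * g i w) z =
        ∑ l ∈ Finset.range (j + 1), ((j : ℕ).choose l : ℂ) * iteratedDeriv l (g i) z *
          iteratedDeriv (j - l) u z := by
      simp only [mul_comm (u _)]
      exact iteratedDeriv_fun_mul (hg i).contDiffAt hu.contDiffAt
    simp only [wronskiMatrix, Matrix.of_apply, hT]
    rw [h2, Fin.sum_univ_eq_sum_range (fun l => iteratedDeriv l (g i) z *
      (if l ≤ (j : ℕ) then ((j : ℕ).choose l : ℂ) * iteratedDeriv (j - l) u z else 0)) n]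
    rw [← Finset.sum_subset (Finset.range_subset_range.2 j.2) fun l _ hl => by
      rw [if_neg (by simpa [Nat.lt_succ_iff] using hl), mul_zero]]
    refine Finset.sum_congr rfl fun l hl => ?_
    rw [if_pos (by simpa [Nat.lt_succ_iff] using hl)]
    ring
  have h3 : T.det = u z ^ n := by
    rw [Matrix.det_of_isUpperTriangular]
    · simp [hT]
    · intro i j hij
      simp only [hT, Matrix.of_apply]
      exact if_neg (by simpa using hij)
  rw [wronskian, h1, Matrix.det_mul, h3, wronskian, mul_comm]

/-- The row of the constant function has a single nonzero entry. Together with `wronskian_mul` this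
lowers the order of a Wronskian by one. -/
theorem wronskian_cons_one {n : ℕ} (h : Fin n → ℂ → ℂ) (z : ℂ) :
    wronskian (Fin.cons (fun _ => 1) h : Fin (n + 1) → ℂ → ℂ) z =
      wronskian (fun i => deriv (h i)) z := by
  unfold wronskian
  rw [Matrix.det_succ_row_zero, Fin.sum_univ_succ]
  have h1 : ∀ j : Fin n, wronskiMatrix (Fin.cons (fun _ => 1) h : Fin (n + 1) → ℂ → ℂ) z 0 j.succ =
      0 := by
    intro j
    simp [wronskiMatrix, iteratedDeriv_const]
  simp only [h1, mul_zero, zero_mul, Finset.sum_const_zero, add_zero]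
  have h2 : wronskiMatrix (Fin.cons (fun _ => 1) h : Fin (n + 1) → ℂ → ℂ) z 0 0 = 1 := by
    simp [wronskiMatrix]
  rw [h2]
  simp only [Fin.val_zero, pow_zero, mul_one, one_mul]
  congr 1
  ext i j
  simp [wronskiMatrix, iteratedDeriv_succ']

/-- Functions with vanishing Wronskian are locally linearly dependent. -/
theorem exists_linear_relation_of_wronskian_eq_zero {n : ℕ} {g : Fin n → ℂ → ℂ} {U : Set ℂ}
    (hU : IsOpen U) (hne : U.Nonempty) (hg : ∀ i, DifferentiableOn ℂ (g i) U)
    (hW : ∀ z ∈ U, wronskian g z = 0) :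
    ∃ a : Fin n → ℂ, a ≠ 0 ∧ ∃ V ⊆ U, IsOpen V ∧ V.Nonempty ∧ ∀ z ∈ V, ∑ i, a i * g i z = 0 := by
  induction n generalizing U with
  | zero =>
    obtain ⟨z, hz⟩ := hne
    have := hW z hz
    simp [wronskian] at this
  | succ n ih =>
    by_cases h0 : ∀ z ∈ U, g 0 z = 0
    · refine ⟨Pi.single 0 1, by simp, U, Subset.rfl, hU, hne, fun z hz => ?_⟩
      rw [Finset.sum_eq_single 0]
      · simp [h0 z hz]
      · intro i _ hi; simp [Pi.single_eq_of_ne hi]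
      · simp
    push Not at h0
    obtain ⟨z₀, hz₀, hgz₀⟩ := h0
    set V := {z ∈ U | g 0 z ≠ 0} with hV
    have hVo : IsOpen V := (hg 0).continuousOn.isOpen_inter_preimage hU isOpen_ne
    have hVU : V ⊆ U := fun z hz => hz.1
    -- Dividing by `g 0` leaves quotients whose derivatives have vanishing Wronskian. By induction a
    -- nontrivial combination of the quotients is locally constant, and that constant is minus the
    -- coefficient of `g 0`.
    set h : Fin n → ℂ → ℂ := fun i z => g i.succ z / g 0 z with hh
    have hhd : ∀ i, DifferentiableOn ℂ (h i) V := fun i =>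
      ((hg i.succ).mono hVU).div ((hg 0).mono hVU) fun z hz => hz.2
    have hWh : ∀ z ∈ V, wronskian (fun i => deriv (h i)) z = 0 := by
      intro z hz
      have h1 : wronskian g z = wronskian (fun i w => g 0 w *
          (Fin.cons (fun _ => 1) h : Fin (n + 1) → ℂ → ℂ) i w) z := by
        refine wronskian_congr fun i => ?_
        filter_upwards [hVo.mem_nhds hz] with w hw
        refine Fin.cases ?_ (fun i => ?_) i
        · simp
        · simp only [Fin.cons_succ, hh]
          rw [mul_div_cancel₀ _ hw.2]
      rw [wronskian_mul ((hg 0).analyticOnNhd hU z hz.1), wronskian_cons_one, hW z hz.1] at h1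
      · exact (mul_eq_zero.1 h1.symm).resolve_left (pow_ne_zero _ hz.2)
      · intro i
        refine Fin.cases ?_ (fun i => ?_) i
        · exact analyticAt_const
        · exact (hhd i).analyticOnNhd hVo z hz
    obtain ⟨a, ha, V', hV'V, hV'o, ⟨z₁, hz₁⟩, hV'⟩ := ih hVo ⟨z₀, hz₀, hgz₀⟩
      (fun i => (hhd i).deriv hVo) hWh
    obtain ⟨ε, hε, hball⟩ := Metric.isOpen_iff.1 hV'o z₁ hz₁
    have hder : ∀ w ∈ ball z₁ ε, HasDerivAt (fun w => ∑ i, a i * h i w) 0 w := by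
      intro w hw
      have : HasDerivAt (fun w => ∑ i, a i * h i w) (∑ i, a i * deriv (h i) w) w :=
        HasDerivAt.fun_sum fun i _ =>
          ((hhd i).differentiableAt (hVo.mem_nhds (hV'V (hball hw)))).hasDerivAt.const_mul _
      rwa [hV' w (hball hw)] at this
    set κ := ∑ i, a i * h i z₁ with hκ
    have hconst : ∀ w ∈ ball z₁ ε, ∑ i, a i * h i w = κ := by
      intro w hw
      exact (convex_ball z₁ ε).is_const_of_fderivWithin_eq_zero (𝕜 := ℂ)
        (f := fun w => ∑ i, a i * h i w)
        (fun w hw => (hder w hw).differentiableAt.differentiableWithinAt)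
        (fun w hw => by
          rw [fderivWithin_of_isOpen isOpen_ball hw]
          ext
          simp [(hder w hw).deriv]) hw (mem_ball_self hε)
    refine ⟨Fin.cons (-κ) a, fun h0 => ha ?_, ball z₁ ε, (hball.trans hV'V).trans hVU, isOpen_ball,
      ⟨z₁, mem_ball_self hε⟩, fun w hw => ?_⟩
    · ext i
      simpa using congrFun h0 i.succ
    · have hw0 : g 0 w ≠ 0 := (hV'V (hball hw)).2
      rw [Fin.sum_univ_succ]
      simp only [Fin.cons_zero, Fin.cons_succ]
      rw [← hconst w hw, neg_mul, Finset.sum_mul, neg_add_eq_zero]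
      refine Finset.sum_congr rfl fun i _ => ?_
      simp only [hh]
      field_simp

theorem analyticAt_iteratedDeriv {F : ℂ → ℂ} {z : ℂ} (hF : AnalyticAt ℂ F z) (n : ℕ) :
    AnalyticAt ℂ (iteratedDeriv n F) z := by
  induction n with
  | zero => simpa using hF
  | succ n ih => rw [iteratedDeriv_succ]; exact ih.deriv

theorem analyticAt_wronskian {n : ℕ} {g : Fin n → ℂ → ℂ} {z : ℂ}
    (hg : ∀ i, AnalyticAt ℂ (g i) z) : AnalyticAt ℂ (wronskian g) z := by
  have : wronskian g = fun z => ∑ σ : Equiv.Perm (Fin n), ((Equiv.Perm.sign σ : ℤ) : ℂ) *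
      ∏ i : Fin n, iteratedDeriv (i : ℕ) (g (σ i)) z := by
    ext w
    simp [wronskian, wronskiMatrix, Matrix.det_apply']
  rw [this]
  exact Finset.analyticAt_fun_sum _ fun σ _ => analyticAt_const.mul
    (Finset.analyticAt_fun_prod _ fun i _ => analyticAt_iteratedDeriv (hg _) _)

/-- Adding the other rows to row `k` does not change the determinant. In this way the sum of the `g
i` enters on the same footing as the `g i`, in place of any one of them. -/
theorem wronskian_update_sum {n : ℕ} {g : Fin n → ℂ → ℂ} {z : ℂ}
    (hg : ∀ i, AnalyticAt ℂ (g i) z) (k : Fin n) :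
    wronskian (Function.update g k fun w => ∑ i, g i w) z = wronskian g z := by
  have h := Matrix.det_updateRow_sum (wronskiMatrix g z) k fun _ => 1
  simp only [one_smul] at h
  rw [wronskian, wronskian, ← h]
  congr 1
  ext i j
  by_cases hik : i = k
  · subst hik
    rw [Matrix.updateRow_self]
    refine Eq.trans ?_ (Finset.sum_apply (M := fun _ => ℂ) j Finset.univ
      fun x j => wronskiMatrix g z x j).symm
    simp only [wronskiMatrix, Matrix.of_apply, Function.update_self]
    exact iteratedDeriv_fun_sum fun i _ => (hg i).contDiffAt
  · simp [wronskiMatrix, Function.update_of_ne hik, Matrix.updateRow_ne hik]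

/-- The Wronskian vanishes to at least the total excess of the vanishing orders. -/
theorem sum_sub_le_analyticOrderAt_wronskian {n : ℕ} {g : Fin (n + 1) → ℂ → ℂ} {z : ℂ}
    (hg : ∀ i, AnalyticAt ℂ (g i) z) {m : Fin (n + 1) → ℕ}
    (hm : ∀ i, (m i : ℕ∞) ≤ analyticOrderAt (g i) z) :
    ((∑ i, (m i - n) : ℕ) : ℕ∞) ≤ analyticOrderAt (wronskian g) z := by
  -- A derivative of order at most `n` lowers the vanishing order by at most `n`, so `(w - z) ^ (m i
  -- - n)` factors out of row `i`; truncated subtraction covers `m i < n`.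
  have h1 : ∀ i j : Fin (n + 1), ∃ e : ℂ → ℂ, AnalyticAt ℂ e z ∧
      ∀ᶠ w in 𝓝 z, iteratedDeriv j (g i) w = (w - z) ^ (m i - n) • e w := by
    intro i j
    rw [← natCast_le_analyticOrderAt (analyticAt_iteratedDeriv (hg i) j),
      natCast_le_analyticOrderAt_iff_iteratedDeriv_eq_zero (analyticAt_iteratedDeriv (hg i) j)]
    intro l hl
    have h2 := (natCast_le_analyticOrderAt_iff_iteratedDeriv_eq_zero (hg i)).1 (hm i)
    have h3 := h2 (l + j) (by have := j.2; omega)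
    rwa [iteratedDeriv_eq_iterate, Function.iterate_add_apply, ← iteratedDeriv_eq_iterate,
      ← iteratedDeriv_eq_iterate] at h3
  choose e he hev using h1
  rw [natCast_le_analyticOrderAt (analyticAt_wronskian hg)]
  refine ⟨fun w => (Matrix.of fun i j => e i j w).det, ?_, ?_⟩
  · simp only [Matrix.det_apply', Matrix.of_apply]
    exact Finset.analyticAt_fun_sum _ fun σ _ => analyticAt_const.mul
      (Finset.analyticAt_fun_prod _ fun i _ => he _ _)
  · filter_upwards [eventually_all.2 fun i => eventually_all.2 fun j => hev i j] with w hw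
    rw [smul_eq_mul, ← Finset.prod_pow_eq_pow_sum, ← Matrix.det_mul_column]
    unfold wronskian wronskiMatrix
    congr 1
    ext i j
    simp [hw i j]

/-- A logarithmic derivative controls all the higher derivatives. -/
theorem norm_iteratedDeriv_le_of_logDeriv {h : ℂ → ℂ} {z : ℂ} (hh : AnalyticAt ℂ h z) (h0 : h z ≠ 0)
    {K : ℕ} {E : ℝ} (hE : 1 + ∑ l ∈ Finset.range K, ‖iteratedDeriv l (logDeriv h) z‖ ≤ E) {j : ℕ}
    (hj : j ≤ K) : ‖iteratedDeriv j h z‖ ≤ 2 ^ (j ^ 2) * E ^ j * ‖h z‖ := by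
  have hE1 : 1 ≤ E := by
    have : 0 ≤ ∑ l ∈ Finset.range K, ‖iteratedDeriv l (logDeriv h) z‖ :=
      Finset.sum_nonneg fun _ _ => norm_nonneg _
    linarith
  induction j using Nat.strong_induction_on with
  | _ j ih =>
    rcases j with _ | j
    · simp
    -- Leibniz's rule for `h' = (h'/h) h`. The exponent `j ^ 2` is chosen because the binomial sum
    -- adds a factor `2 ^ j` and `j + j ^ 2 ≤ (j + 1) ^ 2`.
    have h1 : deriv h =ᶠ[𝓝 z] fun w => logDeriv h w * h w := by
      filter_upwards [hh.continuousAt.eventually_ne h0] with w hw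
      rw [logDeriv_apply, div_mul_cancel₀ _ hw]
    rw [iteratedDeriv_succ', h1.iteratedDeriv_eq, iteratedDeriv_fun_mul
      (analyticAt_logDeriv hh h0).contDiffAt hh.contDiffAt]
    have h2 : ∀ l ∈ Finset.range (j + 1), ‖(j.choose l : ℂ) * iteratedDeriv l (logDeriv h) z *
        iteratedDeriv (j - l) h z‖ ≤ j.choose l * (2 ^ (j ^ 2) * E ^ (j + 1) * ‖h z‖) := by
      intro l hl
      have hl' : l ≤ j := Nat.lt_succ_iff.1 (Finset.mem_range.1 hl)
      rw [norm_mul, norm_mul, Complex.norm_natCast, mul_assoc]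
      refine mul_le_mul_of_nonneg_left ?_ (by positivity)
      have h3 : ‖iteratedDeriv l (logDeriv h) z‖ ≤ E := by
        have := Finset.single_le_sum (f := fun l => ‖iteratedDeriv l (logDeriv h) z‖)
          (fun _ _ => norm_nonneg _) (Finset.mem_range.2 (by omega : l < K))
        linarith
      have h4 := ih (j - l) (by omega) (by omega)
      have h5 : (2 : ℝ) ^ ((j - l) ^ 2) ≤ 2 ^ (j ^ 2) :=
        pow_le_pow_right₀ (by norm_num) (Nat.pow_le_pow_left (Nat.sub_le _ _) 2)
      have h6 : E ^ (j - l) ≤ E ^ j := pow_le_pow_right₀ hE1 (Nat.sub_le _ _)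
      calc ‖iteratedDeriv l (logDeriv h) z‖ * ‖iteratedDeriv (j - l) h z‖
          ≤ E * (2 ^ (j ^ 2) * E ^ j * ‖h z‖) := by
            refine mul_le_mul h3 (h4.trans ?_) (norm_nonneg _) (by linarith)
            gcongr
        _ = _ := by ring
    refine (norm_sum_le _ _).trans ((Finset.sum_le_sum h2).trans ?_)
    rw [← Finset.sum_mul]
    have h3 : (∑ l ∈ Finset.range (j + 1), (j.choose l : ℝ)) = 2 ^ j := by
      exact_mod_cast Nat.sum_range_choose j
    rw [h3]
    have h4 : (2 : ℝ) ^ j * 2 ^ (j ^ 2) ≤ 2 ^ ((j + 1) ^ 2) := by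
      rw [← pow_add]
      exact pow_le_pow_right₀ (by norm_num) (by nlinarith)
    calc (2 : ℝ) ^ j * (2 ^ (j ^ 2) * E ^ (j + 1) * ‖h z‖)
        = 2 ^ j * 2 ^ (j ^ 2) * (E ^ (j + 1) * ‖h z‖) := by ring
      _ ≤ 2 ^ ((j + 1) ^ 2) * (E ^ (j + 1) * ‖h z‖) := by gcongr
      _ = _ := by ring

/-- The pointwise inequality that underlies the second main theorem with the Wronskian. -/
theorem log_norm_le_sum_sub_log_wronskian {n : ℕ} {g : Fin (n + 1) → ℂ → ℂ} {u : ℂ → ℂ} {z : ℂ}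
    (hg : ∀ i, AnalyticAt ℂ (g i) z) (hu : AnalyticAt ℂ u z) (hu0 : u z ≠ 0)
    (hg0 : ∀ i, g i z ≠ 0) (hs0 : ∑ i, g i z ≠ 0) (hW : wronskian g z ≠ 0)
    {E : Fin (n + 1) → ℝ} {E' : ℝ}
    (hE : ∀ i, 1 + ∑ l ∈ Finset.range n,
      ‖iteratedDeriv l (logDeriv (g i)) z - iteratedDeriv l (logDeriv u) z‖ ≤ E i)
    (hE' : 1 + ∑ l ∈ Finset.range n,
      ‖iteratedDeriv l (logDeriv fun w => ∑ i, g i w) z - iteratedDeriv l (logDeriv u) z‖ ≤ E')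
    (k : Fin (n + 1)) :
    Real.log ‖g k z‖ ≤ ∑ i, Real.log ‖g i z‖ + Real.log ‖∑ i, g i z‖ - Real.log ‖wronskian g z‖ +
      (Real.log ((n + 1).factorial * (2 ^ n ^ 2) ^ (n + 1)) +
        n * (∑ i, Real.log (E i) + Real.log E')) := by
  set s : ℂ → ℂ := fun w => ∑ i, g i w with hs
  have hsan : AnalyticAt ℂ s z := Finset.analyticAt_fun_sum _ fun i _ => hg i
  -- The determinant is estimated after `g k` is traded for the sum. The product of the `‖g i z‖`
  -- then lacks exactly `‖g k z‖`, which ends up on the left side.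
  set g' := Function.update g k s with hg'
  set E₁ := Function.update E k E' with hE₁
  have hg'an : ∀ i, AnalyticAt ℂ (g' i) z := fun i => by
    by_cases h : i = k
    · subst h; simpa [hg'] using hsan
    · simpa [hg', Function.update_of_ne h] using hg i
  have hg'0 : ∀ i, g' i z ≠ 0 := fun i => by
    by_cases h : i = k
    · subst h; simpa [hg'] using hs0
    · simpa [hg', Function.update_of_ne h] using hg0 i
  have hE₁b : ∀ i, 1 + ∑ l ∈ Finset.range n,
      ‖iteratedDeriv l (logDeriv (g' i)) z - iteratedDeriv l (logDeriv u) z‖ ≤ E₁ i := fun i => by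
    by_cases h : i = k
    · subst h; simpa [hg', hE₁] using hE'
    · simpa [hg', hE₁, Function.update_of_ne h] using hE i
  have h1le : ∀ (F : ℂ → ℂ) (e : ℝ), 1 + ∑ l ∈ Finset.range n,
      ‖iteratedDeriv l (logDeriv F) z - iteratedDeriv l (logDeriv u) z‖ ≤ e → 1 ≤ e := by
    intro F e he
    have : 0 ≤ ∑ l ∈ Finset.range n,
      ‖iteratedDeriv l (logDeriv F) z - iteratedDeriv l (logDeriv u) z‖ :=
      Finset.sum_nonneg fun _ _ => norm_nonneg _
    linarith
  -- Dividing by `u` turns the entries into derivatives of quotients, whose logarithmic derivatives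
  -- are the differences bounded by `E` and `E'`. The powers of `u` cancel, since both the
  -- determinant and the product have `n + 1` factors.
  set h : Fin (n + 1) → ℂ → ℂ := fun i w => g' i w / u w with hh
  have hhan : ∀ i, AnalyticAt ℂ (h i) z := fun i => (hg'an i).div hu hu0
  have hh0 : ∀ i, h i z ≠ 0 := fun i => div_ne_zero (hg'0 i) hu0
  have hWh : wronskian g z = u z ^ (n + 1) * wronskian h z := by
    rw [← wronskian_update_sum hg k, ← wronskian_mul hu hhan]
    refine wronskian_congr fun i => ?_
    filter_upwards [hu.continuousAt.eventually_ne hu0] with w hw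
    simp only [hh]
    rw [mul_div_cancel₀ _ hw]
  have hlogd : ∀ i, logDeriv (h i) =ᶠ[𝓝 z] logDeriv (g' i) - logDeriv u := by
    intro i
    filter_upwards [hu.continuousAt.eventually_ne hu0, (hg'an i).continuousAt.eventually_ne
      (hg'0 i), (hg'an i).eventually_analyticAt, hu.eventually_analyticAt] with w h1 h2 h3 h4
    exact logDeriv_div w h2 h1 h3.differentiableAt h4.differentiableAt
  have hentry : ∀ i j : Fin (n + 1), ‖iteratedDeriv j (h i) z‖ ≤
      2 ^ n ^ 2 * E₁ i ^ n * ‖h i z‖ := by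
    intro i j
    have h1 : 1 + ∑ l ∈ Finset.range n, ‖iteratedDeriv l (logDeriv (h i)) z‖ ≤ E₁ i := by
      refine le_trans (le_of_eq ?_) (hE₁b i)
      congr 1
      refine Finset.sum_congr rfl fun l _ => ?_
      rw [(hlogd i).iteratedDeriv_eq, iteratedDeriv_sub
        (analyticAt_logDeriv (hg'an i) (hg'0 i)).contDiffAt
        (analyticAt_logDeriv hu hu0).contDiffAt]
    have hj : (j : ℕ) ≤ n := Nat.lt_succ_iff.1 j.2
    refine (norm_iteratedDeriv_le_of_logDeriv (hhan i) (hh0 i) h1 hj).trans ?_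
    have h2 : (2 : ℝ) ^ ((j : ℕ) ^ 2) ≤ 2 ^ n ^ 2 :=
      pow_le_pow_right₀ (by norm_num) (Nat.pow_le_pow_left hj 2)
    have h3 : E₁ i ^ (j : ℕ) ≤ E₁ i ^ n := pow_le_pow_right₀ (h1le _ _ (hE₁b i)) hj
    have h4 : 0 ≤ E₁ i := zero_le_one.trans (h1le _ _ (hE₁b i))
    gcongr
  have hE₁1 : ∀ i, 1 ≤ E₁ i := fun i => h1le _ _ (hE₁b i)
  have hE1 : ∀ i, 1 ≤ E i := fun i => h1le _ _ (hE i)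
  have hE'1 : 1 ≤ E' := h1le _ _ hE'
  have hdet : ‖wronskian h z‖ ≤ (n + 1).factorial * ∏ i, (2 ^ n ^ 2 * E₁ i ^ n * ‖h i z‖) := by
    rw [wronskian, Matrix.det_apply']
    refine (norm_sum_le _ _).trans ?_
    have h1 : ∀ σ ∈ (Finset.univ : Finset (Equiv.Perm (Fin (n + 1)))),
        ‖((Equiv.Perm.sign σ : ℤ) : ℂ) * ∏ i, wronskiMatrix h z (σ i) i‖ ≤
        ∏ i, (2 ^ n ^ 2 * E₁ i ^ n * ‖h i z‖) := by
      intro σ _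
      rw [norm_mul, norm_prod]
      have h2 : ‖((Equiv.Perm.sign σ : ℤ) : ℂ)‖ = 1 := by
        rcases Int.units_eq_one_or (Equiv.Perm.sign σ) with h | h <;> simp [h]
      rw [h2, one_mul, ← Equiv.prod_comp σ fun i => 2 ^ n ^ 2 * E₁ i ^ n * ‖h i z‖]
      exact Finset.prod_le_prod (fun _ _ => norm_nonneg _) fun i _ => hentry _ _
    refine (Finset.sum_le_sum h1).trans (le_of_eq ?_)
    rw [Finset.sum_const, Finset.card_univ, Fintype.card_perm, Fintype.card_fin, nsmul_eq_mul]
  have hmain : ‖wronskian g z‖ ≤ (n + 1).factorial * (2 ^ n ^ 2) ^ (n + 1) *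
      ((∏ i, E₁ i) ^ n * ∏ i, ‖g' i z‖) := by
    rw [hWh, norm_mul, norm_pow]
    have hun : ‖u z‖ ≠ 0 := norm_ne_zero_iff.2 hu0
    refine (mul_le_mul_of_nonneg_left hdet (by positivity)).trans (le_of_eq ?_)
    simp only [hh, norm_div, Finset.prod_mul_distrib, Finset.prod_div_distrib, Finset.prod_const,
      Finset.card_univ, Fintype.card_fin, Finset.prod_pow]
    field_simp
  have hpos : ∀ i, 0 < ‖g' i z‖ := fun i => norm_pos_iff.2 (hg'0 i)
  have hEpos : ∀ i, 0 < E₁ i := fun i => zero_lt_one.trans_le (hE₁1 i)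
  have hlog := Real.log_le_log (norm_pos_iff.2 hW) hmain
  have hPE : 0 < ∏ i, E₁ i := Finset.prod_pos fun i _ => hEpos i
  have hPg : 0 < ∏ i, ‖g' i z‖ := Finset.prod_pos fun i _ => hpos i
  rw [Real.log_mul (by positivity) (by positivity), Real.log_mul (by positivity) hPg.ne',
    Real.log_pow, Real.log_prod fun i _ => (hEpos i).ne', Real.log_prod fun i _ => (hpos i).ne']
    at hlog
  have hs1 : ∑ i, Real.log ‖g' i z‖ + Real.log ‖g k z‖ =
      ∑ i, Real.log ‖g i z‖ + Real.log ‖∑ i, g i z‖ := by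
    rw [← Finset.add_sum_erase _ _ (Finset.mem_univ k), ← Finset.add_sum_erase _
      (fun i => Real.log ‖g i z‖) (Finset.mem_univ k)]
    have h1 : ∑ i ∈ Finset.univ.erase k, Real.log ‖g' i z‖ =
        ∑ i ∈ Finset.univ.erase k, Real.log ‖g i z‖ :=
      Finset.sum_congr rfl fun i hi => by
        rw [hg', Function.update_of_ne (Finset.ne_of_mem_erase hi)]
    have h2 : g' k z = ∑ i, g i z := by simp [hg', hs]
    rw [h1, h2]; ring
  have hs2 : ∑ i, Real.log (E₁ i) ≤ ∑ i, Real.log (E i) + Real.log E' := by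
    rw [← Finset.add_sum_erase _ _ (Finset.mem_univ k), ← Finset.add_sum_erase _
      (fun i => Real.log (E i)) (Finset.mem_univ k)]
    have h1 : ∑ i ∈ Finset.univ.erase k, Real.log (E₁ i) =
        ∑ i ∈ Finset.univ.erase k, Real.log (E i) :=
      Finset.sum_congr rfl fun i hi => by
        rw [hE₁, Function.update_of_ne (Finset.ne_of_mem_erase hi)]
    have h2 : E₁ k = E' := by simp [hE₁]
    rw [h1, h2]
    linarith [Real.log_nonneg (hE1 k)]
  have hs3 := mul_le_mul_of_nonneg_left hs2 (Nat.cast_nonneg (α := ℝ) n)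
  linarith

end PuncturedPlane

end

/-! ### Common zeros of polynomials and Krull's height theorem. -/

section

open Set Filter Topology Metric

namespace PuncturedPlane

section Height

variable {n : ℕ}

/-- The substitution that kills the first `j` variables. -/
noncomputable def killVars (n j : ℕ) :
    MvPolynomial (Fin n) ℂ →ₐ[ℂ] MvPolynomial (Fin n) ℂ :=
  MvPolynomial.aeval fun i => if (i : ℕ) < j then 0 else MvPolynomial.X i

instance ker_killVars_isPrime (j : ℕ) : (RingHom.ker (killVars n j)).IsPrime :=
  RingHom.ker_isPrime _

/-- The kernels form a chain of primes; it is strict because killing one more variable adds that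
variable to the kernel. -/
theorem natCast_le_height_ker_killVars {j : ℕ} (hj : j ≤ n) :
    (j : ℕ∞) ≤ (RingHom.ker (killVars n j)).height := by
  induction j with
  | zero => simp
  | succ j ih =>
    have hcomp : ∀ P, killVars n (j + 1) (killVars n j P) = killVars n (j + 1) P := by
      intro P
      have : (killVars n (j + 1)).comp (killVars n j) = killVars n (j + 1) := by
        refine MvPolynomial.algHom_ext fun i => ?_
        by_cases h : (i : ℕ) < j
        · simp only [killVars, AlgHom.comp_apply, MvPolynomial.aeval_X, if_pos h,
            if_pos (h.trans (Nat.lt_succ_self j)), map_zero]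
        · simp [killVars, h]
      exact DFunLike.congr_fun this P
    have hlt : RingHom.ker (killVars n j) < RingHom.ker (killVars n (j + 1)) := by
      refine lt_of_le_of_ne (fun P hP => ?_) fun h => ?_
      · rw [RingHom.mem_ker] at hP ⊢
        rw [← hcomp P, hP, map_zero]
      · have h1 : (MvPolynomial.X ⟨j, hj⟩ : MvPolynomial (Fin n) ℂ) ∈
            RingHom.ker (killVars n (j + 1)) := by
          simp [RingHom.mem_ker, killVars]
        rw [← h, RingHom.mem_ker] at h1
        simp [killVars] at h1
    have := Ideal.height_add_one_le_of_lt_of_isPrime hlt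
    push_cast
    exact (add_le_add_left (ih (by omega)) 1).trans this

theorem natCast_le_height_vanishingIdeal_zero :
    (n : ℕ∞) ≤ (MvPolynomial.vanishingIdeal ℂ ({0} : Set (Fin n → ℂ))).height := by
  refine (natCast_le_height_ker_killVars (n := n) le_rfl).trans (Ideal.height_mono fun P hP => ?_)
  rw [MvPolynomial.mem_vanishingIdeal_singleton_iff]
  rw [RingHom.mem_ker] at hP
  have : (MvPolynomial.aeval (0 : Fin n → ℂ)).comp (killVars n n) =
      MvPolynomial.aeval (0 : Fin n → ℂ) := by
    refine MvPolynomial.algHom_ext fun i => ?_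
    simp [killVars]
  rw [← this, AlgHom.comp_apply, hP, map_zero]

/-- Fewer than `n` polynomials in `n` variables that vanish at the origin have another common
zero. -/
theorem exists_common_zero_of_card_lt (s : Finset (MvPolynomial (Fin n) ℂ)) (hs : s.card < n)
    (h0 : ∀ P ∈ s, MvPolynomial.eval 0 P = 0) :
    ∃ x : Fin n → ℂ, x ≠ 0 ∧ ∀ P ∈ s, MvPolynomial.eval x P = 0 := by
  by_contra! hcon
  set I := Ideal.span (s : Set (MvPolynomial (Fin n) ℂ))
  set m := MvPolynomial.vanishingIdeal ℂ ({0} : Set (Fin n → ℂ)) with hm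
  have hZ : MvPolynomial.zeroLocus ℂ I = {0} := by
    ext x
    rw [MvPolynomial.mem_zeroLocus_iff, mem_singleton_iff]
    constructor
    · intro hx
      by_contra hx0
      obtain ⟨P, hP, hPx⟩ := hcon x hx0
      refine hPx ?_
      simpa using hx P (Ideal.subset_span hP)
    · rintro rfl P hP
      have : I ≤ RingHom.ker (MvPolynomial.aeval (R := ℂ) (0 : Fin n → ℂ)) :=
        Ideal.span_le.2 fun P hP => by simpa [RingHom.mem_ker] using h0 P hP
      exact this hP
  -- If the origin is the only common zero, the Nullstellensatz makes its ideal the radical of `I`,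
  -- hence a minimal prime over `I`. Krull's theorem bounds its height by the number of generators,
  -- although the height is at least `n`.
  have hrad : I.radical = m := by
    rw [← MvPolynomial.vanishingIdeal_zeroLocus_eq_radical (K := ℂ), hZ]
  have hmin : m ∈ I.minimalPrimes := by
    refine ⟨⟨inferInstance, hrad ▸ Ideal.le_radical⟩, fun p hp _ => ?_⟩
    rw [← hrad]
    exact hp.1.radical_le_iff.2 hp.2
  have h1 := Ideal.height_le_card_of_mem_minimalPrimes_span_finset hmin
  have h2 : (n : ℕ∞) ≤ s.card := natCast_le_height_vanishingIdeal_zero.trans h1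
  exact absurd (by exact_mod_cast h2 : n ≤ s.card) (not_le.2 hs)

end Height

/-! ### Homogeneous forms without common zero. -/

section Homogeneous

variable {N e : ℕ}

theorem eval_smul_of_isHomogeneous {P : MvPolynomial (Fin (N + 1)) ℂ} (hP : P.IsHomogeneous e)
    (a : ℂ) (x : Fin (N + 1) → ℂ) :
    MvPolynomial.eval (a • x) P = a ^ e * MvPolynomial.eval x P := by
  rw [MvPolynomial.eval_eq', MvPolynomial.eval_eq', Finset.mul_sum]
  refine Finset.sum_congr rfl fun m hm => ?_
  have h1 : ∑ i, m i = e := by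
    have := hP (MvPolynomial.mem_support_iff.1 hm)
    simpa [Finsupp.weight_apply, Finsupp.sum_fintype] using this
  simp only [Pi.smul_apply, smul_eq_mul, mul_pow, Finset.prod_mul_distrib,
    Finset.prod_pow_eq_pow_sum, h1]
  ring

theorem eval_zero_of_isHomogeneous {P : MvPolynomial (Fin (N + 1)) ℂ} (hP : P.IsHomogeneous e)
    (he : e ≠ 0) : MvPolynomial.eval 0 P = 0 := by
  have := eval_smul_of_isHomogeneous hP 0 0
  simpa [he] using this

theorem exists_norm_eval_le {P : MvPolynomial (Fin (N + 1)) ℂ} (hP : P.IsHomogeneous e) :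
    ∃ C : ℝ, 1 ≤ C ∧ ∀ x, ‖MvPolynomial.eval x P‖ ≤ C * ‖x‖ ^ e := by
  have hcont : Continuous fun x : Fin (N + 1) → ℂ => MvPolynomial.eval x P :=
    MvPolynomial.continuous_eval P
  obtain ⟨C, hC⟩ := (isCompact_sphere (0 : Fin (N + 1) → ℂ) 1).exists_bound_of_continuousOn
    hcont.continuousOn
  refine ⟨max C 1, le_max_right _ _, fun x => ?_⟩
  by_cases hx : x = 0
  · subst hx
    rcases Nat.eq_zero_or_pos e with rfl | he
    · have h1 := eval_smul_of_isHomogeneous hP 0 (fun _ => 1)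
      have h2 := hC (fun _ => 1) (by simp)
      rw [zero_smul, pow_zero, one_mul] at h1
      rw [h1]
      simpa using Or.inl h2
    · rw [eval_zero_of_isHomogeneous hP he.ne']
      simp [he.ne']
  · have hx' : 0 < ‖x‖ := norm_pos_iff.2 hx
    set y : Fin (N + 1) → ℂ := ((‖x‖ : ℂ)⁻¹) • x with hy
    have hxy : x = (‖x‖ : ℂ) • y := by
      rw [hy, smul_smul, mul_inv_cancel₀ (by exact_mod_cast hx'.ne'), one_smul]
    have hy1 : ‖y‖ = 1 := by
      rw [hy, norm_smul, norm_inv, Complex.norm_real, norm_norm, inv_mul_cancel₀ hx'.ne']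
    have h1 : MvPolynomial.eval x P = (‖x‖ : ℂ) ^ e * MvPolynomial.eval y P := by
      conv_lhs => rw [hxy]
      exact eval_smul_of_isHomogeneous hP _ _
    rw [h1, norm_mul, norm_pow, Complex.norm_real, norm_norm, mul_comm]
    gcongr
    exact (hC y (by simpa using hy1)).trans (le_max_left _ _)

/-- Homogeneous forms of the same degree without common zero dominate a power of the norm. -/
theorem exists_mul_norm_pow_le {P : Fin (N + 1) → MvPolynomial (Fin (N + 1)) ℂ}
    (hP : ∀ i, (P i).IsHomogeneous e)
    (h0 : ∀ x : Fin (N + 1) → ℂ, x ≠ 0 → ∃ i, MvPolynomial.eval x (P i) ≠ 0) :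
    ∃ κ : ℝ, 0 < κ ∧ ∀ x, x ≠ 0 → ∃ i, κ * ‖x‖ ^ e ≤ ‖MvPolynomial.eval x (P i)‖ := by
  have hcont : Continuous fun x : Fin (N + 1) → ℂ => ‖fun i => MvPolynomial.eval x (P i)‖ :=
    (continuous_pi fun i => MvPolynomial.continuous_eval (P i)).norm
  have hne : (sphere (0 : Fin (N + 1) → ℂ) 1).Nonempty := NormedSpace.sphere_nonempty.2 zero_le_one
  obtain ⟨y₀, hy₀, hmin⟩ := (isCompact_sphere (0 : Fin (N + 1) → ℂ) 1).exists_isMinOn hne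
    hcont.continuousOn
  have hy₀0 : y₀ ≠ 0 := by
    rintro rfl
    simp at hy₀
  refine ⟨‖fun i => MvPolynomial.eval y₀ (P i)‖, ?_, fun x hx => ?_⟩
  · obtain ⟨i, hi⟩ := h0 y₀ hy₀0
    exact norm_pos_iff.2 fun h => hi (congrFun h i)
  · have hx' : 0 < ‖x‖ := norm_pos_iff.2 hx
    set y : Fin (N + 1) → ℂ := ((‖x‖ : ℂ)⁻¹) • x with hy
    have hxy : x = (‖x‖ : ℂ) • y := by
      rw [hy, smul_smul, mul_inv_cancel₀ (by exact_mod_cast hx'.ne'), one_smul]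
    have hy1 : ‖y‖ = 1 := by
      rw [hy, norm_smul, norm_inv, Complex.norm_real, norm_norm, inv_mul_cancel₀ hx'.ne']
    have h2 : ‖fun i => MvPolynomial.eval y₀ (P i)‖ ≤ ‖fun i => MvPolynomial.eval y (P i)‖ :=
      hmin (by simpa using hy1)
    obtain ⟨i, -, hi⟩ := Finset.exists_max_image Finset.univ
      (fun i => ‖MvPolynomial.eval y (P i)‖) Finset.univ_nonempty
    have h3 : ‖fun i => MvPolynomial.eval y (P i)‖ ≤ ‖MvPolynomial.eval y (P i)‖ :=
      (pi_norm_le_iff_of_nonneg (norm_nonneg _)).2 fun j => hi j (Finset.mem_univ j)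
    refine ⟨i, ?_⟩
    have h1 : MvPolynomial.eval x (P i) = (‖x‖ : ℂ) ^ e * MvPolynomial.eval y (P i) := by
      conv_lhs => rw [hxy]
      exact eval_smul_of_isHomogeneous (hP i) _ _
    rw [h1, norm_mul, norm_pow, Complex.norm_real, norm_norm, mul_comm]
    exact mul_le_mul_of_nonneg_left (h2.trans h3) (by positivity)

/-- Forms of positive degree without common zero, as many as variables, are linearly
independent. -/
theorem eq_zero_of_linear_relation {P : Fin (N + 1) → MvPolynomial (Fin (N + 1)) ℂ}
    (hP : ∀ i, (P i).IsHomogeneous e) (he : e ≠ 0)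
    (h0 : ∀ x : Fin (N + 1) → ℂ, x ≠ 0 → ∃ i, MvPolynomial.eval x (P i) ≠ 0)
    {a : Fin (N + 1) → ℂ} (ha : ∑ i, MvPolynomial.C (a i) * P i = 0) : a = 0 := by
  classical
  by_contra hne
  obtain ⟨k, hk⟩ := Function.ne_iff.1 hne
  set s : Finset (MvPolynomial (Fin (N + 1)) ℂ) := (Finset.univ.erase k).image P
  have hcard : s.card < N + 1 := by
    refine Finset.card_image_le.trans_lt ?_
    rw [Finset.card_erase_of_mem (Finset.mem_univ k), Finset.card_univ, Fintype.card_fin]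
    omega
  -- At most `N` forms other than `P k` vanish together at some `x ≠ 0`; there the relation, with
  -- nonzero coefficient at `k`, would make `P k` vanish too.
  obtain ⟨x, hx, hxs⟩ := exists_common_zero_of_card_lt s hcard fun Q hQ => by
    obtain ⟨i, -, rfl⟩ := Finset.mem_image.1 hQ
    exact eval_zero_of_isHomogeneous (hP i) he
  have hother : ∀ i, i ≠ k → MvPolynomial.eval x (P i) = 0 := fun i hi =>
    hxs _ (Finset.mem_image_of_mem _ (Finset.mem_erase.2 ⟨hi, Finset.mem_univ i⟩))
  obtain ⟨i, hi⟩ := h0 x hx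
  have hik : i = k := by
    by_contra h
    exact hi (hother i h)
  subst hik
  have h1 := congrArg (MvPolynomial.eval x) ha
  rw [map_sum, map_zero, Finset.sum_eq_single i] at h1
  · rw [map_mul, MvPolynomial.eval_C] at h1
    exact (mul_ne_zero hk hi) h1
  · intro j _ hj
    rw [map_mul, hother j hj, mul_zero]
  · simp

end Homogeneous

/-- A nonzero form does not vanish identically along an algebraically nondegenerate curve. -/
theorem exists_eval_ne_zero {M N e : ℕ} {c : Fin M → ℂ} {f : ℂ → Fin (N + 1) → ℂ}
    (hnd : IsAlgebraicallyNondegenerate c f) {P : MvPolynomial (Fin (N + 1)) ℂ}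
    (hP : P.IsHomogeneous e) (hP0 : P ≠ 0) : ∃ z ∈ Omega c, MvPolynomial.eval (f z) P ≠ 0 := by
  by_contra! hcon
  have h1 : ∀ x : Fin (N + 1) → ℂ, x ≠ 0 → MvPolynomial.eval x P = 0 := fun x hx =>
    hnd {P} (by simpa using ⟨e, hP⟩) (by simpa using hcon) x hx P rfl
  refine hP0 (MvPolynomial.funext fun x => ?_)
  rw [map_zero]
  -- Nondegeneracy speaks only of nonzero vectors; the value at the origin follows by continuity.
  by_cases hx : x = 0
  · subst hx
    by_contra h0
    have hcont : Continuous fun x : Fin (N + 1) → ℂ => MvPolynomial.eval x P :=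
      MvPolynomial.continuous_eval P
    have h2 : ∀ᶠ x in 𝓝[≠] (0 : Fin (N + 1) → ℂ), MvPolynomial.eval x P ≠ 0 :=
      (hcont.continuousAt.eventually_ne h0).filter_mono nhdsWithin_le_nhds
    have h3 : ∀ᶠ x in 𝓝[≠] (0 : Fin (N + 1) → ℂ), x ≠ 0 := eventually_mem_nhdsWithin
    obtain ⟨x, hx1, hx2⟩ := (h2.and h3).exists
    exact hx1 (h1 x hx2)
  · exact h1 x hx

theorem differentiableOn_eval {M N : ℕ} {c : Fin M → ℂ} {f : ℂ → Fin (N + 1) → ℂ}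
    (hf : IsHolomorphicCurve c f) (P : MvPolynomial (Fin (N + 1)) ℂ) :
    DifferentiableOn ℂ (fun z => MvPolynomial.eval (f z) P) (Omega c) := by
  simp only [MvPolynomial.eval_eq']
  exact DifferentiableOn.fun_sum fun m _ => (DifferentiableOn.fun_finsetProd fun i _ =>
    (hf.holomorphic i).fun_pow _).const_mul _

end PuncturedPlane

end

/-! ### Polynomial growth, rationality and the sub-mean-value property. -/

section

open Set Filter Topology Metric

namespace PuncturedPlane

/-- An entire function of polynomial growth is a polynomial. -/
theorem exists_polynomial_of_entire_growth {F : ℂ → ℂ} (hF : Differentiable ℂ F) {C : ℝ} {k : ℕ}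
    (hgr : ∀ᶠ R : ℝ in atTop, ∀ z, ‖z‖ = R → ‖F z‖ ≤ C * R ^ k) :
    ∃ P : Polynomial ℂ, ∀ z, F z = P.eval z := by
  have hzero : ∀ n, k < n → iteratedDeriv n F 0 = 0 := by
    intro n hn
    rw [← norm_eq_zero]
    refine le_antisymm ?_ (norm_nonneg _)
    have hlim : Tendsto (fun R : ℝ => n.factorial * C * (1 / R ^ (n - k))) atTop (𝓝 0) := by
      have : Tendsto (fun R : ℝ => 1 / R ^ (n - k)) atTop (𝓝 0) := by
        simp only [one_div]
        exact (tendsto_pow_atTop (by omega)).inv_tendsto_atTop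
      simpa using this.const_mul (n.factorial * C)
    refine ge_of_tendsto hlim ?_
    filter_upwards [hgr, eventually_gt_atTop 0] with R hR hR0
    have h1 := Complex.norm_iteratedDeriv_le_of_forall_mem_sphere_norm_le n hR0
      (hF.diffContOnCl (s := ball 0 R)) fun z hz => hR z (by simpa using hz)
    refine h1.trans (le_of_eq ?_)
    obtain ⟨l, rfl⟩ : ∃ l, n = k + l := ⟨n - k, by omega⟩
    rw [Nat.add_sub_cancel_left, pow_add]
    field_simp
  refine ⟨∑ n ∈ Finset.range (k + 1),
    Polynomial.C ((n.factorial : ℂ)⁻¹ * iteratedDeriv n F 0) * Polynomial.X ^ n, fun z => ?_⟩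
  have h := Complex.taylorSeries_eq_of_entire' (c := 0) (z := z) hF
  rw [← h, tsum_eq_sum (s := Finset.range (k + 1)) fun n hn => by
    rw [hzero n (by simpa [Nat.lt_succ_iff] using hn)]; simp, Polynomial.eval_finsetSum]
  refine Finset.sum_congr rfl fun n _ => ?_
  simp

theorem exists_norm_prod_le {ι : Type*} (Z : Finset ι) (a : ι → ℂ) (m : ι → ℕ) :
    ∃ C : ℝ, 1 ≤ C ∧ ∃ D : ℕ, ∀ z, ‖∏ i ∈ Z, (z - a i) ^ m i‖ ≤ C * (1 + ‖z‖) ^ D := by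
  classical
  induction Z using Finset.induction_on with
  | empty => exact ⟨1, le_rfl, 0, by simp⟩
  | insert i Z hi ih =>
    obtain ⟨C, hC, D, h⟩ := ih
    refine ⟨(1 + ‖a i‖) ^ m i * C, ?_, m i + D, fun z => ?_⟩
    · exact one_le_mul_of_one_le_of_one_le (one_le_pow₀ (by linarith [norm_nonneg (a i)])) hC
    · rw [Finset.prod_insert hi, norm_mul, norm_pow, pow_add]
      have h1 : ‖z - a i‖ ≤ (1 + ‖a i‖) * (1 + ‖z‖) := by
        have := norm_sub_le z (a i)
        nlinarith [norm_nonneg z, norm_nonneg (a i), mul_nonneg (norm_nonneg z) (norm_nonneg (a i))]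
      calc ‖z - a i‖ ^ m i * ‖∏ i ∈ Z, (z - a i) ^ m i‖
          ≤ ((1 + ‖a i‖) * (1 + ‖z‖)) ^ m i * (C * (1 + ‖z‖) ^ D) := by
            gcongr
            exact h z
        _ = _ := by rw [mul_pow]; ring

/-- A holomorphic function with poles of bounded order at finitely many points and at infinity is
rational. -/
theorem exists_polynomial_of_growth {Z : Finset ℂ} {g : ℂ → ℂ}
    (hg : DifferentiableOn ℂ g ((Z : Set ℂ)ᶜ)) {C : ℝ} {k : ℕ}
    (hZ : ∀ a ∈ Z, ∀ᶠ z in 𝓝[≠] a, ‖g z‖ * ‖z - a‖ ^ k ≤ C)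
    (hgr : ∀ᶠ R : ℝ in atTop, ∀ z, ‖z‖ = R → ‖g z‖ ≤ C * R ^ k) :
    ∃ P : Polynomial ℂ, ∀ z ∉ Z, (∏ a ∈ Z, (z - a) ^ (k + 2)) * g z = P.eval z := by
  classical
  have hZo : IsOpen ((Z : Set ℂ)ᶜ) := Z.finite_toSet.isClosed.isOpen_compl
  set F : ℂ → ℂ := fun z => (∏ a ∈ Z, (z - a) ^ (k + 2)) * g z with hF
  have hdiff : Differentiable ℂ F := by
    intro z
    by_cases hz : z ∈ Z
    · have hF0 : ∀ w, F w = (w - z) ^ (k + 2) * ((∏ a ∈ Z.erase z, (w - a) ^ (k + 2)) * g w) := by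
        intro w
        rw [hF, ← mul_assoc, Finset.mul_prod_erase Z (fun a => (w - a) ^ (k + 2)) hz]
      have hcont : ContinuousAt (fun w => ‖∏ a ∈ Z.erase z, (w - a) ^ (k + 2)‖) z := by fun_prop
      obtain ⟨B, hB⟩ : ∃ B, ∀ᶠ w in 𝓝 z, ‖∏ a ∈ Z.erase z, (w - a) ^ (k + 2)‖ ≤ B :=
        ⟨_, (hcont.eventually_lt continuousAt_const (lt_add_one _)).mono fun _ h => le_of_lt h⟩
      have hB0 : 0 ≤ B := (norm_nonneg _).trans hB.self_of_nhds
      -- `k` of the `k + 2` factors cancel the pole and two remain, so `F = O(|w - z|²)`. Hence `F`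
      -- has derivative `0` at `z`, whatever value `g` takes there.
      have hbig : F =O[𝓝 z] fun w => ‖w - z‖ ^ 2 := by
        refine Asymptotics.IsBigO.of_bound (B * C) ?_
        have h1 := eventually_nhdsWithin_iff.1 (hZ z hz)
        filter_upwards [hB, h1] with w hw1 hw2
        by_cases hwz : w = z
        · subst hwz
          rw [hF0 w]
          simp
        · rw [hF0 w, norm_mul, norm_mul, norm_pow, Real.norm_of_nonneg (by positivity), pow_add]
          have h3 := hw2 hwz
          calc ‖w - z‖ ^ k * ‖w - z‖ ^ 2 * (‖∏ a ∈ Z.erase z, (w - a) ^ (k + 2)‖ * ‖g w‖)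
              = ‖∏ a ∈ Z.erase z, (w - a) ^ (k + 2)‖ * (‖g w‖ * ‖w - z‖ ^ k) * ‖w - z‖ ^ 2 := by
                ring
            _ ≤ B * C * ‖w - z‖ ^ 2 := by gcongr
      have hFz : F z = 0 := by rw [hF0 z]; simp
      have : HasDerivAt F 0 z := by
        rw [hasDerivAt_iff_isLittleO]
        simp only [hFz, sub_zero, smul_zero]
        refine hbig.trans_isLittleO ?_
        have := Asymptotics.isLittleO_norm_pow_id (E' := ℂ) one_lt_two
        have h2 := this.comp_tendsto (tendsto_sub_nhds_zero_iff.2 (tendsto_id (x := 𝓝 z)))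
        exact h2
      exact this.differentiableAt
    · exact (by fun_prop : DifferentiableAt ℂ (fun z => ∏ a ∈ Z, (z - a) ^ (k + 2)) z).mul
        (hg.differentiableAt (hZo.mem_nhds hz))
  obtain ⟨C', hC', D, hbd⟩ := exists_norm_prod_le Z id fun _ => k + 2
  obtain ⟨P, hP⟩ := exists_polynomial_of_entire_growth hdiff (C := C' * 2 ^ D * C) (k := D + k) (by
    filter_upwards [hgr, eventually_ge_atTop 1] with R hR hR1 z hz
    have h1 := hR z hz
    have h2 := hbd z
    rw [hz] at h2
    have h3 : (1 + R) ^ D ≤ 2 ^ D * R ^ D := by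
      rw [← mul_pow]; gcongr; linarith
    rw [hF, norm_mul]
    calc ‖∏ a ∈ Z, (z - a) ^ (k + 2)‖ * ‖g z‖ ≤ (C' * (2 ^ D * R ^ D)) * (C * R ^ k) := by
          refine mul_le_mul (h2.trans ?_) h1 (norm_nonneg _) (by positivity)
          gcongr
      _ = _ := by rw [pow_add]; ring)
  exact ⟨P, fun z _ => hP z⟩

/-- Jensen's inequality: the sub-mean-value property of `log |g|`. -/
theorem log_norm_le_circleAverage {V : Set ℂ} (hV : IsOpen V) {g : ℂ → ℂ}
    (hg : DifferentiableOn ℂ g V) (hord : ∀ w ∈ V, analyticOrderAt g w ≠ ⊤) {z : ℂ} {s : ℝ}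
    (hs : 0 < s) (hsub : closedBall z s ⊆ V) (hgz : g z ≠ 0) :
    Real.log ‖g z‖ ≤ Real.circleAverage (fun w => Real.log ‖g w‖) z s := by
  have hfin := finite_zeros_inter_compact hV hg hord (isCompact_closedBall z s) hsub
  obtain ⟨G, hG, hGZ, hgG⟩ := exists_factor_zeros hV hfin.toFinset hg
    (fun a ha => hsub (hfin.mem_toFinset.1 ha).1) hord
  set Z := hfin.toFinset
  have hzV : z ∈ V := hsub (mem_closedBall_self hs.le)
  have hG0 : ∀ w ∈ closedBall z s, G w ≠ 0 := by
    intro w hw h0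
    refine hGZ w (hfin.mem_toFinset.2 ⟨hw, ?_⟩) h0
    rw [hgG w (hsub hw), h0, mul_zero]
  have hlog : ∀ w ∈ closedBall z s, w ∉ Z → Real.log ‖g w‖ =
      ∑ a ∈ Z, (analyticOrderNatAt g a : ℝ) • Real.log ‖w - a‖ + Real.log ‖G w‖ := by
    intro w hw hwZ
    have hne : ∀ a ∈ Z, ‖w - a‖ ≠ 0 := fun a ha h =>
      hwZ (by rw [norm_eq_zero, sub_eq_zero] at h; rwa [h])
    rw [hgG w (hsub hw), norm_mul, norm_prod, Real.log_mul (Finset.prod_ne_zero_iff.2 fun a ha => by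
      rw [norm_pow]; exact pow_ne_zero _ (hne a ha)) (norm_ne_zero_iff.2 (hG0 w hw)),
      Real.log_prod fun a ha => by rw [norm_pow]; exact pow_ne_zero _ (hne a ha)]
    simp
  have hss : sphere z s ⊆ V := sphere_subset_closedBall.trans hsub
  have hi1 : ∀ a ∈ Z, CircleIntegrable
      (fun w => (analyticOrderNatAt g a : ℝ) • Real.log ‖w - a‖) z s := fun a _ =>
    (circleIntegrable_log_norm_sub a z s).const_fun_smul
  have hi2 := circleIntegrable_log_norm_of_differentiableOn hV hG hs.le hss
  have hzZ : z ∉ Z := fun h => hgz (hfin.mem_toFinset.1 h).2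
  have hle : Real.circleAverage (fun w => ∑ a ∈ Z, (analyticOrderNatAt g a : ℝ) • Real.log ‖w - a‖
      + Real.log ‖G w‖) z s ≤ Real.circleAverage (fun w => Real.log ‖g w‖) z s := by
    refine circleAverage_mono_of_countable hs.ne' ((CircleIntegrable.fun_sum _ hi1).add hi2)
      (circleIntegrable_log_norm_of_differentiableOn hV hg hs.le hss) Z.countable_toSet ?_
    intro w hw hwZ
    rw [abs_of_pos hs] at hw
    exact (hlog w (sphere_subset_closedBall hw) hwZ).ge
  refine le_trans ?_ hle
  rw [hlog z (mem_closedBall_self hs.le) hzZ, Real.circleAverage_fun_add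
    (CircleIntegrable.fun_sum _ hi1) hi2, Real.circleAverage_fun_sum hi1]
  refine add_le_add (Finset.sum_le_sum fun a ha => ?_) (le_of_eq ?_)
  · rw [Real.circleAverage_fun_smul, circleAverage_log_norm_sub_const_eq_log_radius_add_posLog
      hs.ne', smul_eq_mul, smul_eq_mul]
    refine mul_le_mul_of_nonneg_left ?_ (by positivity)
    have hza : 0 < ‖z - a‖ := norm_pos_iff.2 fun h => hzZ (by rw [sub_eq_zero.1 h]; exact ha)
    have h1 : Real.log ‖z - a‖ = Real.log s + Real.log (s⁻¹ * ‖z - a‖) := by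
      rw [Real.log_mul (by positivity) hza.ne', Real.log_inv]; ring
    rw [h1]
    gcongr
    exact le_max_right _ _
  · symm
    refine AnalyticOnNhd.circleAverage_log_norm_of_ne_zero (fun w hw => ?_) fun w hw => ?_
    · rw [abs_of_pos hs] at hw
      exact hG.analyticOnNhd hV w (hsub hw)
    · rw [abs_of_pos hs] at hw
      exact hG0 w hw

/-- `exists_radius_circleAverage_le` provides a circle about `z` with controlled mean, and the
sub-mean-value property carries the bound to the centre. The positive part is used because the
choice of the radius needs a nonnegative integrand; `δ = ρ / 2` gives the constant `32`. -/
theorem log_norm_le_of_circleAverage_posLog_le {V : Set ℂ} (hV : IsOpen V) {g : ℂ → ℂ}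
    (hg : DifferentiableOn ℂ g V) (hord : ∀ w ∈ V, analyticOrderAt g w ≠ ⊤) {x z : ℂ} {ρ B : ℝ}
    (hρ : 0 < ρ) (hz : ‖z - x‖ = ρ) (hgz : g z ≠ 0)
    (hsub : ∀ t ∈ Ioo (ρ / 2) (ρ + ρ / 2), sphere x t ⊆ V)
    (hB : ∀ t ∈ Ioo (ρ / 2) (ρ + ρ / 2),
      Real.circleAverage (fun w => Real.posLog ‖g w‖) x t ≤ B) :
    Real.log ‖g z‖ ≤ 32 * B := by
  classical
  have hball : ball z (ρ / 2) ⊆ V := by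
    intro a ha
    rw [mem_ball, dist_eq_norm] at ha
    have h1 : ‖a - x‖ ≤ ‖a - z‖ + ‖z - x‖ := norm_sub_le_norm_sub_add_norm_sub _ _ _
    have h2 : ‖z - x‖ ≤ ‖z - a‖ + ‖a - x‖ := norm_sub_le_norm_sub_add_norm_sub _ _ _
    rw [norm_sub_rev z a] at h2
    exact hsub ‖a - x‖ ⟨by linarith, by linarith⟩ (by rw [mem_sphere, dist_eq_norm])
  set g' := V.indicator g with hg'
  have hg'm : Measurable g' := by
    rw [hg', ← piecewise_eq_indicator]
    exact hg.continuousOn.measurable_piecewise continuousOn_const hV.measurableSet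
  set u : ℂ → ℝ := fun w => Real.posLog ‖g' w‖ with hu
  have hum : Measurable u := by
    have : u = fun w => max 0 (Real.log ‖g' w‖) := rfl
    rw [this]
    exact measurable_const.max (Real.measurable_log.comp hg'm.norm)
  have hpos : ∀ {y : ℂ} {t : ℝ}, 0 ≤ t → sphere y t ⊆ V →
      CircleIntegrable (fun w => Real.posLog ‖g w‖) y t := by
    intro y t ht hy
    refine CircleIntegrable.congr_codiscreteWithin (f₁ := fun w => (2 : ℝ)⁻¹ •
      (|Real.log ‖g w‖| + Real.log ‖g w‖)) ?_ ?_
    · refine Eventually.of_forall fun w => ?_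
      simp only [smul_eq_mul, Real.posLog_apply]
      rcases le_total 0 (Real.log ‖g w‖) with h | h
      · rw [abs_of_nonneg h, max_eq_right h]; ring
      · rw [abs_of_nonpos h, max_eq_left h]; ring
    · have := circleIntegrable_log_norm_of_differentiableOn hV hg ht hy
      exact (this.abs.add this).const_fun_smul
  have hucirc : ∀ {y : ℂ} {t : ℝ}, 0 ≤ t → sphere y t ⊆ V → CircleIntegrable u y t ∧
      Real.circleAverage u y t = Real.circleAverage (fun w => Real.posLog ‖g w‖) y t := by
    intro y t ht hy
    have heq : EqOn u (fun w => Real.posLog ‖g w‖) (sphere y t) := by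
      intro w hw
      simp [hu, hg', indicator_of_mem (hy hw)]
    exact ⟨circleIntegrable_congr_sphere ht heq (hpos ht hy),
      Real.circleAverage_congr_sphere (by rwa [abs_of_nonneg ht])⟩
  have e1 : ρ - ρ / 2 = ρ / 2 := by ring
  obtain ⟨s, hs, hsB⟩ := exists_radius_circleAverage_le hum (fun w => Real.posLog_nonneg)
    (δ := ρ / 2) (ρ := ρ) (x := x) (z := z) (B := B) (by positivity) (by linarith) hz
    (fun t ht => by
      rw [e1] at ht
      obtain ⟨h1, h2⟩ := hucirc (by linarith [ht.1]) (hsub t ht)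
      exact ⟨h1, h2.trans_le (hB t ht)⟩)
    (fun s hs => (hucirc (by linarith [hs.1]) ((sphere_subset_ball hs.2).trans hball)).1)
  have hs0 : 0 < s := by linarith [hs.1]
  have hsV : closedBall z s ⊆ V := (closedBall_subset_ball hs.2).trans hball
  have hsS : sphere z s ⊆ V := sphere_subset_closedBall.trans hsV
  rw [(hucirc hs0.le hsS).2] at hsB
  have h1 := log_norm_le_circleAverage hV hg hord hs0 hsV hgz
  have h2 : Real.circleAverage (fun w => Real.log ‖g w‖) z s ≤
      Real.circleAverage (fun w => Real.posLog ‖g w‖) z s :=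
    Real.circleAverage_mono (circleIntegrable_log_norm_of_differentiableOn hV hg hs0.le hsS)
      (hpos hs0.le hsS) fun w _ => le_max_right _ _
  have h3 : 16 * ρ * B / (ρ / 2) = 32 * B := by field_simp; ring
  linarith

end PuncturedPlane

end

/-! ### Quotients with few zeros in a pencil are rational. -/

section

open Set Filter Topology Metric

namespace PuncturedPlane

variable {M : ℕ} {c : Fin M → ℂ}

theorem eventually_mem_closedRegion {z : ℂ} (hz : z ∈ Omega c) :
    ∀ᶠ t : ℝ in atTop, z ∈ closedRegion c t := by
  have h1 : ∀ j, ∀ᶠ t : ℝ in atTop, 1 / t ≤ ‖z - c j‖ := by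
    intro j
    have hpos : 0 < ‖z - c j‖ := norm_pos_iff.2 fun h => hz ⟨j, (sub_eq_zero.1 h).symm⟩
    have : Tendsto (fun t : ℝ => 1 / t) atTop (𝓝 0) := by
      simpa only [one_div] using tendsto_inv_atTop_zero
    exact (this.eventually_lt_const hpos).mono fun _ h => le_of_lt h
  filter_upwards [eventually_ge_atTop ‖z‖, eventually_all.2 h1] with t ht ht'
  exact ⟨ht, ht'⟩

/-- Any finite part of the support lies in `closedRegion c t` for large `t`, so it has at most `K`
elements. -/
theorem finite_of_weightCount_le {s K : ℝ} (hs : Separated c s) {m : ℂ → ℕ}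
    (hm : LocallyFiniteWeight c m) (hK : ∀ t, s ≤ t → (weightCount c m t : ℝ) ≤ K) :
    {z ∈ Omega c | m z ≠ 0}.Finite := by
  by_contra hinf
  obtain ⟨n, hn⟩ := exists_nat_gt K
  obtain ⟨F, hF, hcard⟩ := Set.Infinite.exists_subset_card_eq hinf n
  have hev : ∀ᶠ t : ℝ in atTop, ∀ z ∈ F, z ∈ closedRegion c t :=
    (Filter.eventually_all_finset F).2 fun z hz => eventually_mem_closedRegion (hF hz).1
  obtain ⟨t, ht, hst⟩ := (hev.and (eventually_ge_atTop s)).exists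
  have hsep := hs.mono hst
  have hfin := hm t hsep.pos
  have h1 := weightCount_eq_sum (m := m) hsep le_rfl (Z := hfin.toFinset)
    fun z hz hz' => hfin.mem_toFinset.2 ⟨hz, hz'⟩
  have h2 : F.card ≤ weightCount c m t := by
    rw [h1, Finset.card_eq_sum_ones]
    refine (Finset.sum_le_sum fun a ha => ?_).trans
      (Finset.sum_le_sum_of_subset (f := fun a => (closedRegion c t).indicator m a)
        fun a ha => hfin.mem_toFinset.2 ⟨ht a ha, (hF ha).2⟩)
    rw [indicator_of_mem (ht a ha)]
    exact Nat.one_le_iff_ne_zero.2 (hF ha).2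
  have h3 : (n : ℝ) ≤ weightCount c m t := by exact_mod_cast hcard ▸ h2
  linarith [hK t hst]

theorem le_mul_pow_of_log_le {x y L : ℝ} {m : ℕ} (hx : 1 ≤ x) (hy : 0 < y) (hLm : L ≤ m)
    (h : Real.log y ≤ L * (1 + Real.log (1 + 2 * x))) :
    y ≤ Real.exp m * 4 ^ m * x ^ m := by
  have h1 : Real.log (1 + 2 * x) ≤ Real.log (4 * x) :=
    Real.log_le_log (by linarith) (by linarith)
  have h2 : 0 ≤ Real.log (1 + 2 * x) := Real.log_nonneg (by linarith)
  have h3 : Real.log y ≤ Real.log (Real.exp m * 4 ^ m * x ^ m) := by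
    rw [mul_assoc, ← mul_pow, Real.log_mul (Real.exp_pos _).ne' (by positivity), Real.log_exp,
      Real.log_pow]
    calc Real.log y ≤ L * (1 + Real.log (1 + 2 * x)) := h
      _ ≤ m * (1 + Real.log (4 * x)) := by
        refine mul_le_mul hLm (by linarith) (by linarith) (by positivity)
      _ = _ := by ring
  exact (Real.log_le_log_iff hy (by positivity)).1 h3

theorem bdryIntegrable_posLog {g : ℂ → ℂ} {t : ℝ} (ht : Separated c t)
    (hg : DifferentiableOn ℂ g (Omega c)) : BdryIntegrable c (fun w => Real.posLog ‖g w‖) t :=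
  bdryIntegrable_of_continuousOn ht (Real.continuous_posLog.comp_continuousOn
    (hg.continuousOn.mono (closedRegion_subset_Omega ht.pos)).norm)

/-- Polynomial growth on the circles about the origin and about the punctures. -/
theorem exists_growth_of_bdryAvg_posLog_le {s κ : ℝ} (hs : Separated c s) {g : ℂ → ℂ}
    (hg : DifferentiableOn ℂ g (Omega c)) (hne : ∃ z ∈ Omega c, g z ≠ 0)
    (hκ : 0 ≤ κ) (hB : ∀ T, s ≤ T →
      bdryAvg c (fun w => Real.posLog ‖g w‖) T ≤ κ * (1 + Real.log (1 + T))) :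
    ∃ C : ℝ, ∃ m : ℕ, (∀ j, ∀ᶠ z in 𝓝[≠] (c j), ‖g z‖ * ‖z - c j‖ ^ m ≤ C) ∧
      ∀ᶠ R : ℝ in atTop, ∀ z, ‖z‖ = R → ‖g z‖ ≤ C * R ^ m := by
  obtain ⟨m, hm⟩ := exists_nat_ge (32 * κ)
  have hord := order_ne_top_Omega hg hne
  have hs0 := hs.pos
  have hmonoB : ∀ {T T' : ℝ}, 0 < T → T ≤ T' →
      κ * (1 + Real.log (1 + T)) ≤ κ * (1 + Real.log (1 + T')) := fun h h' =>
    mul_le_mul_of_nonneg_left (add_le_add_right (Real.log_le_log (by linarith) (by linarith)) _) hκ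
  refine ⟨Real.exp m * 4 ^ m, m, fun j => ?_, ?_⟩
  · have hsmall : ∀ᶠ z in 𝓝[≠] (c j), ‖z - c j‖ < min 1 (1 / (2 * s)) := by
      refine eventually_nhdsWithin_of_eventually_nhds ?_
      have : ContinuousAt (fun z => ‖z - c j‖) (c j) := by fun_prop
      exact this.eventually_lt continuousAt_const (by simp; positivity)
    filter_upwards [hsmall, self_mem_nhdsWithin] with z hz hzne
    have hρ : 0 < ‖z - c j‖ := norm_pos_iff.2 (sub_ne_zero.2 hzne)
    set ρ := ‖z - c j‖ with hρdef
    have hρ1 : ρ < 1 := lt_of_lt_of_le hz (min_le_left _ _)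
    have hρs : ρ * (2 * s) < 1 := (lt_div_iff₀ (by positivity)).1 (lt_of_lt_of_le hz (min_le_right _ _))
    by_cases hgz : g z = 0
    · rw [hgz, norm_zero, zero_mul]; positivity
    have hT : ∀ t ∈ Ioo (ρ / 2) (ρ + ρ / 2), 0 < t ∧ s ≤ 1 / t ∧ 1 / t ≤ 2 * (1 / ρ) := by
      intro t ht
      have ht0 : 0 < t := by linarith [ht.1]
      refine ⟨ht0, (le_div_iff₀ ht0).2 ?_, ?_⟩
      · nlinarith [ht.2]
      · rw [mul_one_div, div_le_div_iff₀ ht0 hρ]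
        linarith [ht.1]
    have h1 := log_norm_le_of_circleAverage_posLog_le (isOpen_Omega c) hg hord hρ hρdef.symm hgz
      (B := κ * (1 + Real.log (1 + 2 * (1 / ρ)))) (fun t ht => by
        obtain ⟨ht0, hst, -⟩ := hT t ht
        have := (hs.mono hst).inner_circle_subset j
        rw [one_div_one_div] at this
        exact this.trans (closedRegion_subset_Omega (by positivity))) (fun t ht => by
        obtain ⟨ht0, hst, ht2⟩ := hT t ht
        have h2 := circleAverage_puncture_le_bdryAvg (c := c) (t := 1 / t)
          (u := fun w => Real.posLog ‖g w‖) (fun _ => Real.posLog_nonneg) j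
        rw [one_div_one_div] at h2
        exact (h2.trans (hB _ hst)).trans (hmonoB (by positivity) ht2))
    rw [← mul_assoc] at h1
    have h2 := le_mul_pow_of_log_le (x := 1 / ρ) (by rw [le_div_iff₀ hρ]; linarith)
      (norm_pos_iff.2 hgz) hm h1
    rw [one_div, inv_pow] at h2
    calc ‖g z‖ * ρ ^ m ≤ (Real.exp m * 4 ^ m * (ρ ^ m)⁻¹) * ρ ^ m := by gcongr
      _ = _ := by field_simp
  · filter_upwards [eventually_ge_atTop (2 * s), eventually_ge_atTop 1] with R hR hR1 z hz
    by_cases hgz : g z = 0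
    · rw [hgz, norm_zero]; positivity
    have hR0 : 0 < R := by linarith
    have h1 := log_norm_le_of_circleAverage_posLog_le (isOpen_Omega c) hg hord (x := 0) hR0
      (by simpa using hz) hgz (B := κ * (1 + Real.log (1 + 2 * R))) (fun t ht => by
        have hst : s ≤ t := by linarith [ht.1]
        exact (hs.mono hst).outer_circle_subset.trans
          (closedRegion_subset_Omega (hs0.trans_le hst))) (fun t ht => by
        have hst : s ≤ t := by linarith [ht.1]
        refine ((circleAverage_zero_le_bdryAvg (c := c) fun _ => Real.posLog_nonneg).trans
          (hB _ hst)).trans (hmonoB (hs0.trans_le hst) ?_)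
        linarith [ht.2])
    rw [← mul_assoc] at h1
    exact le_mul_pow_of_log_le hR1 (norm_pos_iff.2 hgz) hm h1

/-- A quotient of holomorphic functions on the punctured plane for which all values on a circle and
the value `∞` have bounded counting functions is rational. -/
theorem exists_rational_quotient {s K : ℝ} (hs : Separated c s) {p q : ℂ → ℂ}
    (hp : DifferentiableOn ℂ p (Omega c)) (hq : DifferentiableOn ℂ q (Omega c))
    (hpne : ∃ z ∈ Omega c, p z ≠ 0)
    (hpq : ∀ a : ℂ, ‖a‖ = 1 → ∃ z ∈ Omega c, p z + a * q z ≠ 0)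
    (hKp : ∀ t, s ≤ t → (weightCount c (analyticOrderNatAt p) t : ℝ) ≤ K)
    (hK : ∀ a : ℂ, ‖a‖ = 1 → ∀ t, s ≤ t →
      (weightCount c (analyticOrderNatAt fun z => p z + a * q z) t : ℝ) ≤ K) :
    ∃ A B : Polynomial ℂ, B ≠ 0 ∧ ∀ z ∈ Omega c, B.eval z * q z = A.eval z * p z := by
  classical
  by_cases hqne : ∃ z ∈ Omega c, q z ≠ 0
  swap
  · push Not at hqne
    exact ⟨0, 1, one_ne_zero, fun z hz => by simp [hqne z hz]⟩
  have hordp := order_ne_top_Omega hp hpne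
  have hfin := finite_of_weightCount_le hs (locallyFiniteWeight_order hp hpne) hKp
  set Z := hfin.toFinset with hZdef
  obtain ⟨G, hG, hGZ, hpG⟩ := exists_factor_zeros (isOpen_Omega c) Z hp
    (fun a ha => (hfin.mem_toFinset.1 ha).1) hordp
  have hG0 : ∀ z ∈ Omega c, G z ≠ 0 := by
    intro z hz h0
    refine hGZ z (hfin.mem_toFinset.2 ⟨hz, ?_⟩) h0
    rw [order_natAt_ne_zero_iff (isOpen_Omega c) hp hordp hz, hpG z hz, h0, mul_zero]
  -- `G` is `p` without its finitely many zeros, so `g` is holomorphic. It is `q / p` times a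
  -- polynomial, hence its `posLog` is at most `log max(‖p‖, ‖q‖) - log ‖p‖` plus a multiple of `log
  -- (1 + T)` and a constant; the bounded counts control the mean of the first term.
  set g : ℂ → ℂ := fun z => q z / G z with hgdef
  have hg : DifferentiableOn ℂ g (Omega c) := hq.div hG hG0
  have hgne : ∃ z ∈ Omega c, g z ≠ 0 := by
    obtain ⟨z, hz, h⟩ := hqne
    exact ⟨z, hz, div_ne_zero h (hG0 z hz)⟩
  obtain ⟨C, hC, D, hprod⟩ := exists_norm_prod_le Z id (analyticOrderNatAt p)
  set P0 := bdryAvg c (fun z => Real.log ‖p z‖) s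
  set A0 := bdryAvg c (fun z => Real.log (max ‖p z‖ ‖q z‖)) s
  have hK0 : 0 ≤ K := (Nat.cast_nonneg _).trans (hKp s le_rfl)
  set κ := |A0 - P0| + K * (1 + |Real.log s|) + (M + 1) * (Real.log C + D) with hκ
  have hlC : 0 ≤ Real.log C := Real.log_nonneg hC
  have hκ0 : 0 ≤ κ := by positivity
  have hB : ∀ T, s ≤ T →
      bdryAvg c (fun w => Real.posLog ‖g w‖) T ≤ κ * (1 + Real.log (1 + T)) := by
    intro T hT
    have hsT := hs.mono hT
    have hT0 := hsT.pos
    have hi1 := bdryIntegrable_log_max hsT hp hq hpne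
    have hi2 := bdryIntegrable_log_norm_of_differentiableOn hsT hp
    have h1 : bdryAvg c (fun w => Real.posLog ‖g w‖) T ≤
        bdryAvg c (fun z => (Real.log (max ‖p z‖ ‖q z‖) - Real.log ‖p z‖) +
          (Real.log C + D * Real.log (1 + T))) T := by
      refine bdryAvg_mono hT0 (bdryIntegrable_posLog hsT hg)
        ((hi1.sub hi2).add (bdryIntegrable_const _))
        (countable_zeros_inter_closedRegion hT0 hp hpne) ?_
      intro z hz hz0
      have hzr : z ∈ closedRegion c T := by
        rcases hz with hz | ⟨j, hz⟩
        · exact hsT.outer_circle_subset hz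
        · exact hsT.inner_circle_subset j hz
      have hzO := closedRegion_subset_Omega hT0 hzr
      have hpz : p z ≠ 0 := fun h => hz0 ⟨hzr, h⟩
      have hpz' : 0 < ‖p z‖ := norm_pos_iff.2 hpz
      have e : ‖g z‖ = (‖q z‖ / ‖p z‖) * ‖∏ a ∈ Z, (z - id a) ^ analyticOrderNatAt p a‖ := by
        rw [← norm_div, ← norm_mul]
        congr 1
        have h2 := hpG z hzO
        have h3 := hG0 z hzO
        simp only [hgdef, id]
        rw [div_mul_eq_mul_div, div_eq_div_iff h3 hpz, h2]
        ring
      rw [e]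
      refine Real.posLog_mul.trans (add_le_add ?_ ?_)
      · rw [Real.posLog_apply, ← Real.log_div (lt_max_of_lt_left hpz').ne' hpz'.ne']
        refine max_le (Real.log_nonneg ?_) ?_
        · rw [one_le_div hpz']; exact le_max_left _ _
        · rcases eq_or_ne (‖q z‖) 0 with h | h
          · rw [h]
            simp only [zero_div, Real.log_zero]
            refine Real.log_nonneg ?_
            rw [one_le_div hpz']; exact le_max_left _ _
          · have : 0 < ‖q z‖ := lt_of_le_of_ne (norm_nonneg _) h.symm
            refine Real.log_le_log (by positivity) ?_
            gcongr
            exact le_max_right _ _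
      · have hb := hprod z
        have hzT : 1 ≤ 1 + T := by linarith
        calc Real.posLog ‖∏ a ∈ Z, (z - id a) ^ analyticOrderNatAt p a‖
            ≤ Real.posLog (C * (1 + T) ^ D) := by
              refine Real.posLog_le_posLog (norm_nonneg _) (hb.trans ?_)
              gcongr
              exact hzr.1
          _ = Real.log (C * (1 + T) ^ D) := by
              rw [Real.posLog_eq_log]
              rw [abs_of_nonneg (by positivity)]
              exact one_le_mul_of_one_le_of_one_le hC (one_le_pow₀ hzT)
          _ = _ := by rw [Real.log_mul (by positivity) (by positivity), Real.log_pow]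
    rw [bdryAvg_add (hi1.sub hi2) (bdryIntegrable_const _), bdryAvg_sub hi1 hi2,
      bdryAvg_const] at h1
    have h2 := bdryAvg_log_max_le_of_weightCount_le hs hp hq hpne hpq hK hT
    have h3 := bdryAvg_log_norm_mono hs hT hp hpne
    have hl : 0 ≤ Real.log (1 + T) := Real.log_nonneg (by linarith)
    have h4 : K * Real.log (T / s) ≤ K * ((1 + |Real.log s|) * (1 + Real.log (1 + T))) := by
      refine mul_le_mul_of_nonneg_left ?_ hK0
      rw [Real.log_div hT0.ne' hs.pos.ne']
      have : Real.log T ≤ Real.log (1 + T) := Real.log_le_log hT0 (by linarith)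
      nlinarith [neg_abs_le (Real.log s), abs_nonneg (Real.log s),
        mul_nonneg (abs_nonneg (Real.log s)) hl]
    have h5 : A0 - P0 ≤ |A0 - P0| * (1 + Real.log (1 + T)) := by
      nlinarith [le_abs_self (A0 - P0), abs_nonneg (A0 - P0)]
    have h6 : ((M : ℝ) + 1) * (Real.log C + D * Real.log (1 + T)) ≤
        (M + 1) * ((Real.log C + D) * (1 + Real.log (1 + T))) := by
      refine mul_le_mul_of_nonneg_left ?_ (by positivity)
      nlinarith [mul_nonneg hlC hl, Nat.cast_nonneg (α := ℝ) D]
    rw [hκ]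
    nlinarith
  obtain ⟨C', m, hpole, hgr⟩ := exists_growth_of_bdryAvg_posLog_le hs hg hgne hκ0 hB
  have hOm : ((Finset.univ.image c : Finset ℂ) : Set ℂ)ᶜ = Omega c := by
    simp [Omega]
  obtain ⟨P, hP⟩ := exists_polynomial_of_growth (Z := Finset.univ.image c) (g := g)
    (by rw [hOm]; exact hg) (C := C') (k := m) (by simpa using hpole) hgr
  refine ⟨P, (∏ a ∈ Finset.univ.image c, (Polynomial.X - Polynomial.C a) ^ (m + 2)) *
    ∏ a ∈ Z, (Polynomial.X - Polynomial.C a) ^ analyticOrderNatAt p a, ?_, fun z hz => ?_⟩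
  · refine mul_ne_zero ?_ ?_ <;>
    exact Finset.prod_ne_zero_iff.2 fun a _ => pow_ne_zero _ (Polynomial.X_sub_C_ne_zero a)
  · have h1 := hP z (by rw [← hOm] at hz; exact hz)
    have h2 := hpG z hz
    have h3 : q z = g z * G z := by rw [hgdef]; exact (div_mul_cancel₀ _ (hG0 z hz)).symm
    rw [← h1, h2, h3]
    simp only [Polynomial.eval_mul, Polynomial.eval_prod, Polynomial.eval_pow, Polynomial.eval_sub,
      Polynomial.eval_X, Polynomial.eval_C]
    ring

end PuncturedPlane

end

/-! ### Rational quotients contradict nondegeneracy. -/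

section

open Set Filter Topology Metric

namespace PuncturedPlane

/-- Three polynomials in one variable satisfy a homogeneous algebraic relation. -/
theorem exists_homogeneous_relation (p : Fin 3 → Polynomial ℂ) :
    ∃ (e : ℕ) (R : MvPolynomial (Fin 3) ℂ), R.IsHomogeneous e ∧ R ≠ 0 ∧
      ∀ z, MvPolynomial.eval (fun k => (p k).eval z) R = 0 := by
  -- Three elements of a ring of transcendence degree two are algebraically dependent. The extra
  -- variable, common to all of them, is a scaling parameter that allows a homogeneous relation to
  -- be extracted.
  set x : Fin 3 → MvPolynomial (Fin 2) ℂ := fun k =>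
    MvPolynomial.X 0 * Polynomial.aeval (MvPolynomial.X 1) (p k) with hx
  have hdep : ¬ AlgebraicIndependent ℂ x := fun h => by
    have := h.cardinalMk_le_trdeg
    simp only [MvPolynomial.trdeg_of_isDomain, Cardinal.mk_fin, Cardinal.lift_natCast,
      Nat.cast_le] at this
    omega
  rw [algebraicIndependent_iff] at hdep
  push Not at hdep
  obtain ⟨R, hR, hR0⟩ := hdep
  have hev : ∀ t z : ℂ, MvPolynomial.eval (t • fun k => (p k).eval z) R = 0 := by
    intro t z
    have h1 := congrArg (MvPolynomial.aeval (![t, z] : Fin 2 → ℂ)) hR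
    rw [map_zero, MvPolynomial.comp_aeval_apply] at h1
    rw [← MvPolynomial.coe_aeval_eq_eval]
    refine Eq.trans ?_ h1
    refine congrArg (fun y => MvPolynomial.aeval y R) (funext fun k => ?_)
    simp only [hx, map_mul, MvPolynomial.aeval_X, ← Polynomial.aeval_algHom_apply, Pi.smul_apply,
      smul_eq_mul, Matrix.cons_val_zero, Matrix.cons_val_one, Polynomial.coe_aeval_eq_eval]
  obtain ⟨e, he⟩ : ∃ e, MvPolynomial.homogeneousComponent e R ≠ 0 := by
    by_contra! h
    exact hR0 (by rw [← MvPolynomial.sum_homogeneousComponent R]; simp [h])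
  refine ⟨e, _, MvPolynomial.homogeneousComponent_isHomogeneous e R, he, fun z => ?_⟩
  set y : Fin 3 → ℂ := fun k => (p k).eval z
  -- As a polynomial in the scaling `t`, the relation vanishes identically; its coefficients are the
  -- values of the homogeneous components.
  set q : Polynomial ℂ := ∑ k ∈ Finset.range (R.totalDegree + 1),
    Polynomial.C (MvPolynomial.eval y (MvPolynomial.homogeneousComponent k R)) * Polynomial.X ^ k
    with hq
  have hq0 : q = 0 := by
    refine Polynomial.funext fun t => ?_
    have h1 := hev t z
    rw [← MvPolynomial.sum_homogeneousComponent R, map_sum] at h1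
    rw [hq, Polynomial.eval_finsetSum, Polynomial.eval_zero, ← h1]
    refine Finset.sum_congr rfl fun k _ => ?_
    rw [eval_smul_of_isHomogeneous (N := 2) (MvPolynomial.homogeneousComponent_isHomogeneous k R)]
    simp only [Polynomial.eval_mul, Polynomial.eval_C, Polynomial.eval_pow, Polynomial.eval_X]
    ring
  by_cases hek : e ∈ Finset.range (R.totalDegree + 1)
  · have h1 := congrArg (fun q => Polynomial.coeff q e) hq0
    simp only [hq, Polynomial.finsetSum_coeff, Polynomial.coeff_C_mul_X_pow, Polynomial.coeff_zero]
      at h1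
    rwa [Finset.sum_ite_eq, if_pos hek] at h1
  · refine absurd (MvPolynomial.homogeneousComponent_eq_zero _ _ ?_) he
    simp at hek
    omega

variable {M N : ℕ} {c : Fin M → ℂ} {f : ℂ → Fin (N + 1) → ℂ}

theorem infinite_Omega (c : Fin M → ℂ) : (Omega c).Infinite :=
  (Set.finite_range c).infinite_compl

/-- For `N = 1` a rational quotient makes the curve rational. For `N ≥ 2` the coordinates `f 0`, `f
1`, `f 2` become proportional to polynomials on clearing denominators; a homogeneous relation
between these polynomials holds along `f`, against nondegeneracy. -/
theorem not_forall_rational (hN : 1 ≤ N) (hf : IsHolomorphicCurve c f)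
    (hnd : IsAlgebraicallyNondegenerate c f) (hrat : N = 1 → ¬ IsRationalCurve c f) :
    ¬ ∀ i : Fin N, ∃ A B : Polynomial ℂ, B ≠ 0 ∧
      ∀ z ∈ Omega c, B.eval z * f z i.succ = A.eval z * f z 0 := by
  intro h
  rcases hN.eq_or_lt with rfl | hN2
  · obtain ⟨A, B, hB, hAB⟩ := h 0
    refine hrat rfl ⟨![B, A], fun h0 => hB (congrFun h0 0), fun z hz i j => ?_⟩
    have := hAB z hz
    rw [Fin.succ_zero_eq_one] at this
    fin_cases i <;> fin_cases j <;>
      first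
      | rfl
      | (simp; linear_combination this)
      | (simp; linear_combination -this)
  · obtain ⟨A₀, B₀, hB₀, h₀⟩ := h ⟨0, by omega⟩
    obtain ⟨A₁, B₁, hB₁, h₁⟩ := h ⟨1, by omega⟩
    set ι : Fin 3 → Fin (N + 1) := Fin.castLE (by omega) with hι
    obtain ⟨e, R, hR, hR0, hRp⟩ := exists_homogeneous_relation ![B₀ * B₁, A₀ * B₁, B₀ * A₁]
    obtain ⟨w, hw, hwR⟩ := exists_eval_ne_zero hnd (P := MvPolynomial.rename ι R)
      hR.rename_isHomogeneous ((MvPolynomial.rename_injective ι (Fin.castLE_injective _)).ne_iff'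
        (map_zero _) |>.2 hR0)
    have hmul : ∀ z ∈ Omega c,
        ((B₀ * B₁) ^ e).eval z * MvPolynomial.eval (f z) (MvPolynomial.rename ι R) = 0 := by
      intro z hz
      have e0 := h₀ z hz
      have e1 := h₁ z hz
      have hvec : ((B₀ * B₁).eval z) • (f z ∘ ι) =
          (f z 0) • fun k => ((![B₀ * B₁, A₀ * B₁, B₀ * A₁] : Fin 3 → Polynomial ℂ) k).eval z := by
        funext k
        have i0 : ι 0 = 0 := rfl
        have i1 : ι 1 = Fin.succ ⟨0, by omega⟩ := rfl
        have i2 : ι 2 = Fin.succ ⟨1, by omega⟩ := rfl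
        fin_cases k
        · simp [i0]; ring
        · simp only [Fin.mk_one, Pi.smul_apply, Function.comp_apply, i1, smul_eq_mul,
            Polynomial.eval_mul, Matrix.cons_val_one, Matrix.cons_val_zero]
          linear_combination B₁.eval z * e0
        · simp only [Fin.reduceFinMk, Pi.smul_apply, Function.comp_apply, i2, smul_eq_mul,
            Polynomial.eval_mul, Matrix.cons_val]
          linear_combination B₀.eval z * e1
      rw [MvPolynomial.eval_rename, Polynomial.eval_pow,
        ← eval_smul_of_isHomogeneous (N := 2) hR, hvec, eval_smul_of_isHomogeneous (N := 2) hR,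
        hRp, mul_zero]
    rcases AnalyticOnNhd.eq_zero_or_eq_zero_of_mul_eq_zero
      ((Polynomial.differentiable _).differentiableOn.analyticOnNhd (isOpen_Omega c))
      ((differentiableOn_eval hf _).analyticOnNhd (isOpen_Omega c)) hmul (isPreconnected_Omega c)
      with h2 | h2
    · have h3 := Polynomial.eq_zero_of_infinite_isRoot _ ((infinite_Omega c).mono fun z hz => h2 z hz)
      exact pow_ne_zero e (mul_ne_zero hB₀ hB₁) h3
    · exact hwR (h2 w hw)

end PuncturedPlane

end

/-! ### Growth of the characteristic function. -/

section

open Set Filter Topology Metric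

namespace PuncturedPlane

variable {M N : ℕ} {c : Fin M → ℂ} {f : ℂ → Fin (N + 1) → ℂ}

theorem characteristic_eq_bdryAvg (r : ℝ) :
    characteristic c f r = bdryAvg c (fun z => Real.log ‖f z‖) r := rfl

theorem exists_norm_apply_eq (x : Fin (N + 1) → ℂ) : ∃ k, ‖x k‖ = ‖x‖ := by
  obtain ⟨k, hk⟩ := Finite.exists_max fun k => ‖x k‖
  exact ⟨k, le_antisymm (norm_le_pi_norm x k)
    ((pi_norm_le_iff_of_nonneg (norm_nonneg _)).2 hk)⟩

/-- One of the `N` maxima is at least `‖x‖`, the other `N - 1` are at least `‖x 0‖`. -/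
theorem log_norm_le_sum_log_max (hN : 1 ≤ N) {x : Fin (N + 1) → ℂ} (hx : x 0 ≠ 0) :
    Real.log ‖x‖ ≤ ∑ i : Fin N, Real.log (max ‖x 0‖ ‖x i.succ‖) - ((N : ℝ) - 1) * Real.log ‖x 0‖ := by
  have h0 : 0 < ‖x 0‖ := norm_pos_iff.2 hx
  have hxn : 0 < ‖x‖ := h0.trans_le (norm_le_pi_norm x 0)
  obtain ⟨i, hi⟩ : ∃ i : Fin N, ‖x‖ ≤ max ‖x 0‖ ‖x i.succ‖ := by
    obtain ⟨k, hk⟩ := exists_norm_apply_eq x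
    rw [← hk]
    induction k using Fin.cases with
    | zero => exact ⟨⟨0, hN⟩, le_max_left _ _⟩
    | succ i => exact ⟨i, le_max_right _ _⟩
  have h1 : ((Finset.univ.erase i).card : ℝ) * Real.log ‖x 0‖ ≤
      ∑ j ∈ Finset.univ.erase i, Real.log (max ‖x 0‖ ‖x j.succ‖) := by
    rw [← nsmul_eq_mul]
    exact Finset.card_nsmul_le_sum _ _ _ fun j _ => Real.log_le_log h0 (le_max_left _ _)
  rw [Finset.card_erase_of_mem (Finset.mem_univ i), Finset.card_univ, Fintype.card_fin,
    Nat.cast_sub hN, Nat.cast_one] at h1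
  rw [← Finset.add_sum_erase _ _ (Finset.mem_univ i)]
  have h2 : Real.log ‖x‖ ≤ Real.log (max ‖x 0‖ ‖x i.succ‖) := Real.log_le_log hxn hi
  linarith

theorem exists_coord_ne_zero (hnd : IsAlgebraicallyNondegenerate c f) (k : Fin (N + 1)) :
    ∃ z ∈ Omega c, f z k ≠ 0 := by
  simpa using exists_eval_ne_zero hnd (MvPolynomial.isHomogeneous_X ℂ k) (MvPolynomial.X_ne_zero k)

theorem exists_coord_add_mul_ne_zero (hnd : IsAlgebraicallyNondegenerate c f) (i : Fin N) (a : ℂ) :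
    ∃ z ∈ Omega c, f z 0 + a * f z i.succ ≠ 0 := by
  have hh : (MvPolynomial.X 0 + MvPolynomial.C a * MvPolynomial.X i.succ :
      MvPolynomial (Fin (N + 1)) ℂ).IsHomogeneous 1 := by
    refine (MvPolynomial.isHomogeneous_X ℂ 0).add ?_
    simpa using (MvPolynomial.isHomogeneous_C (Fin (N + 1)) a).mul
      (MvPolynomial.isHomogeneous_X ℂ i.succ)
  simpa using exists_eval_ne_zero hnd hh fun h => by
    simpa using congrArg (MvPolynomial.eval (Pi.single 0 1 : Fin (N + 1) → ℂ)) h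

theorem continuousOn_curve (hf : IsHolomorphicCurve c f) : ContinuousOn f (Omega c) :=
  continuousOn_pi.2 fun i => (hf.holomorphic i).continuousOn

theorem bdryIntegrable_log_norm_curve {t : ℝ} (ht : Separated c t) (hf : IsHolomorphicCurve c f)
    (hnd : IsAlgebraicallyNondegenerate c f) : BdryIntegrable c (fun z => Real.log ‖f z‖) t :=
  bdryIntegrable_log_of_norm_le ht (hf.holomorphic 0) (exists_coord_ne_zero hnd 0)
    ((continuousOn_curve hf).mono (closedRegion_subset_Omega ht.pos)).norm
    fun z _ => norm_le_pi_norm (f z) 0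

theorem bdryAvg_mono_of_ne_zero {t : ℝ} (ht : Separated c t) {u v : ℂ → ℝ}
    (hu : BdryIntegrable c u t) (hv : BdryIntegrable c v t) {F : ℂ → ℂ}
    (hF : DifferentiableOn ℂ F (Omega c)) (hne : ∃ z ∈ Omega c, F z ≠ 0)
    (h : ∀ z ∈ Omega c, (‖z‖ = t ∨ ∃ j, ‖z - c j‖ = 1 / t) → F z ≠ 0 → u z ≤ v z) :
    bdryAvg c u t ≤ bdryAvg c v t := by
  refine bdryAvg_mono ht.pos hu hv (countable_zeros_inter_closedRegion ht.pos hF hne) ?_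
  intro z hz hz0
  have hb : ‖z‖ = t ∨ ∃ j, ‖z - c j‖ = 1 / t := by
    simpa only [mem_sphere, dist_eq_norm, sub_zero] using hz
  have hzr := ht.closedRegion_of_mem_sphere hb
  exact h z (closedRegion_subset_Omega ht.pos hzr) hb fun h0 => hz0 ⟨hzr, h0⟩

/-- A monotone function comparable with the characteristic. -/
theorem exists_growth_function (hN : 1 ≤ N) {r₀ : ℝ} (h₀ : Separated c r₀)
    (hf : IsHolomorphicCurve c f) (hnd : IsAlgebraicallyNondegenerate c f) :
    ∃ (S : ℝ → ℝ) (A : ℝ), 0 ≤ A ∧ MonotoneOn S (Ici r₀) ∧ (∀ t ∈ Ici r₀, 1 ≤ S t) ∧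
      (∀ t, r₀ ≤ t → characteristic c f t ≤ A * S t) ∧
      ∀ t, r₀ ≤ t → S t ≤ N * characteristic c f t + A := by
  set u : Fin N → ℂ → ℝ := fun i z => Real.log (max ‖f z 0‖ ‖f z i.succ‖) with hu
  -- Each summand is monotone by Cartan's formula, which applies to a pair of functions. The sum
  -- dominates `T` up to a constant and is at most `N T`.
  set σ : ℝ → ℝ := fun t => ∑ i, bdryAvg c (u i) t with hσ
  have hne0 := exists_coord_ne_zero hnd 0
  have hmono : MonotoneOn σ (Ici r₀) := fun s hs t _ hst =>
    Finset.sum_le_sum fun i _ => bdryAvg_log_max_mono (h₀.mono hs) hst (hf.holomorphic 0)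
      (hf.holomorphic i.succ) hne0 fun a _ => exists_coord_add_mul_ne_zero hnd i a
  have hui : ∀ t, r₀ ≤ t → ∀ i ∈ Finset.univ, BdryIntegrable c (u i) t := fun t ht i _ =>
    bdryIntegrable_log_max (h₀.mono ht) (hf.holomorphic 0) (hf.holomorphic i.succ) hne0
  set b := bdryAvg c (fun z => Real.log ‖f z 0‖) r₀
  have h1 : ∀ t, r₀ ≤ t → characteristic c f t ≤ σ t - (N - 1) * b := by
    intro t ht
    have hs := h₀.mono ht
    have hi0 := bdryIntegrable_log_norm_of_differentiableOn hs (hf.holomorphic 0)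
    have h2 := bdryAvg_mono_of_ne_zero hs (bdryIntegrable_log_norm_curve hs hf hnd)
      ((BdryIntegrable.sum (hui t ht)).sub (hi0.const_mul ((N : ℝ) - 1))) (hf.holomorphic 0) hne0
      fun z _ _ hz0 => log_norm_le_sum_log_max hN hz0
    rw [bdryAvg_sub (BdryIntegrable.sum (hui t ht)) (hi0.const_mul _), bdryAvg_sum (hui t ht),
      bdryAvg_const_mul] at h2
    have h3 := bdryAvg_log_norm_mono h₀ ht (hf.holomorphic 0) hne0
    have hN' : (0 : ℝ) ≤ N - 1 := by rw [sub_nonneg]; exact_mod_cast hN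
    have := mul_le_mul_of_nonneg_left h3 hN'
    rw [characteristic_eq_bdryAvg]
    linarith
  have h2 : ∀ t, r₀ ≤ t → σ t ≤ N * characteristic c f t := by
    intro t ht
    have hs := h₀.mono ht
    rw [hσ, characteristic_eq_bdryAvg]
    have : ∀ i ∈ Finset.univ, bdryAvg c (u i) t ≤ bdryAvg c (fun z => Real.log ‖f z‖) t := by
      intro i hi
      refine bdryAvg_mono_of_ne_zero hs (hui t ht i hi) (bdryIntegrable_log_norm_curve hs hf hnd)
        (hf.holomorphic 0) hne0 fun z _ _ hz0 => ?_
      exact Real.log_le_log (lt_max_of_lt_left (norm_pos_iff.2 hz0))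
        (max_le (norm_le_pi_norm _ _) (norm_le_pi_norm _ _))
    simpa using Finset.sum_le_card_nsmul _ _ _ this
  refine ⟨fun t => σ t - σ r₀ + 1, 1 + |σ r₀ - 1 - (N - 1) * b| + |1 - σ r₀|, by positivity, ?_, ?_,
    fun t ht => ?_, fun t ht => ?_⟩
  · intro s hs t ht hst
    have := hmono hs ht hst
    simp only
    linarith
  · intro t ht
    have := hmono self_mem_Ici ht ht
    simp only
    linarith
  · have h3 := h1 t ht
    have h4 := hmono self_mem_Ici ht ht
    set y := σ r₀ - 1 - (N - 1) * b
    set S := σ t - σ r₀ + 1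
    have hS : 1 ≤ S := by linarith
    have h5 : characteristic c f t ≤ S + y := by linarith
    nlinarith [le_abs_self y, abs_nonneg y, abs_nonneg (1 - σ r₀)]
  · have h3 := h2 t ht
    have h4 := le_abs_self (1 - σ r₀)
    have h5 := abs_nonneg (σ r₀ - 1 - (N - 1) * b)
    linarith

/-- If the count `w` at `t` exceeded `K`, the term `w log (r / t)` would outgrow `K log r + C`. A
bound for arbitrarily large `r` is therefore enough. -/
theorem weightCount_le_of_frequently {r₀ K C : ℝ} (h₀ : Separated c r₀) {m : ℂ → ℕ}
    (hm : LocallyFiniteWeight c m)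
    (h : ∃ᶠ r : ℝ in atTop, weightCounting c m r₀ r ≤ K * Real.log r + C) {t : ℝ} (ht : r₀ ≤ t) :
    (weightCount c m t : ℝ) ≤ K := by
  by_contra! hlt
  set w : ℝ := (weightCount c m t : ℝ)
  have hev : ∀ᶠ r : ℝ in atTop, w * Real.log t + C < (w - K) * Real.log r :=
    (Real.tendsto_log_atTop.const_mul_atTop (sub_pos.2 hlt)).eventually_gt_atTop _
  obtain ⟨r, hr, hr1, hr2⟩ := (h.and_eventually (hev.and (eventually_ge_atTop t))).exists
  have ht0 := (h₀.mono ht).pos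
  have h1 := weightCount_mul_log_le h₀ ht hr2 hm
  rw [Real.log_div (ht0.trans_le hr2).ne' ht0.ne'] at h1
  nlinarith

/-- The characteristic of an algebraically nondegenerate, non-rational curve dominates `log r`. -/
theorem eventually_mul_log_le_characteristic (hN : 1 ≤ N) {r₀ : ℝ} (h₀ : Separated c r₀)
    (hf : IsHolomorphicCurve c f) (hnd : IsAlgebraicallyNondegenerate c f)
    (hrat : N = 1 → ¬ IsRationalCurve c f) (K : ℝ) :
    ∀ᶠ r : ℝ in atTop, K * Real.log r ≤ characteristic c f r := by
  by_contra hcon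
  have hfreq : ∃ᶠ r : ℝ in atTop, characteristic c f r < K * Real.log r := by
    simpa only [Filter.Frequently, not_lt] using hcon
  -- By Jensen's formula the counting function of `F` is at most `T + O(1)`, so it is below `K log r
  -- + O(1)` for arbitrarily large `r`. The factor `2` leaves room for `f 0 + a f i` with `|a| = 1`.
  have key : ∀ F : ℂ → ℂ, DifferentiableOn ℂ F (Omega c) → (∃ z ∈ Omega c, F z ≠ 0) →
      (∀ z ∈ Omega c, ‖F z‖ ≤ 2 * ‖f z‖) → ∀ t, r₀ ≤ t →
      (weightCount c (analyticOrderNatAt F) t : ℝ) ≤ K := by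
    intro F hF hne hle t ht
    refine weightCount_le_of_frequently h₀ (locallyFiniteWeight_order hF hne)
      (C := (M + 1) * Real.log 2 - bdryAvg c (fun z => Real.log ‖F z‖) r₀) ?_ ht
    refine (hfreq.and_eventually (eventually_ge_atTop r₀)).mono ?_
    rintro r ⟨hr, hr0⟩
    have hs := h₀.mono hr0
    have hfi := bdryIntegrable_log_norm_curve hs hf hnd
    rw [weightCounting_order_eq h₀ hr0 hF hne]
    have h1 : bdryAvg c (fun z => Real.log ‖F z‖) r ≤
        bdryAvg c (fun z => Real.log 2 + Real.log ‖f z‖) r := by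
      refine bdryAvg_mono_of_ne_zero hs (bdryIntegrable_log_norm_of_differentiableOn hs hF)
        ((bdryIntegrable_const _).add hfi) hF hne fun z hz _ hz0 => ?_
      have hF0 : 0 < ‖F z‖ := norm_pos_iff.2 hz0
      have hf0 : 0 < ‖f z‖ := by linarith [hle z hz]
      rw [← Real.log_mul two_ne_zero hf0.ne']
      exact Real.log_le_log hF0 (hle z hz)
    rw [bdryAvg_add (bdryIntegrable_const _) hfi, bdryAvg_const, ← characteristic_eq_bdryAvg] at h1
    linarith
  refine not_forall_rational hN hf hnd hrat fun i => ?_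
  refine exists_rational_quotient h₀ (hf.holomorphic 0) (hf.holomorphic i.succ)
    (exists_coord_ne_zero hnd 0) (fun a _ => exists_coord_add_mul_ne_zero hnd i a) (K := K)
    (key _ (hf.holomorphic 0) (exists_coord_ne_zero hnd 0) fun z _ => ?_) fun a ha =>
      key _ ((hf.holomorphic 0).add ((hf.holomorphic i.succ).const_mul a))
        (exists_coord_add_mul_ne_zero hnd i a) fun z _ => ?_
  · linarith [norm_le_pi_norm (f z) 0, norm_nonneg (f z)]
  · refine (norm_add_le _ _).trans ?_
    rw [norm_mul, ha, one_mul]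
    linarith [norm_le_pi_norm (f z) 0, norm_le_pi_norm (f z) i.succ]

end PuncturedPlane

end

/-! ### First main theorem; vanishing orders of the Wronskian. -/

section

open Set Filter Topology Metric

namespace PuncturedPlane

variable {M N : ℕ} {c : Fin M → ℂ} {f : ℂ → Fin (N + 1) → ℂ}

theorem norm_pos_of_mem_Omega (hf : IsHolomorphicCurve c f) {z : ℂ} (hz : z ∈ Omega c) :
    0 < ‖f z‖ := by
  obtain ⟨i, hi⟩ := hf.no_common_zero z hz
  exact (norm_pos_iff.2 hi).trans_le (norm_le_pi_norm (f z) i)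

theorem exists_log_norm_eval_le {e : ℕ} {P : MvPolynomial (Fin (N + 1)) ℂ}
    (hP : P.IsHomogeneous e) :
    ∃ C : ℝ, 0 ≤ C ∧ ∀ x, MvPolynomial.eval x P ≠ 0 → 0 < ‖x‖ →
      Real.log ‖MvPolynomial.eval x P‖ ≤ e * Real.log ‖x‖ + C := by
  obtain ⟨C, hC, h⟩ := exists_norm_eval_le hP
  refine ⟨Real.log C, Real.log_nonneg hC, fun x hx hx0 => ?_⟩
  refine (Real.log_le_log (norm_pos_iff.2 hx) (h x)).trans ?_
  rw [Real.log_mul (by positivity) (by positivity), Real.log_pow]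
  linarith

/-- The first main theorem for a hypersurface. -/
theorem exists_weightCounting_eval_le {r₀ : ℝ} (h₀ : Separated c r₀) (hf : IsHolomorphicCurve c f)
    (hnd : IsAlgebraicallyNondegenerate c f) {e : ℕ} {P : MvPolynomial (Fin (N + 1)) ℂ}
    (hP : P.IsHomogeneous e) (hP0 : P ≠ 0) :
    ∃ C : ℝ, 0 ≤ C ∧ ∀ t, r₀ ≤ t →
      weightCounting c (analyticOrderNatAt fun z => MvPolynomial.eval (f z) P) r₀ t ≤
        e * characteristic c f t + C := by
  obtain ⟨B, -, hB⟩ := exists_log_norm_eval_le hP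
  have hF := differentiableOn_eval hf P
  have hne := exists_eval_ne_zero hnd hP hP0
  set F : ℂ → ℂ := fun z => MvPolynomial.eval (f z) P
  refine ⟨|(M + 1) * B - bdryAvg c (fun z => Real.log ‖F z‖) r₀|, abs_nonneg _, fun t ht => ?_⟩
  have hs := h₀.mono ht
  have hi := (bdryIntegrable_log_norm_curve hs hf hnd).const_mul (e : ℝ)
  have h1 : bdryAvg c (fun z => Real.log ‖F z‖) t ≤
      bdryAvg c (fun z => e * Real.log ‖f z‖ + B) t :=
    bdryAvg_mono_of_ne_zero hs (bdryIntegrable_log_norm_of_differentiableOn hs hF)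
      (hi.add (bdryIntegrable_const _)) hF hne
      fun z hz _ hz0 => hB _ hz0 (norm_pos_of_mem_Omega hf hz)
  rw [bdryAvg_add hi (bdryIntegrable_const _), bdryAvg_const_mul, bdryAvg_const,
    ← characteristic_eq_bdryAvg] at h1
  rw [weightCounting_order_eq h₀ ht hF hne]
  linarith [le_abs_self ((M + 1) * B - bdryAvg c (fun z => Real.log ‖F z‖) r₀)]

/-- If `x, y ≤ U` then `|x - y| ≤ 2U - x - y`. Here `U` is `e log ‖f‖` plus a constant, and Jensen's
formula bounds the means of `-x` and `-y` by constants. -/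
theorem exists_bdryAvg_abs_log_sub_log_le {r₀ : ℝ} (h₀ : Separated c r₀)
    (hf : IsHolomorphicCurve c f) (hnd : IsAlgebraicallyNondegenerate c f) {e : ℕ}
    {P Q : MvPolynomial (Fin (N + 1)) ℂ} (hP : P.IsHomogeneous e) (hP0 : P ≠ 0)
    (hQ : Q.IsHomogeneous e) (hQ0 : Q ≠ 0) :
    ∃ C : ℝ, 0 ≤ C ∧ ∀ t, r₀ ≤ t →
      bdryAvg c (fun z => |Real.log ‖MvPolynomial.eval (f z) P‖ -
        Real.log ‖MvPolynomial.eval (f z) Q‖|) t ≤ 2 * e * characteristic c f t + C := by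
  obtain ⟨B, hB0, hB⟩ := exists_log_norm_eval_le hP
  obtain ⟨B', hB0', hB'⟩ := exists_log_norm_eval_le hQ
  have hF := differentiableOn_eval hf P
  have hFne := exists_eval_ne_zero hnd hP hP0
  have hG := differentiableOn_eval hf Q
  have hGne := exists_eval_ne_zero hnd hQ hQ0
  set F : ℂ → ℂ := fun z => MvPolynomial.eval (f z) P with hFdef
  set G : ℂ → ℂ := fun z => MvPolynomial.eval (f z) Q with hGdef
  set y := (M + 1) * (2 * (B + B')) - bdryAvg c (fun z => Real.log ‖F z‖) r₀ -
    bdryAvg c (fun z => Real.log ‖G z‖) r₀ with hy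
  refine ⟨|y|, abs_nonneg _, fun t ht => ?_⟩
  have hs := h₀.mono ht
  have hi := (bdryIntegrable_log_norm_curve hs hf hnd).const_mul (2 * e : ℝ)
  have hiF := bdryIntegrable_log_norm_of_differentiableOn hs hF
  have hiG := bdryIntegrable_log_norm_of_differentiableOn hs hG
  have hic := hi.add (bdryIntegrable_const (c := c) (t := t) (2 * (B + B')))
  have h1 : bdryAvg c (fun z => |Real.log ‖F z‖ - Real.log ‖G z‖|) t ≤
      bdryAvg c (fun z => (2 * e * Real.log ‖f z‖ + 2 * (B + B')) - Real.log ‖F z‖ -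
        Real.log ‖G z‖) t := by
    refine bdryAvg_mono hs.pos (hiF.sub hiG).abs ((hic.sub hiF).sub hiG)
      ((countable_zeros_inter_closedRegion hs.pos hF hFne).union
        (countable_zeros_inter_closedRegion hs.pos hG hGne)) fun z hz hz0 => ?_
    have hzr := hs.closedRegion_of_mem_sphere (a := z)
      (by simpa only [mem_sphere, dist_eq_norm, sub_zero] using hz)
    have hzO := closedRegion_subset_Omega hs.pos hzr
    have h2 := hB (f z) (fun h => hz0 (Or.inl ⟨hzr, h⟩)) (norm_pos_of_mem_Omega hf hzO)
    have h3 := hB' (f z) (fun h => hz0 (Or.inr ⟨hzr, h⟩)) (norm_pos_of_mem_Omega hf hzO)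
    rw [abs_le]
    constructor <;> linarith
  rw [bdryAvg_sub (hic.sub hiF) hiG, bdryAvg_sub hic hiF, bdryAvg_add hi (bdryIntegrable_const _),
    bdryAvg_const_mul, bdryAvg_const, ← characteristic_eq_bdryAvg] at h1
  have h2 := bdryAvg_log_norm_mono h₀ ht hF hFne
  have h3 := bdryAvg_log_norm_mono h₀ ht hG hGne
  linarith [le_abs_self y]

theorem exists_growthControl {r₀ A : ℝ} {S : ℝ → ℝ} (hA : 0 ≤ A) (h₀ : Separated c r₀)
    (hS1 : ∀ t ∈ Ici r₀, 1 ≤ S t) (hT : ∀ t, r₀ ≤ t → characteristic c f t ≤ A * S t)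
    (hf : IsHolomorphicCurve c f) (hnd : IsAlgebraicallyNondegenerate c f) {e : ℕ}
    {P Q : MvPolynomial (Fin (N + 1)) ℂ} (hP : P.IsHomogeneous e) (hP0 : P ≠ 0)
    (hQ : Q.IsHomogeneous e) (hQ0 : Q ≠ 0) :
    ∃ A' : ℝ, 0 ≤ A' ∧ GrowthControl c r₀ A' S (fun z => MvPolynomial.eval (f z) P)
      fun z => MvPolynomial.eval (f z) Q := by
  obtain ⟨C₁, h₁, H₁⟩ := exists_weightCounting_eval_le h₀ hf hnd hP hP0
  obtain ⟨C₂, h₂, H₂⟩ := exists_weightCounting_eval_le h₀ hf hnd hQ hQ0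
  obtain ⟨C₃, h₃, H₃⟩ := exists_bdryAvg_abs_log_sub_log_le h₀ hf hnd hP hP0 hQ hQ0
  have he : (0 : ℝ) ≤ e := Nat.cast_nonneg e
  have heA := mul_nonneg he hA
  have key : ∀ t, r₀ ≤ t → e * characteristic c f t ≤ e * A * S t := fun t ht => by
    rw [mul_assoc]; exact mul_le_mul_of_nonneg_left (hT t ht) he
  have hCS : ∀ t, r₀ ≤ t → C₁ ≤ C₁ * S t ∧ C₂ ≤ C₂ * S t ∧ C₃ ≤ C₃ * S t := fun t ht =>
    ⟨le_mul_of_one_le_right h₁ (hS1 t ht), le_mul_of_one_le_right h₂ (hS1 t ht),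
      le_mul_of_one_le_right h₃ (hS1 t ht)⟩
  refine ⟨2 * (e * A) + C₁ + C₂ + C₃, by positivity, differentiableOn_eval hf P,
    differentiableOn_eval hf Q, exists_eval_ne_zero hnd hP hP0, exists_eval_ne_zero hnd hQ hQ0,
    fun t ht => ?_, fun t ht => ?_, fun t ht => ?_⟩
  all_goals
    obtain ⟨k1, k2, k3⟩ := hCS t ht
    have k4 := key t ht
    have k5 : 0 ≤ e * A * S t := mul_nonneg heA (zero_le_one.trans (hS1 t ht))
    have k6 : (2 * (e * A) + C₁ + C₂ + C₃) * S t =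
      2 * (e * A * S t) + C₁ * S t + C₂ * S t + C₃ * S t := by ring
    rw [k6]
  · linarith [H₃ t ht]
  · linarith [H₁ t ht]
  · linarith [H₂ t ht]

/-- A function `g k` that does not vanish at `z` contributes nothing and may be traded for the sum.
The Wronskian of the resulting `n + 1` functions is the same, and it vanishes at least to the total
excess of their orders over `n`. -/
theorem sum_order_le_order_wronskian_add {n : ℕ} {g : Fin (n + 1) → ℂ → ℂ} {z : ℂ}
    (hg : ∀ i, AnalyticAt ℂ (g i) z) (h0 : ∃ k, g k z ≠ 0)
    (hW : analyticOrderAt (wronskian g) z ≠ ⊤) :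
    ∑ i, analyticOrderNatAt (g i) z + analyticOrderNatAt (fun w => ∑ i, g i w) z ≤
      analyticOrderNatAt (wronskian g) z + (∑ i, min (analyticOrderNatAt (g i) z) n +
        min (analyticOrderNatAt (fun w => ∑ i, g i w) z) n) := by
  classical
  obtain ⟨k, hk⟩ := h0
  set s := analyticOrderNatAt (fun w => ∑ i, g i w) z
  set a : Fin (n + 1) → ℕ := fun i => analyticOrderNatAt (g i) z with ha
  have hak : a k = 0 := by
    simp only [ha, analyticOrderNatAt, (hg k).analyticOrderAt_eq_zero.2 hk, ENat.toNat_zero]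
  set g' := Function.update g k fun w => ∑ i, g i w with hg'
  have hgs : AnalyticAt ℂ (fun w => ∑ i, g i w) z :=
    Finset.analyticAt_fun_sum _ fun i _ => hg i
  have hga : ∀ i, AnalyticAt ℂ (g' i) z := by
    intro i
    rcases eq_or_ne i k with rfl | h
    · simpa [hg'] using hgs
    · simpa [hg', Function.update_of_ne h] using hg i
  set m := Function.update a k s with hm
  have hma : ∀ i, (m i : ℕ∞) ≤ analyticOrderAt (g' i) z := by
    intro i
    rcases eq_or_ne i k with rfl | h
    · simp only [hm, hg', Function.update_self]
      exact ENat.natCast_toNat_le_self _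
    · simp only [hm, hg', Function.update_of_ne h]
      exact ENat.natCast_toNat_le_self _
  have hWg : analyticOrderAt (wronskian g') z = analyticOrderAt (wronskian g) z := by
    refine analyticOrderAt_congr ?_
    have : ∀ᶠ w in 𝓝 z, ∀ i, AnalyticAt ℂ (g i) w :=
      eventually_all.2 fun i => (hg i).eventually_analyticAt
    exact this.mono fun w hw => wronskian_update_sum hw k
  have h1 := sum_sub_le_analyticOrderAt_wronskian hga hma
  rw [hWg, ← Nat.cast_analyticOrderNatAt hW] at h1
  have h2 : ∑ i, (m i - n) ≤ analyticOrderNatAt (wronskian g) z := by exact_mod_cast h1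
  have e1 : ∑ i, a i + s = ∑ i, m i := by
    rw [← Finset.add_sum_erase _ _ (Finset.mem_univ k), ← Finset.add_sum_erase _ m
      (Finset.mem_univ k), hak, Finset.sum_congr rfl fun i hi => ?_]
    · simp only [hm, Function.update_self]
      rw [zero_add, add_comm]
    · simp [Function.update_of_ne (Finset.ne_of_mem_erase hi)]
  have e2 : ∑ i, min (a i) n + min s n = ∑ i, min (m i) n := by
    rw [← Finset.add_sum_erase _ _ (Finset.mem_univ k), ← Finset.add_sum_erase _ (fun i => min (m i) n)
      (Finset.mem_univ k), hak, Finset.sum_congr rfl fun i hi => ?_]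
    · simp only [hm, Function.update_self]
      rw [Nat.zero_min, zero_add, add_comm]
    · simp [Function.update_of_ne (Finset.ne_of_mem_erase hi)]
  rw [e1, e2]
  calc ∑ i, m i = ∑ i, ((m i - n) + min (m i) n) := by
        refine Finset.sum_congr rfl fun i _ => ?_
        omega
    _ = ∑ i, (m i - n) + ∑ i, min (m i) n := Finset.sum_add_distrib
    _ ≤ _ := by gcongr

/-- Otherwise the `P i (f)` are linearly dependent on an open set, hence on `Omega c` by the
identity theorem. Nondegeneracy makes this a relation between the forms `P i`, which are
independent. -/
theorem exists_wronskian_eval_ne_zero (hf : IsHolomorphicCurve c f)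
    (hnd : IsAlgebraicallyNondegenerate c f) {e : ℕ} (he : e ≠ 0)
    {P : Fin (N + 1) → MvPolynomial (Fin (N + 1)) ℂ} (hP : ∀ i, (P i).IsHomogeneous e)
    (h0 : ∀ x : Fin (N + 1) → ℂ, x ≠ 0 → ∃ i, MvPolynomial.eval x (P i) ≠ 0) :
    ∃ z ∈ Omega c, wronskian (fun i z => MvPolynomial.eval (f z) (P i)) z ≠ 0 := by
  by_contra! hW
  obtain ⟨a, ha, V, hVU, hVo, ⟨w, hw⟩, hV⟩ := exists_linear_relation_of_wronskian_eq_zero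
    (isOpen_Omega c) (infinite_Omega c).nonempty (fun i => differentiableOn_eval hf (P i)) hW
  set R := ∑ i, MvPolynomial.C (a i) * P i with hR
  have hRh : R.IsHomogeneous e := by
    refine MvPolynomial.IsHomogeneous.sum _ _ _ fun i _ => ?_
    simpa using (MvPolynomial.isHomogeneous_C (Fin (N + 1)) (a i)).mul (hP i)
  obtain ⟨z, hz, hRz⟩ := exists_eval_ne_zero hnd hRh fun h =>
    ha (eq_zero_of_linear_relation hP he h0 h)
  refine hRz (((differentiableOn_eval hf R).analyticOnNhd
    (isOpen_Omega c)).eqOn_zero_of_preconnected_of_eventuallyEq_zero (isPreconnected_Omega c)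
    (hVU hw) ?_ hz)
  filter_upwards [hVo.mem_nhds hw] with y hy
  simpa [hR] using hV y hy

end PuncturedPlane

end

/-! ### The second main theorem. -/

section

open Set Filter Topology Metric

namespace PuncturedPlane

variable {M N : ℕ} {c : Fin M → ℂ} {f : ℂ → Fin (N + 1) → ℂ}

theorem locallyFiniteWeight_min {F : ℂ → ℂ} (hF : DifferentiableOn ℂ F (Omega c))
    (hne : ∃ z ∈ Omega c, F z ≠ 0) (n : ℕ) :
    LocallyFiniteWeight c fun z => min (analyticOrderNatAt F z) n :=
  locallyFiniteWeight_mono (locallyFiniteWeight_order hF hne) fun z _ h h' => h (by simp [h'])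

theorem weightCounting_le_wronskian {r₀ r : ℝ} (h₀ : Separated c r₀) (hr : r₀ ≤ r) {n : ℕ}
    {g : Fin (n + 1) → ℂ → ℂ} (hg : ∀ i, DifferentiableOn ℂ (g i) (Omega c))
    (hne : ∀ i, ∃ z ∈ Omega c, g i z ≠ 0) (hs : ∃ z ∈ Omega c, ∑ i, g i z ≠ 0)
    (h0 : ∀ z ∈ Omega c, ∃ k, g k z ≠ 0) (hWd : DifferentiableOn ℂ (wronskian g) (Omega c))
    (hW : ∃ z ∈ Omega c, wronskian g z ≠ 0) :
    ∑ i, weightCounting c (analyticOrderNatAt (g i)) r₀ r +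
        weightCounting c (analyticOrderNatAt fun w => ∑ i, g i w) r₀ r ≤
      weightCounting c (analyticOrderNatAt (wronskian g)) r₀ r +
        (∑ i, weightCounting c (fun z => min (analyticOrderNatAt (g i) z) n) r₀ r +
          weightCounting c (fun z => min (analyticOrderNatAt (fun w => ∑ i, g i w) z) n) r₀ r) := by
  have hgs : DifferentiableOn ℂ (fun w => ∑ i, g i w) (Omega c) :=
    DifferentiableOn.fun_sum fun i _ => hg i
  let m : Option (Fin (n + 1)) → ℂ → ℕ := fun o =>
    o.elim (analyticOrderNatAt fun w => ∑ i, g i w) fun i => analyticOrderNatAt (g i)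
  let m' : Option (Option (Fin (n + 1))) → ℂ → ℕ := fun o =>
    o.elim (analyticOrderNatAt (wronskian g)) fun o z => min (m o z) n
  have h := sum_weightCounting_le (c := c) (I := Finset.univ) (J := Finset.univ) (m := m) (m' := m')
    h₀ hr ?_ ?_ ?_
  · simp only [Fintype.sum_option] at h
    simp only [m, m', Option.elim] at h
    linarith
  · rintro (_ | i) -
    · exact locallyFiniteWeight_order hgs hs
    · exact locallyFiniteWeight_order (hg i) (hne i)
  · rintro (_ | _ | i) -
    · exact locallyFiniteWeight_order hWd hW
    · exact locallyFiniteWeight_min hgs hs n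
    · exact locallyFiniteWeight_min (hg i) (hne i) n
  · intro z hz
    have := sum_order_le_order_wronskian_add (fun i => (hg i).analyticOnNhd (isOpen_Omega c) z hz)
      (h0 z hz) (order_ne_top_Omega hWd hW z hz)
    simp only [Fintype.sum_option]
    simp only [m, m', Option.elim]
    omega

/-- A vanishing form would itself be a nontrivial linear relation. -/
theorem ne_zero_of_no_common_zero {e : ℕ} {P : Fin (N + 1) → MvPolynomial (Fin (N + 1)) ℂ}
    (hP : ∀ i, (P i).IsHomogeneous e) (he : e ≠ 0)
    (h0 : ∀ x : Fin (N + 1) → ℂ, x ≠ 0 → ∃ i, MvPolynomial.eval x (P i) ≠ 0) (i : Fin (N + 1)) :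
    P i ≠ 0 := by
  classical
  intro h
  have : (Pi.single i 1 : Fin (N + 1) → ℂ) = 0 := by
    refine eq_zero_of_linear_relation hP he h0 (Finset.sum_eq_zero fun j _ => ?_)
    rcases eq_or_ne j i with rfl | hj
    · rw [h, mul_zero]
    · rw [Pi.single_eq_of_ne hj, map_zero, zero_mul]
  simpa using congrFun this i

/-- The second main theorem for hypersurfaces of equal degree without common point, and their sum,
with counting functions truncated to level `N`. -/
theorem second_main_theorem {r₀ A : ℝ} {S : ℝ → ℝ} (hA : 0 ≤ A) (h₀ : Separated c r₀)
    (hS : MonotoneOn S (Ici r₀)) (hS1 : ∀ t ∈ Ici r₀, 1 ≤ S t)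
    (hT : ∀ t, r₀ ≤ t → characteristic c f t ≤ A * S t)
    (hf : IsHolomorphicCurve c f) (hnd : IsAlgebraicallyNondegenerate c f) {e : ℕ} (he : e ≠ 0)
    {P : Fin (N + 1) → MvPolynomial (Fin (N + 1)) ℂ} (hP : ∀ i, (P i).IsHomogeneous e)
    (h0 : ∀ x : Fin (N + 1) → ℂ, x ≠ 0 → ∃ i, MvPolynomial.eval x (P i) ≠ 0) :
    ∃ C : ℝ, 0 ≤ C ∧ ∀ r, r₀ + 1 ≤ r → 2 ≤ r → S (r + 1 / S r) ≤ 2 * S r →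
      e * characteristic c f r ≤
        ∑ i, weightCounting c (fun z => min
          (analyticOrderNatAt (fun w => MvPolynomial.eval (f w) (P i)) z) N) r₀ r +
        weightCounting c (fun z => min
          (analyticOrderNatAt (fun w => MvPolynomial.eval (f w) (∑ i, P i)) z) N) r₀ r +
        C * (Real.log r + Real.log (S r) + 1) := by
  classical
  have hPne := ne_zero_of_no_common_zero hP he h0
  have hsumne : ∑ i, P i ≠ 0 := by
    intro h
    have : (1 : Fin (N + 1) → ℂ) = 0 := eq_zero_of_linear_relation hP he h0 (by simpa using h)
    exact one_ne_zero this
  have hsumh : (∑ i, P i).IsHomogeneous e := MvPolynomial.IsHomogeneous.sum _ _ _ fun i _ => hP i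
  set g : Fin (N + 1) → ℂ → ℂ := fun i z => MvPolynomial.eval (f z) (P i) with hgdef
  have hgsum : (fun z => MvPolynomial.eval (f z) (∑ i, P i)) = fun z => ∑ i, g i z := by
    funext z
    rw [map_sum]
  have hg : ∀ i, DifferentiableOn ℂ (g i) (Omega c) := fun i => differentiableOn_eval hf (P i)
  have hgne : ∀ i, ∃ z ∈ Omega c, g i z ≠ 0 := fun i => exists_eval_ne_zero hnd (hP i) (hPne i)
  have hsd : DifferentiableOn ℂ (fun z => ∑ i, g i z) (Omega c) :=
    DifferentiableOn.fun_sum fun i _ => hg i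
  have hsne : ∃ z ∈ Omega c, ∑ i, g i z ≠ 0 := by
    simpa only [map_sum] using exists_eval_ne_zero hnd hsumh hsumne
  have hg0 : ∀ z ∈ Omega c, ∃ k, g k z ≠ 0 := fun z hz =>
    h0 (f z) (norm_pos_iff.1 (norm_pos_of_mem_Omega hf hz))
  have hWne := exists_wronskian_eval_ne_zero hf hnd he hP h0
  have hWd : DifferentiableOn ℂ (wronskian g) (Omega c) := fun z hz =>
    (analyticAt_wronskian fun i =>
      (hg i).analyticOnNhd (isOpen_Omega c) z hz).differentiableAt.differentiableWithinAt
  -- All logarithmic derivatives are compared with that of `g 0`: the quotients `g i / g 0` come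
  -- from forms of equal degree, so the mean of the absolute value of their logarithm is controlled
  -- by `T`.
  have hmaj : ∀ i, ∃ C : ℝ, 0 ≤ C ∧ ∀ r, r₀ + 1 ≤ r → 2 ≤ r → S (r + 1 / S r) ≤ 2 * S r →
      ∃ φ : ℂ → ℝ, BdryIntegrable c φ r ∧
        bdryAvg c φ r ≤ C * (Real.log r + Real.log (S r) + 1) ∧
        ∀ z ∈ Omega c, (‖z‖ = r ∨ ∃ j, ‖z - c j‖ = 1 / r) → g i z ≠ 0 → g 0 z ≠ 0 →
          Real.log (1 + ∑ k ∈ Finset.range N, ‖iteratedDeriv k (logDeriv (g i)) z -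
            iteratedDeriv k (logDeriv (g 0)) z‖) ≤ φ z := by
    intro i
    obtain ⟨A', hA', hctrl⟩ := exists_growthControl hA h₀ hS1 hT hf hnd (hP i) (hPne i) (hP 0)
      (hPne 0)
    exact exists_boundary_majorant_log_derivs N hA' h₀ hS hS1 hctrl
  obtain ⟨A', hA', hctrl⟩ := exists_growthControl hA h₀ hS1 hT hf hnd hsumh hsumne (hP 0) (hPne 0)
  rw [hgsum] at hctrl
  obtain ⟨C', hC', hmaj'⟩ := exists_boundary_majorant_log_derivs N hA' h₀ hS hS1 hctrl
  choose B hB hmaj using hmaj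
  obtain ⟨κ, hκ, hlow⟩ := exists_mul_norm_pow_le hP h0
  set L := Real.log ((N + 1).factorial * (2 ^ N ^ 2) ^ (N + 1)) with hL
  set y := ∑ i, bdryAvg c (fun z => Real.log ‖g i z‖) r₀ +
    bdryAvg c (fun z => Real.log ‖∑ i, g i z‖) r₀ - bdryAvg c (fun z => Real.log ‖wronskian g z‖) r₀
    + (M + 1) * L - (M + 1) * Real.log κ with hy
  have hBs : 0 ≤ ∑ i, B i := Finset.sum_nonneg fun i _ => hB i
  refine ⟨|y| + N * (∑ i, B i + C'), by positivity, fun r hr hr2 hSr => ?_⟩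
  have hr0 : r₀ ≤ r := by linarith
  have hs := h₀.mono hr0
  choose φ hφi hφ hφle using fun i => hmaj i r hr hr2 hSr
  obtain ⟨ψ, hψi, hψ, hψle⟩ := hmaj' r hr hr2 hSr
  have hif := (bdryIntegrable_log_norm_curve hs hf hnd).const_mul (e : ℝ)
  have hig : ∀ i ∈ Finset.univ, BdryIntegrable c (fun z => Real.log ‖g i z‖) r := fun i _ =>
    bdryIntegrable_log_norm_of_differentiableOn hs (hg i)
  have hisum := bdryIntegrable_log_norm_of_differentiableOn hs hsd
  have hiW := bdryIntegrable_log_norm_of_differentiableOn hs hWd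
  have hi1 := ((BdryIntegrable.sum hig).add hisum).sub hiW
  have hiφ : BdryIntegrable c (fun z => ∑ i, φ i z + ψ z) r :=
    (BdryIntegrable.sum fun i _ => hφi i).add hψi
  have hi2 := (bdryIntegrable_const (c := c) (t := r) L).add (hiφ.const_mul (N : ℝ))
  -- The index `k` with `|g k| ≥ κ ‖f‖ ^ e` varies with the point, but the right side is symmetric
  -- in the `g i` and does not involve `k`; so the inequality can be averaged.
  have havg : bdryAvg c (fun z => e * Real.log ‖f z‖ + Real.log κ) r ≤
      bdryAvg c (fun z => (∑ i, Real.log ‖g i z‖ + Real.log ‖∑ i, g i z‖ -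
        Real.log ‖wronskian g z‖) + (L + N * (∑ i, φ i z + ψ z))) r := by
    refine bdryAvg_mono hs.pos (hif.add (bdryIntegrable_const _)) (hi1.add hi2)
      (((countable_iUnion fun i => countable_zeros_inter_closedRegion hs.pos (hg i) (hgne i)).union
        (countable_zeros_inter_closedRegion hs.pos hsd hsne)).union
        (countable_zeros_inter_closedRegion hs.pos hWd hWne)) fun z hz hz0 => ?_
    have hb : ‖z‖ = r ∨ ∃ j, ‖z - c j‖ = 1 / r := by
      simpa only [mem_sphere, dist_eq_norm, sub_zero] using hz
    have hzr := hs.closedRegion_of_mem_sphere hb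
    have hzO := closedRegion_subset_Omega hs.pos hzr
    have hgz : ∀ i, g i z ≠ 0 := fun i h =>
      hz0 (Or.inl (Or.inl (mem_iUnion.2 ⟨i, hzr, h⟩)))
    have hsz : ∑ i, g i z ≠ 0 := fun h => hz0 (Or.inl (Or.inr ⟨hzr, h⟩))
    have hWz : wronskian g z ≠ 0 := fun h => hz0 (Or.inr ⟨hzr, h⟩)
    have hfz := norm_pos_of_mem_Omega hf hzO
    obtain ⟨k, hk⟩ := hlow (f z) (norm_pos_iff.1 hfz)
    have hga : ∀ i, AnalyticAt ℂ (g i) z := fun i =>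
      (hg i).analyticOnNhd (isOpen_Omega c) z hzO
    have h1 := log_norm_le_sum_sub_log_wronskian hga (hga 0) (hgz 0) hgz hsz hWz
      (fun i => le_rfl) le_rfl k
    have h2 : e * Real.log ‖f z‖ + Real.log κ ≤ Real.log ‖g k z‖ := by
      have := Real.log_le_log (by positivity) hk
      rw [Real.log_mul hκ.ne' (by positivity), Real.log_pow] at this
      linarith
    have h3 := Finset.sum_le_sum fun i (_ : i ∈ Finset.univ) => hφle i z hzO hb (hgz i) (hgz 0)
    have h4 := hψle z hzO hb hsz (hgz 0)
    have h5 := mul_le_mul_of_nonneg_left (add_le_add h3 h4) (Nat.cast_nonneg (α := ℝ) N)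
    linarith
  rw [bdryAvg_add hif (bdryIntegrable_const _), bdryAvg_const_mul, bdryAvg_const,
    ← characteristic_eq_bdryAvg, bdryAvg_add hi1 hi2, bdryAvg_sub ((BdryIntegrable.sum hig).add
      hisum) hiW, bdryAvg_add (BdryIntegrable.sum hig) hisum, bdryAvg_sum hig,
    bdryAvg_add (bdryIntegrable_const _) (hiφ.const_mul _), bdryAvg_const, bdryAvg_const_mul,
    bdryAvg_add (BdryIntegrable.sum fun i _ => hφi i) hψi, bdryAvg_sum fun i _ => hφi i] at havg
  have hcount := weightCounting_le_wronskian h₀ hr0 hg hgne hsne hg0 hWd hWne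
  have hJg : ∑ i, weightCounting c (analyticOrderNatAt (g i)) r₀ r =
      ∑ i, bdryAvg c (fun z => Real.log ‖g i z‖) r -
        ∑ i, bdryAvg c (fun z => Real.log ‖g i z‖) r₀ := by
    rw [← Finset.sum_sub_distrib]
    exact Finset.sum_congr rfl fun i _ => weightCounting_order_eq h₀ hr0 (hg i) (hgne i)
  have hJs := weightCounting_order_eq h₀ hr0 hsd hsne
  have hJW := weightCounting_order_eq h₀ hr0 hWd hWne
  have hlr : 0 ≤ Real.log r := Real.log_nonneg (by linarith)
  have hlS : 0 ≤ Real.log (S r) := Real.log_nonneg (hS1 r hr0)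
  set Λ := Real.log r + Real.log (S r) + 1
  have hφs : ∑ i, bdryAvg c (φ i) r + bdryAvg c ψ r ≤ (∑ i, B i + C') * Λ := by
    rw [add_mul, Finset.sum_mul]
    exact add_le_add (Finset.sum_le_sum fun i _ => hφ i) hψ
  have hφs' := mul_le_mul_of_nonneg_left hφs (Nat.cast_nonneg (α := ℝ) N)
  have hyΛ : y ≤ |y| * Λ := (le_abs_self y).trans
    (le_mul_of_one_le_right (abs_nonneg y) (by linarith))
  rw [hgsum]
  have hexp : (|y| + N * (∑ i, B i + C')) * Λ = |y| * Λ + N * ((∑ i, B i + C') * Λ) := by ring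
  rw [hexp]
  linarith

end PuncturedPlane

end

/-! ### Truncated counts of products; the error term. -/

section

open Set Filter Topology Metric

namespace PuncturedPlane

variable {M N : ℕ} {c : Fin M → ℂ} {f : ℂ → Fin (N + 1) → ℂ}

/-- Where `F` vanishes, the first term on the right is already at least `k`; elsewhere the product
and `G` have the same order. -/
theorem min_order_pow_mul_le {F G : ℂ → ℂ} {z : ℂ} (hF : AnalyticAt ℂ F z) (hG : AnalyticAt ℂ G z)
    (hF' : analyticOrderAt F z ≠ ⊤) (hG' : analyticOrderAt G z ≠ ⊤) (n k : ℕ) :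
    min (analyticOrderNatAt (fun w => F w ^ n * G w) z) k ≤
      k * analyticOrderNatAt F z + min (analyticOrderNatAt G z) k := by
  have h : analyticOrderNatAt (fun w => F w ^ n * G w) z =
      n * analyticOrderNatAt F z + analyticOrderNatAt G z := by
    have hFn : analyticOrderAt (F ^ n) z ≠ ⊤ := by
      rw [analyticOrderAt_pow hF, nsmul_eq_mul]
      exact WithTop.mul_ne_top (ENat.natCast_ne_top n) hF'
    refine (analyticOrderNatAt_mul (hF.pow n) hG hFn hG').trans ?_
    rw [analyticOrderNatAt_pow hF n, smul_eq_mul]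
  rw [h]
  rcases Nat.eq_zero_or_pos (analyticOrderNatAt F z) with h0 | h0
  · simp [h0]
  · exact (min_le_right _ _).trans ((Nat.le_mul_of_pos_right k h0).trans (Nat.le_add_right _ _))

theorem weightCounting_min_pow_mul_le {r₀ r : ℝ} (h₀ : Separated c r₀) (hr : r₀ ≤ r) {F G : ℂ → ℂ}
    (hF : DifferentiableOn ℂ F (Omega c)) (hG : DifferentiableOn ℂ G (Omega c)) {n : ℕ}
    (hFG : ∃ z ∈ Omega c, F z ^ n * G z ≠ 0) (hn : n ≠ 0) (k : ℕ) :
    weightCounting c (fun z => min (analyticOrderNatAt (fun w => F w ^ n * G w) z) k) r₀ r ≤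
      k * weightCounting c (analyticOrderNatAt F) r₀ r +
        weightCounting c (fun z => min (analyticOrderNatAt G z) k) r₀ r := by
  have hFne : ∃ z ∈ Omega c, F z ≠ 0 :=
    hFG.imp fun z h => ⟨h.1, fun h' => h.2 (by rw [h', zero_pow hn, zero_mul])⟩
  have hGne : ∃ z ∈ Omega c, G z ≠ 0 :=
    hFG.imp fun z h => ⟨h.1, fun h' => h.2 (by rw [h', mul_zero])⟩
  let m : Option (Fin k) → ℂ → ℕ := fun o =>
    o.elim (fun z => min (analyticOrderNatAt G z) k) fun _ => analyticOrderNatAt F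
  have h := sum_weightCounting_le (c := c) (I := {()}) (J := Finset.univ)
    (m := fun _ z => min (analyticOrderNatAt (fun w => F w ^ n * G w) z) k) (m' := m) h₀ hr ?_ ?_ ?_
  · rw [Finset.sum_singleton, Fintype.sum_option] at h
    simp only [m, Option.elim, Finset.sum_const, Finset.card_univ, Fintype.card_fin,
      nsmul_eq_mul] at h
    linarith
  · exact fun _ _ => locallyFiniteWeight_min ((hF.fun_pow n).mul hG) hFG k
  · rintro (_ | i) -
    · exact locallyFiniteWeight_min hG hGne k
    · exact locallyFiniteWeight_order hF hFne
  · intro z hz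
    have := min_order_pow_mul_le (hF.analyticOnNhd (isOpen_Omega c) z hz)
      (hG.analyticOnNhd (isOpen_Omega c) z hz) (order_ne_top_Omega hF hFne z hz)
      (order_ne_top_Omega hG hGne z hz) n k
    rw [Finset.sum_singleton, Fintype.sum_option]
    simp only [m, Option.elim, Finset.sum_const, Finset.card_univ, Fintype.card_fin, smul_eq_mul]
    linarith

/-- `hT` says `log r = o(T)`, so `T → ∞` and constants are negligible; `log S = o(T)` because `S`
grows at most linearly in `T`. -/
theorem isLittleO_error {T S : ℝ → ℝ} {r₀ a A : ℝ} (ha : 0 ≤ a)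
    (hT : ∀ K, ∀ᶠ r : ℝ in atTop, K * Real.log r ≤ T r) (hS1 : ∀ t ∈ Ici r₀, 1 ≤ S t)
    (hS : ∀ t, r₀ ≤ t → S t ≤ a * T t + A) (C C' : ℝ) :
    (fun r => C * (Real.log r + Real.log (S r) + 1) + C') =o[atTop] T := by
  have htend : Tendsto T atTop atTop :=
    tendsto_atTop_mono' _ ((hT 1).mono fun r hr => by rwa [one_mul] at hr) Real.tendsto_log_atTop
  have hconst : ∀ y : ℝ, (fun _ : ℝ => y) =o[atTop] T := fun y =>
    Asymptotics.isLittleO_const_left.2 (Or.inr (tendsto_norm_atTop_atTop.comp htend))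
  have hlog : (fun r : ℝ => Real.log r) =o[atTop] T := by
    refine Asymptotics.isLittleO_iff.2 fun ε hε => ?_
    filter_upwards [hT ε⁻¹, eventually_ge_atTop 1] with r hr hr1
    rw [Real.norm_of_nonneg (Real.log_nonneg hr1)]
    rw [inv_mul_le_iff₀ hε] at hr
    exact hr.trans (mul_le_mul_of_nonneg_left (le_abs_self _) hε.le)
  have hlogS : (fun r : ℝ => Real.log (S r)) =o[atTop] T := by
    have hU : Tendsto (fun r => (a + 1) * T r + A) atTop atTop :=
      tendsto_atTop_add_const_right _ _ (htend.const_mul_atTop (by linarith))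
    have h1 := Real.isLittleO_log_id_atTop.comp_tendsto hU
    have h2 : (fun r => (a + 1) * T r + A) =O[atTop] T :=
      ((Asymptotics.isBigO_refl T atTop).const_mul_left _).add (hconst A).isBigO
    refine Asymptotics.IsBigO.trans_isLittleO ?_ (h1.trans_isBigO h2)
    refine Asymptotics.IsBigO.of_bound 1 ?_
    filter_upwards [eventually_ge_atTop r₀, htend.eventually_ge_atTop 0] with r hr hTr
    have h3 := hS1 r hr
    have h4 := hS r hr
    have h5 : Real.log (S r) ≤ Real.log ((a + 1) * T r + A) :=
      Real.log_le_log (by linarith) (by linarith)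
    rw [Real.norm_of_nonneg (Real.log_nonneg h3), one_mul]
    exact h5.trans (le_abs_self _)
  exact (((hlog.add hlogS).add (hconst 1)).const_mul_left C).add (hconst C')

end PuncturedPlane

end

/-! ### The theorem. -/

open PuncturedPlane in
theorem theorem10
    (M : ℕ) (hM : 2 ≤ M) (c : Fin M → ℂ) (hc : Function.Injective c)
    (N : ℕ) (hN : 1 ≤ N) (f : ℂ → Fin (N + 1) → ℂ)
    (hf : PuncturedPlane.IsHolomorphicCurve c f)
    (hnd : PuncturedPlane.IsAlgebraicallyNondegenerate c f)
    (hrat : N = 1 → ¬ PuncturedPlane.IsRationalCurve c f)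
    (d n : ℕ) (hn : N * (d + N + 1) < n)
    (H Q : Fin (N + 1) → MvPolynomial (Fin (N + 1)) ℂ)
    (hH : ∀ i, (H i).IsHomogeneous 1)
    (hQ : ∀ i, (Q i).IsHomogeneous d)
    (hgen : PuncturedPlane.InGeneralPosition (fun i => H i ^ n * Q i)) :
    ∃ (E : Set ℝ) (ε : ℝ → ℝ),
      MeasurableSet E ∧ MeasureTheory.volume E < ⊤ ∧
      ε =o[Filter.atTop] PuncturedPlane.characteristic c f ∧
      ∀ r : ℝ, PuncturedPlane.rZero c < r → r ∉ E →
        ((n : ℝ) - ((d : ℝ) + (N : ℝ) + 1) * (N : ℝ)) * PuncturedPlane.characteristic c f r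
            + ∑ i, (PuncturedPlane.counting c f (Q i) r
                - PuncturedPlane.truncCounting c f N (Q i) r)
          ≤ PuncturedPlane.truncCounting c f N (∑ i, H i ^ n * Q i) r + ε r := by
  have hn0 : n ≠ 0 := by omega
  have h₀ := separated_rZero hM hc
  set P : Fin (N + 1) → MvPolynomial (Fin (N + 1)) ℂ := fun i => H i ^ n * Q i with hPdef
  have hP : ∀ i, (P i).IsHomogeneous (n + d) := fun i => by
    simpa using ((hH i).pow n).mul (hQ i)
  have h0 : ∀ x : Fin (N + 1) → ℂ, x ≠ 0 → ∃ i, MvPolynomial.eval x (P i) ≠ 0 := by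
    intro x hx
    by_contra! hcon
    exact hgen Finset.univ (by simp) ⟨x, hx, fun i _ => hcon i⟩
  have he : n + d ≠ 0 := by omega
  have hPne : ∀ i, P i ≠ 0 := ne_zero_of_no_common_zero hP he h0
  have hHne : ∀ i, H i ≠ 0 := fun i h => hPne i (by simp [hPdef, h, hn0])
  have hQne : ∀ i, Q i ≠ 0 := fun i h => hPne i (by simp [hPdef, h])
  obtain ⟨S, A, hA, hS, hS1, hTS, hST⟩ := exists_growth_function hN h₀ hf hnd
  obtain ⟨C, hC, hsmt⟩ := second_main_theorem hA h₀ hS hS1 hTS hf hnd he hP h0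
  obtain ⟨E, hEm, hEv, hE⟩ := exists_borel_exceptional hS hS1
  choose B hB hHB using fun i => exists_weightCounting_eval_le h₀ hf hnd (hH i) (hHne i)
  choose B' hB' hQB using fun i => exists_weightCounting_eval_le h₀ hf hnd (hQ i) (hQne i)
  -- The bounded interval removes the radii with `r ≤ r₀ + 1` or `r ≤ 2`, where the second main
  -- theorem is not available.
  refine ⟨E ∪ Set.Ioc (rZero c) (max (rZero c + 1) 2),
    fun r => C * (Real.log r + Real.log (S r) + 1) + (N * ∑ i, B i + ∑ i, B' i),
    hEm.union measurableSet_Ioc, MeasureTheory.measure_union_lt_top hEv (by simp),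
    isLittleO_error (Nat.cast_nonneg N)
      (eventually_mul_log_le_characteristic hN h₀ hf hnd hrat) hS1 hST _ _, fun r hr hrE => ?_⟩
  have hrE' : r ∉ E := fun h => hrE (Or.inl h)
  have hr1 : max (rZero c + 1) 2 < r := by
    by_contra! h
    exact hrE (Or.inr ⟨hr, h⟩)
  have h1 := hsmt r ((le_max_left _ _).trans hr1.le) ((le_max_right _ _).trans hr1.le)
    (hE r hr.le hrE').le
  have h2 : ∀ i, weightCounting c (fun z => min
      (analyticOrderNatAt (fun w => MvPolynomial.eval (f w) (P i)) z) N) (rZero c) r ≤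
      N * (characteristic c f r + B i) + truncCounting c f N (Q i) r := by
    intro i
    have h3 := weightCounting_min_pow_mul_le h₀ hr.le (differentiableOn_eval hf (H i))
      (differentiableOn_eval hf (Q i)) (n := n)
      (by simpa [hPdef] using exists_eval_ne_zero hnd (hP i) (hPne i)) hn0 N
    have h4 := hHB i r hr.le
    rw [Nat.cast_one, one_mul] at h4
    have h5 := mul_le_mul_of_nonneg_left h4 (Nat.cast_nonneg (α := ℝ) N)
    have h6 : (fun w => MvPolynomial.eval (f w) (P i)) = fun w =>
        MvPolynomial.eval (f w) (H i) ^ n * MvPolynomial.eval (f w) (Q i) := by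
      funext w
      simp [hPdef]
    rw [h6]
    exact h3.trans (add_le_add h5 le_rfl)
  have h3 := Finset.sum_le_sum fun i (_ : i ∈ Finset.univ) => h2 i
  have h4 : ∑ i, counting c f (Q i) r ≤ ∑ i, (d * characteristic c f r + B' i) :=
    Finset.sum_le_sum fun i _ => hQB i r hr.le
  have h5 : weightCounting c (fun z => min
      (analyticOrderNatAt (fun w => MvPolynomial.eval (f w) (∑ i, P i)) z) N) (rZero c) r =
      truncCounting c f N (∑ i, P i) r := rfl
  simp only [Finset.sum_add_distrib, ← Finset.mul_sum, Finset.sum_const, Finset.card_univ,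
    Fintype.card_fin, nsmul_eq_mul] at h3 h4
  rw [h5] at h1
  push_cast at h1 h3 h4
  rw [Finset.sum_sub_distrib]
  -- The forms `H i` cost `N (N + 1) T` and the untruncated counts of the `Q i` cost `(N + 1) d T`;
  -- what remains is `n + d - N (N + 1) - (N + 1) d = n - (d + N + 1) N`.
  linarith
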